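/- Let $K$ be a field of characteristic $0$ and let $\mathfrak g=\bigoplus_{d\in\mathbb Z}\mathfrak g^d$ be an $L_\infty$-algebra over $K$: a $\mathbb Z$-graded vector space with graded antisymmetric brackets $[x_1,\dots,x_k]$, $k\ge 1$, of degree $2-k$ (with $\delta=[\,\cdot\,]$) such that for all $n\ge1$ and homogeneous $x_1,\dots,x_n$ $$\sum_{k=1}^n(-1)^k\sum_{\substack{i_1<\dots<i_k,\ j_1<\dots<j_{n-k}\\ \{i\}\sqcup\{j\}=\{1,\dots,n\}}}(-1)^{\varepsilon}\,[[x_{i_1},\dots,x_{i_k}],x_{j_1},\dots,x_{j_{n-k}}]=0,$$ where $x_1\wedge\dots\wedge x_n=(-1)^{\varepsilon}x_{i_1}\wedge\dots\wedge x_{i_k}\wedge x_{j_1}\wedge\dots\wedge x_{j_{n-k}}$. Its lower central series is $F^i\mathfrak g=\mathfrak g$ for $i\le 1$ and $F^{i+1}\mathfrak g=\sum_{k\ge 2}\sum_{i_1+\dots+i_k=i,\ i_j\le i}[F^{i_1}\mathfrak g,\dots,F^{i_k}\mathfrak g]$ for $i\ge1$; $\mathfrak g$ is nilpotent if $F^i\mathfrak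 g=0$ for some $i$, and abelian if all brackets with $k\ge2$ vanish. Let $\Omega_n$ be the commutative differential graded algebra of polynomial differential forms on the $n$-simplex (generators $t_0,\dots,t_n$ of degree $0$ and $dt_0,\dots,dt_n$ of degree $1$, relations $\sum t_i=1$, $\sum dt_i=0$), and give $\mathfrak g\otimes\Omega_n$ the brackets extended with Koszul signs, with differential $\delta\otimes 1+1\otimes d$. For nilpotent $\mathfrak g$ let $\Sigma(\mathfrak g)$ be the simplicial set with $$\Sigma_n(\mathfrak g)=\operatorname{MC}(\mathfrak g\otimes\Omega_n)=\Big\{\mu\in(\mathfrak g\otimes\Omega_n)^1 : \delta_{\mathrm{tot}}\mu+\sum_{k\ge2}\tfrac1{k!}[\mu,\dots,\mu]=0\Big\},$$ where $\delta_{\mathrm{tot}}=\delta\otimes1+1\otimes d$. If $\mathfrak a$ is abelian, addition makes $\Sigma(\mathfrak a)$ a simplicial abelian group. Suppose that $\mathfrak g$ is nilpotent. Then $\Sigma(\mathfrak g)$ is a Kan simplicial set. Moreover, it is an iterated principal fibration along the lower central series: each $\mathfrak g/F^i\mathfrak g$ carries an $L_\infty$-structure for which $\mathfrak g\to\mathfrak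 g/F^i\mathfrak g$ is a (strict) map of $L_\infty$-algebras, it is nilpotent, and $F^i\mathfrak g/F^{i+1}\mathfrak g$ is an abelian $L_\infty$-subalgebra of $\mathfrak g/F^{i+1}\mathfrak g$; $\Sigma(\mathfrak g/F^1\mathfrak g)$ is a point; $\Sigma(\mathfrak g)\to\Sigma(\mathfrak g/F^N\mathfrak g)$ is an isomorphism whenever $F^N\mathfrak g=0$; and for each $i\ge1$ the image of $\Sigma(\mathfrak g/F^{i+1}\mathfrak g)\to\Sigma(\mathfrak g/F^i\mathfrak g)$ is a union of connected components, onto which this map is a principal fibration with group $\Sigma(F^i\mathfrak g/F^{i+1}\mathfrak g)$ acting by addition (that is, the action is free and its orbits are exactly the fibres of the map). -/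

import Mathlib

open scoped TensorProduct

universe u v

noncomputable section

/-! ### L-infinity algebras -/

section Signs

/-- The sign of the passage from `x₁ ∧ … ∧ x_k` to `x_{σ 1} ∧ … ∧ x_{σ k}` in the graded exterior
power, for homogeneous `x_i` of degree `d i`: each inversion of `σ` contributes
`-(-1)^{|x||y|}`. -/
def wedgeSign {k : ℕ} (d : Fin k → ℤ) (σ : Equiv.Perm (Fin k)) : ℤˣ :=
  ∏ i : Fin k, ∏ j : Fin k,
    if i < j ∧ σ j < σ i then -(d (σ i) * d (σ j)).negOnePow else 1

/-- The sign of the passage from `x₁ ∧ … ∧ x_n` to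
`x_{i_1} ∧ … ∧ x_{i_k} ∧ x_{j_1} ∧ … ∧ x_{j_{n-k}}`, where `S = {i_1 < … < i_k}` and
`Sᶜ = {j_1 < … < j_{n-k}}`. -/
def unshuffleSign {n : ℕ} (d : Fin n → ℤ) (S : Finset (Fin n)) : ℤˣ :=
  ∏ a ∈ S, ∏ b ∈ Sᶜ, if b < a then -(d a * d b).negOnePow else 1

end Signs

/-- An `L∞`-algebra structure on the `K`-vector space `V`: a `ℤ`-grading of `V` and graded
antisymmetric brackets `[x₁, …, x_k]` of degree `2 - k`, `k ≥ 1`, satisfying the Jacobi identities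
`∑_{k = 1}^n (-1)^k ∑ ± [[x_{i_1}, …, x_{i_k}], x_{j_1}, …, x_{j_{n-k}}] = 0`
(sum over all `i_1 < … < i_k`, `j_1 < … < j_{n-k}` partitioning `{1, …, n}`).
There is no bracket of arity `0`; the map `bracket 0` is required to vanish. -/
structure LInfinityAlgebra (K : Type v) (V : Type u) [Field K] [AddCommGroup V] [Module K V] where
  grading : ℤ → Submodule K V
  isInternal : DirectSum.IsInternal grading
  bracket : ∀ k : ℕ, MultilinearMap K (fun _ : Fin k => V) V
  bracket_zero : bracket 0 = 0
  bracket_mem : ∀ (k : ℕ) (d : Fin k → ℤ) (x : Fin k → V), (∀ i, x i ∈ grading (d i)) →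
    bracket k x ∈ grading (∑ i, d i + 2 - k)
  bracket_perm : ∀ (k : ℕ) (d : Fin k → ℤ) (x : Fin k → V), (∀ i, x i ∈ grading (d i)) →
    ∀ σ : Equiv.Perm (Fin k), bracket k (fun i => x (σ i)) = wedgeSign d σ • bracket k x
  jacobi : ∀ (n : ℕ) (d : Fin n → ℤ) (x : Fin n → V), (∀ i, x i ∈ grading (d i)) →
    ∑ S : Finset (Fin n), ((-1 : ℤˣ) ^ S.card * unshuffleSign d S) •
      bracket (Sᶜ.card + 1)
        (Fin.cons (bracket S.card fun i => x (S.orderEmbOfFin rfl i))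
          fun j => x (Sᶜ.orderEmbOfFin rfl j)) = 0

namespace LInfinityAlgebra

section Basic

variable {K : Type v} {V W : Type u} [Field K] [AddCommGroup V] [Module K V]
  [AddCommGroup W] [Module K W]

/-- All operations of valency two and higher vanish. -/
def IsAbelian (g : LInfinityAlgebra K V) : Prop :=
  ∀ k, 2 ≤ k → g.bracket k = 0

/-- The lower central series: `F⁰ = F¹ = V`, and for `i ≥ 1`, `F^{i+1}` is spanned by all
`[x₁, …, x_k]` with `k ≥ 2`, `x_j ∈ F^{i_j}`, `i_1 + … + i_k = i` (and all `i_j ≤ i`). -/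
def lcs (g : LInfinityAlgebra K V) : ℕ → Submodule K V
  | 0 => ⊤
  | 1 => ⊤
  | i + 2 => Submodule.span K
      {y | ∃ k, 2 ≤ k ∧ ∃ d : Fin k → Fin (i + 2), ∑ j, (d j : ℕ) = i + 1 ∧
        ∃ x : Fin k → V, (∀ j, x j ∈ lcs g (d j)) ∧ y = g.bracket k x}
decreasing_by exact (d j).2

def IsNilpotent (g : LInfinityAlgebra K V) : Prop :=
  ∃ i, g.lcs i = ⊥

/-- A linear map that is a (strict) map of `L∞`-algebras. -/
structure IsHom (g : LInfinityAlgebra K V) (h : LInfinityAlgebra K W) (f : V →ₗ[K] W) : Prop where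
  map_grading : ∀ d, ∀ x ∈ g.grading d, f x ∈ h.grading d
  map_bracket : ∀ k (x : Fin k → V), f (g.bracket k x) = h.bracket k (fun i => f (x i))

lemma IsHom.id (g : LInfinityAlgebra K V) : IsHom g g LinearMap.id :=
  ⟨fun _ _ h => h, fun _ _ => rfl⟩

/-- In a nilpotent `L∞`-algebra only finitely many brackets are nonzero. -/
lemma IsNilpotent.bracket_eq_zero {g : LInfinityAlgebra K V} (hg : g.IsNilpotent) :
    ∃ N, ∀ k, N ≤ k → g.bracket k = 0 := by
  obtain ⟨i, hi⟩ := hg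
  refine ⟨i + 3, fun k hk => ?_⟩
  ext x
  rcases i with _ | _ | i
  · have h : ∀ y : V, y = 0 := fun y => by
      have : y ∈ g.lcs 0 := by rw [lcs]; trivial
      rwa [hi] at this
    exact h _
  · have h : ∀ y : V, y = 0 := fun y => by
      have : y ∈ g.lcs 1 := by rw [lcs]; trivial
      rwa [hi] at this
    exact h _
  · have : g.bracket k x ∈ g.lcs (i + 2) := by
      rw [lcs]
      refine Submodule.subset_span ⟨k, by omega,
        fun j => if (j : ℕ) < i + 1 then 1 else 0, ?_, x, fun j => ?_, rfl⟩
      · have h1 : ∀ j : Fin k, (((if (j : ℕ) < i + 1 then 1 else 0 : Fin (i + 2)) : Fin (i + 2)) : ℕ)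
            = if (j : ℕ) < i + 1 then 1 else 0 := by
          intro j; split_ifs <;> simp
        simp only [h1]
        rw [Fin.sum_univ_eq_sum_range (fun j => if j < i + 1 then 1 else 0) k,
          Finset.sum_ite, Finset.sum_const_zero, add_zero, Finset.sum_const, smul_eq_mul, mul_one]
        have : (Finset.range k).filter (fun j => j < i + 1) = Finset.range (i + 1) := by
          ext j; simp; omega
        rw [this, Finset.card_range]
      · dsimp only
        split_ifs
        · have : ((1 : Fin (i + 2)) : ℕ) = 1 := by simp
          rw [this, lcs]; trivial
        · have : ((0 : Fin (i + 2)) : ℕ) = 0 := by simp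
          rw [this, lcs]; trivial
    rw [hi] at this
    simpa using this

/-- The projection of `V` onto its part of parity `p`. -/
def parityProj (g : LInfinityAlgebra K V) (p : ZMod 2) : V →ₗ[K] V :=
  DirectSum.toModule K ℤ V (fun d => if (d : ZMod 2) = p then (g.grading d).subtype else 0) ∘ₗ
    (LinearEquiv.ofBijective (DirectSum.coeLinearMap g.grading) g.isInternal).symm.toLinearMap

lemma parityProj_of_mem (g : LInfinityAlgebra K V) (p : ZMod 2) {d : ℤ} {x : V}
    (hx : x ∈ g.grading d) : g.parityProj p x = if (d : ZMod 2) = p then x else 0 := by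
  have h : (LinearEquiv.ofBijective (DirectSum.coeLinearMap g.grading) g.isInternal).symm x =
      DirectSum.lof K ℤ (fun d => g.grading d) d ⟨x, hx⟩ := by
    rw [LinearEquiv.symm_apply_eq]
    exact (DirectSum.coeLinearMap_lof g.grading d ⟨x, hx⟩).symm
  simp only [parityProj, LinearMap.comp_apply, LinearEquiv.coe_coe]
  rw [h, DirectSum.toModule_lof]
  split_ifs <;> simp

/-- A linear map on a graded vector space is determined by its values on homogeneous elements. -/
lemma hom_ext_of_homogeneous (g : LInfinityAlgebra K V) {f₁ f₂ : V →ₗ[K] W}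
    (h : ∀ d, ∀ x ∈ g.grading d, f₁ x = f₂ x) : f₁ = f₂ := by
  apply LinearMap.ext_on (s := ⋃ d, (g.grading d : Set V))
  · rw [← Submodule.iSup_eq_span]
    exact g.isInternal.submodule_iSup_eq_top
  · intro x hx
    obtain ⟨d, hd⟩ := Set.mem_iUnion.1 hx
    exact h d x hd

lemma IsHom.parityProj {g : LInfinityAlgebra K V} {h : LInfinityAlgebra K W} {f : V →ₗ[K] W}
    (hf : IsHom g h f) (p : ZMod 2) : f ∘ₗ g.parityProj p = h.parityProj p ∘ₗ f := by
  apply hom_ext_of_homogeneous g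
  intro d x hx
  simp only [LinearMap.comp_apply]
  rw [g.parityProj_of_mem p hx, h.parityProj_of_mem p (hf.map_grading d x hx)]
  split_ifs <;> simp

end Basic

end LInfinityAlgebra

/-! ### Polynomial differential forms on the simplex -/

section Forms

variable (K : Type v) [Field K]

/-- The relations among the generators `t_i = inl i` (of degree `0`) and `dt_i = inr i`
(of degree `1`): graded commutativity, `∑ t_i = 1` and `∑ dt_i = 0`. -/
inductive FormRel (n : ℕ) : FreeAlgebra K (Fin (n + 1) ⊕ Fin (n + 1)) →
    FreeAlgebra K (Fin (n + 1) ⊕ Fin (n + 1)) → Prop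
  | t_t (i j : Fin (n + 1)) : FormRel n
      (FreeAlgebra.ι K (.inl i) * FreeAlgebra.ι K (.inl j))
      (FreeAlgebra.ι K (.inl j) * FreeAlgebra.ι K (.inl i))
  | t_dt (i j : Fin (n + 1)) : FormRel n
      (FreeAlgebra.ι K (.inl i) * FreeAlgebra.ι K (.inr j))
      (FreeAlgebra.ι K (.inr j) * FreeAlgebra.ι K (.inl i))
  | dt_dt (i j : Fin (n + 1)) : FormRel n
      (FreeAlgebra.ι K (.inr i) * FreeAlgebra.ι K (.inr j))
      (-(FreeAlgebra.ι K (.inr j) * FreeAlgebra.ι K (.inr i)))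
  | sum_t : FormRel n (∑ i, FreeAlgebra.ι K (.inl i)) 1
  | sum_dt : FormRel n (∑ i, FreeAlgebra.ι K (.inr i)) 0

/-- The algebra `Ω_n` of polynomial differential forms on the `n`-simplex, over a field of
characteristic zero. -/
def Forms (n : ℕ) : Type v := RingQuot (FormRel K n)

instance (n : ℕ) : Ring (Forms K n) := inferInstanceAs (Ring (RingQuot (FormRel K n)))

instance (n : ℕ) : Algebra K (Forms K n) :=
  inferInstanceAs (Algebra K (RingQuot (FormRel K n)))

namespace Forms

/-- The quotient map from the free algebra on the generators. -/
def mk (n : ℕ) : FreeAlgebra K (Fin (n + 1) ⊕ Fin (n + 1)) →ₐ[K] Forms K n :=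
  RingQuot.mkAlgHom K (FormRel K n)

variable {K} in
lemma mk_rel {n : ℕ} {a b : FreeAlgebra K (Fin (n + 1) ⊕ Fin (n + 1))} (h : FormRel K n a b) :
    mk K n a = mk K n b :=
  RingQuot.mkAlgHom_rel K h

/-- The barycentric coordinate `t_i`. -/
def t {n : ℕ} (i : Fin (n + 1)) : Forms K n :=
  mk K n (FreeAlgebra.ι K (.inl i))

/-- The one-form `dt_i`. -/
def dt {n : ℕ} (i : Fin (n + 1)) : Forms K n :=
  mk K n (FreeAlgebra.ι K (.inr i))

variable {K} {n : ℕ}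

lemma t_mul_t (i j : Fin (n + 1)) : t K i * t K j = t K j * t K i := by
  simpa only [map_mul, t, dt] using mk_rel (FormRel.t_t (K := K) i j)

lemma t_mul_dt (i j : Fin (n + 1)) : t K i * dt K j = dt K j * t K i := by
  simpa only [map_mul, t, dt] using mk_rel (FormRel.t_dt (K := K) i j)

lemma dt_mul_dt (i j : Fin (n + 1)) : dt K i * dt K j = -(dt K j * dt K i) := by
  have h := mk_rel (FormRel.dt_dt (K := K) i j)
  rw [map_neg, map_mul, map_mul] at h
  exact h

lemma sum_t : ∑ i : Fin (n + 1), t K i = 1 := by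
  simpa only [map_sum, map_one, t, dt] using
    mk_rel (FormRel.sum_t (K := K) (n := n))

lemma sum_dt : ∑ i : Fin (n + 1), dt K i = 0 := by
  simpa only [map_sum, map_zero, t, dt] using
    mk_rel (FormRel.sum_dt (K := K) (n := n))

lemma liftAux_rel {B : Type*} [Ring B] [Algebra K B] {x y : Fin (n + 1) → B}
    (hxx : ∀ i j, x i * x j = x j * x i) (hxy : ∀ i j, x i * y j = y j * x i)
    (hyy : ∀ i j, y i * y j = -(y j * y i)) (hx : ∑ i, x i = 1) (hy : ∑ i, y i = 0)
    ⦃a b : FreeAlgebra K (Fin (n + 1) ⊕ Fin (n + 1))⦄ (h : FormRel K n a b) :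
    FreeAlgebra.lift K (Sum.elim x y) a = FreeAlgebra.lift K (Sum.elim x y) b := by
  induction h with
  | t_t i j => simpa using hxx i j
  | t_dt i j => simpa using hxy i j
  | dt_dt i j => simpa using hyy i j
  | sum_t => simpa using hx
  | sum_dt => simpa using hy

/-- The universal property of `Ω_n`. -/
def lift {B : Type*} [Ring B] [Algebra K B] (x y : Fin (n + 1) → B)
    (hxx : ∀ i j, x i * x j = x j * x i) (hxy : ∀ i j, x i * y j = y j * x i)
    (hyy : ∀ i j, y i * y j = -(y j * y i)) (hx : ∑ i, x i = 1) (hy : ∑ i, y i = 0) :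
    Forms K n →ₐ[K] B :=
  RingQuot.liftAlgHom K ⟨FreeAlgebra.lift K (Sum.elim x y), liftAux_rel hxx hxy hyy hx hy⟩

section lift

variable {B : Type*} [Ring B] [Algebra K B] {x y : Fin (n + 1) → B}
    {hxx : ∀ i j, x i * x j = x j * x i} {hxy : ∀ i j, x i * y j = y j * x i}
    {hyy : ∀ i j, y i * y j = -(y j * y i)} {hx : ∑ i, x i = 1} {hy : ∑ i, y i = 0}

@[simp] lemma lift_t (i : Fin (n + 1)) : lift (K := K) x y hxx hxy hyy hx hy (t K i) = x i := by
  have h := RingQuot.liftAlgHom_mkAlgHom_apply K (FreeAlgebra.lift K (Sum.elim x y))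
    (liftAux_rel hxx hxy hyy hx hy) (FreeAlgebra.ι K (.inl i))
  rw [FreeAlgebra.lift_ι_apply] at h
  exact h

@[simp] lemma lift_dt (i : Fin (n + 1)) : lift (K := K) x y hxx hxy hyy hx hy (dt K i) = y i := by
  have h := RingQuot.liftAlgHom_mkAlgHom_apply K (FreeAlgebra.lift K (Sum.elim x y))
    (liftAux_rel hxx hxy hyy hx hy) (FreeAlgebra.ι K (.inr i))
  rw [FreeAlgebra.lift_ι_apply] at h
  exact h

lemma algHom_ext {f g : Forms K n →ₐ[K] B} (ht : ∀ i, f (t K i) = g (t K i))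
    (hdt : ∀ i, f (dt K i) = g (dt K i)) : f = g := by
  apply RingQuot.ringQuot_ext'
  apply FreeAlgebra.hom_ext
  funext i
  rcases i with i | i
  · exact ht i
  · exact hdt i

end lift

/-- The parity automorphism `ω ↦ (-1)^{|ω|} ω`. -/
def parity : Forms K n →ₐ[K] Forms K n :=
  lift (t K) (fun i => -dt K i) t_mul_t (fun i j => by simp [t_mul_dt])
    (fun i j => by simp [dt_mul_dt i j]) sum_t (by simp [sum_dt])

@[simp] lemma parity_t (i : Fin (n + 1)) : parity (t K i) = t K i := lift_t i
@[simp] lemma parity_dt (i : Fin (n + 1)) : parity (dt K i) = -dt K i := lift_dt i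

/-- The algebra map `ω ↦ !![(-1)^{|ω|} ω, dω; 0, ω]`; that it is multiplicative amounts to the
graded Leibniz rule `d(ω η) = dω η + (-1)^{|ω|} ω dη`. -/
def dMatrix : Forms K n →ₐ[K] Matrix (Fin 2) (Fin 2) (Forms K n) :=
  lift (fun i => !![t K i, dt K i; 0, t K i]) (fun i => !![-dt K i, 0; 0, dt K i])
    (fun i j => by
      simp only [Matrix.mul_fin_two, t_mul_t i j, t_mul_dt, mul_zero, zero_mul, add_zero, zero_add]
      rw [add_comm])
    (fun i j => by simp [t_mul_dt, dt_mul_dt i j])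
    (fun i j => by
      ext a b
      fin_cases a <;> fin_cases b <;> simp [dt_mul_dt i j])
    (by
      ext a b
      fin_cases a <;> fin_cases b <;> simp [Matrix.sum_apply, sum_t, sum_dt])
    (by
      ext a b
      fin_cases a <;> fin_cases b <;> simp [Matrix.sum_apply, sum_dt])

/-- The de Rham differential: the derivation of degree one with `t_i ↦ dt_i` and `dt_i ↦ 0`. -/
def d : Forms K n →ₗ[K] Forms K n where
  toFun a := dMatrix a 0 1
  map_add' a b := by simp
  map_smul' r a := by simp

@[simp] lemma d_t (i : Fin (n + 1)) : d (t K i) = dt K i := by simp [d, dMatrix]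
@[simp] lemma d_dt (i : Fin (n + 1)) : d (dt K i) = 0 := by simp [d, dMatrix]

lemma induction {P : Forms K n → Prop} (hK : ∀ r : K, P (algebraMap K _ r))
    (ht : ∀ i, P (t K i)) (hdt : ∀ i, P (dt K i)) (hadd : ∀ a b, P a → P b → P (a + b))
    (hmul : ∀ a b, P a → P b → P (a * b)) (a : Forms K n) : P a := by
  obtain ⟨a, rfl⟩ : ∃ b, mk K n b = a := RingQuot.mkAlgHom_surjective K (FormRel K n) a
  induction a using FreeAlgebra.induction with
  | grade0 r => rw [AlgHom.commutes]; exact hK r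
  | grade1 i =>
    rcases i with i | i
    · exact ht i
    · exact hdt i
  | mul a b ha hb => rw [map_mul]; exact hmul _ _ ha hb
  | add a b ha hb => rw [map_add]; exact hadd _ _ ha hb

lemma dMatrix_apply (a : Forms K n) : dMatrix a = !![parity a, d a; 0, a] := by
  have h1 : ∀ a : Forms K n, dMatrix a 0 0 = parity a ∧ dMatrix a 1 0 = 0 ∧ dMatrix a 1 1 = a := by
    intro a
    induction a using Forms.induction with
    | hK r => simp [Matrix.algebraMap_matrix_apply]
    | ht i => simp [dMatrix]
    | hdt i => simp [dMatrix]
    | hadd a b ha hb => simp [ha, hb]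
    | hmul a b ha hb => simp [Matrix.mul_apply, ha, hb]
  obtain ⟨h00, h10, h11⟩ := h1 a
  ext i j
  fin_cases i <;> fin_cases j <;> simp [h00, h10, h11, d]

lemma d_mul (a b : Forms K n) : d (a * b) = d a * b + parity a * d b := by
  have h : dMatrix (a * b) 0 1 = (dMatrix a * dMatrix b) 0 1 := by rw [map_mul]
  rw [dMatrix_apply, dMatrix_apply, dMatrix_apply] at h
  simp only [Matrix.mul_fin_two] at h
  simpa [add_comm] using h

variable (K n) in
/-- The forms of degree `p`: sums of `f dt_{i_1} ⋯ dt_{i_p}`, with `f` a polynomial in the `t_i`. -/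
def homogeneous (p : ℕ) : Submodule K (Forms K n) :=
  Subalgebra.toSubmodule (Algebra.adjoin K (Set.range (t K))) *
    (Submodule.span K (Set.range (dt K))) ^ p

/-- The pullback of forms `Ω_n → Ω_m` along the affine map of simplices that sends the `j`-th
vertex to the `θ j`-th vertex. -/
def pullback {m n : ℕ} (θ : Fin (m + 1) → Fin (n + 1)) : Forms K n →ₐ[K] Forms K m :=
  lift (fun i => ∑ j with θ j = i, t K j) (fun i => ∑ j with θ j = i, dt K j)
    (fun i j => by
      simp only [Finset.sum_mul_sum]
      rw [Finset.sum_comm]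
      exact Finset.sum_congr rfl fun _ _ => Finset.sum_congr rfl fun _ _ => t_mul_t _ _)
    (fun i j => by
      simp only [Finset.sum_mul_sum]
      rw [Finset.sum_comm]
      exact Finset.sum_congr rfl fun _ _ => Finset.sum_congr rfl fun _ _ => t_mul_dt _ _)
    (fun i j => by
      simp only [Finset.sum_mul_sum, ← Finset.sum_neg_distrib]
      rw [Finset.sum_comm]
      exact Finset.sum_congr rfl fun _ _ => Finset.sum_congr rfl fun _ _ => dt_mul_dt _ _)
    (by rw [Finset.sum_fiberwise]; exact sum_t)
    (by rw [Finset.sum_fiberwise]; exact sum_dt)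

@[simp] lemma pullback_t {m n : ℕ} (θ : Fin (m + 1) → Fin (n + 1)) (i : Fin (n + 1)) :
    pullback θ (t K i) = ∑ j with θ j = i, t K j := lift_t i

@[simp] lemma pullback_dt {m n : ℕ} (θ : Fin (m + 1) → Fin (n + 1)) (i : Fin (n + 1)) :
    pullback θ (dt K i) = ∑ j with θ j = i, dt K j := lift_dt i

lemma pullback_id : pullback (K := K) (fun i : Fin (n + 1) => i) = AlgHom.id K _ := by
  apply algHom_ext <;> intro i <;> simp [Finset.filter_eq']

lemma pullback_comp {l m n : ℕ} (θ : Fin (m + 1) → Fin (n + 1)) (η : Fin (l + 1) → Fin (m + 1)) :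
    pullback (K := K) (fun i => θ (η i)) = (pullback η).comp (pullback θ) := by
  have key : ∀ (f : Fin (l + 1) → Forms K l) (i : Fin (n + 1)),
      ∑ j with θ (η j) = i, f j = ∑ k with θ k = i, ∑ j with η j = k, f j := by
    intro f i
    rw [Finset.sum_sigma']
    refine Finset.sum_bij' (fun j _ => ⟨η j, j⟩) (fun p _ => p.2) ?_ ?_ ?_ ?_ ?_
    · intro j hj; simpa using hj
    · rintro ⟨k, j⟩ h
      simp only [Finset.mem_sigma, Finset.mem_filter, Finset.mem_univ, true_and] at h ⊢
      rw [h.2, h.1]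
    · intro j _; rfl
    · rintro ⟨k, j⟩ h
      simp only [Finset.mem_sigma, Finset.mem_filter, Finset.mem_univ, true_and] at h
      obtain ⟨_, rfl⟩ := h
      rfl
    · intro j _; rfl
  apply algHom_ext <;> intro i <;> simp [key, map_sum]

lemma pullback_parity {m n : ℕ} (θ : Fin (m + 1) → Fin (n + 1)) :
    (pullback θ).comp (parity (K := K)) = parity.comp (pullback θ) := by
  apply algHom_ext <;> intro i <;> simp [map_sum]

lemma pullback_d {m n : ℕ} (θ : Fin (m + 1) → Fin (n + 1)) (a : Forms K n) :
    pullback θ (d a) = d (pullback θ a) := by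
  have h : (AlgHom.mapMatrix (pullback θ)).comp (dMatrix (K := K)) = dMatrix.comp (pullback θ) := by
    apply algHom_ext <;> intro i
    · ext a b
      fin_cases a <;> fin_cases b <;> simp [dMatrix_apply, map_sum, Matrix.sum_apply]
    · ext a b
      fin_cases a <;> fin_cases b <;> simp [dMatrix_apply, map_sum, Matrix.sum_apply]
  have := congrFun (congrFun (DFunLike.congr_fun h a) 0) 1
  simpa [dMatrix_apply] using this

lemma pullback_homogeneous {m n : ℕ} (θ : Fin (m + 1) → Fin (n + 1)) (p : ℕ) {a : Forms K n}
    (ha : a ∈ homogeneous K n p) : pullback θ a ∈ homogeneous K m p := by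
  have h : (homogeneous K n p).map (pullback θ).toLinearMap ≤ homogeneous K m p := by
    unfold homogeneous
    rw [Submodule.map_mul, Submodule.map_pow]
    refine mul_le_mul' ?_ (pow_le_pow_left' ?_ _)
    · rintro _ ⟨b, hb, rfl⟩
      have : Algebra.adjoin K (Set.range (t K)) ≤
          (Algebra.adjoin K (Set.range (t K))).comap (pullback (K := K) θ) := by
        rw [Algebra.adjoin_le_iff]
        rintro _ ⟨i, rfl⟩
        simp only [Subalgebra.coe_comap, Set.mem_preimage, SetLike.mem_coe, pullback_t]
        exact Subalgebra.sum_mem _ fun j _ => Algebra.subset_adjoin ⟨j, rfl⟩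
      exact this hb
    · rw [Submodule.map_span_le]
      rintro _ ⟨i, rfl⟩
      simp only [AlgHom.toLinearMap_apply, pullback_dt]
      exact Submodule.sum_mem _ fun j _ => Submodule.subset_span ⟨j, rfl⟩
  exact h ⟨a, ha, rfl⟩

end Forms

end Forms

/-! ### The tensor product of an `L∞`-algebra with an algebra of forms -/

section Extension

variable {K : Type v} {V W : Type u} [Field K] [AddCommGroup V] [Module K V]
  [AddCommGroup W] [Module K W] (A : Type v) [Ring A] [Algebra K A]

/-- Auxiliary step in the recursive definition of `tensorExtend`. -/
def tensorExtendStep {k : ℕ}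
    (E : MultilinearMap K (fun _ : Fin k => V) W →ₗ[K]
      MultilinearMap K (fun _ : Fin k => V ⊗[K] A) (W ⊗[K] A))
    (f : MultilinearMap K (fun _ : Fin (k + 1) => V) W) :
    V ⊗[K] A →ₗ[K] MultilinearMap K (fun _ : Fin k => V ⊗[K] A) (W ⊗[K] A) :=
  TensorProduct.lift (LinearMap.mk₂ K (fun (x : V) (a : A) =>
      ((LinearMap.mulLeft K a).lTensor W).compMultilinearMap (E (f.curryLeft x)))
    (fun x y a => by rw [map_add, map_add, LinearMap.compMultilinearMap_add])
    (fun r x a => by rw [map_smul, map_smul, LinearMap.compMultilinearMap_smul])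
    (fun x a b => by
      have h : LinearMap.mulLeft K (a + b) = LinearMap.mulLeft K a + LinearMap.mulLeft K b := by
        ext; simp [add_mul]
      rw [h, LinearMap.lTensor_add]
      rfl)
    (fun r x a => by
      have h : LinearMap.mulLeft K (r • a) = r • LinearMap.mulLeft K a := by
        ext; simp
      rw [h, LinearMap.lTensor_smul]
      rfl))

lemma tensorExtendStep_tmul {k : ℕ}
    (E : MultilinearMap K (fun _ : Fin k => V) W →ₗ[K]
      MultilinearMap K (fun _ : Fin k => V ⊗[K] A) (W ⊗[K] A))
    (f : MultilinearMap K (fun _ : Fin (k + 1) => V) W) (x : V) (a : A) :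
    tensorExtendStep A E f (x ⊗ₜ a) =
      ((LinearMap.mulLeft K a).lTensor W).compMultilinearMap (E (f.curryLeft x)) := by
  simp [tensorExtendStep]

/-- The extension of a multilinear map to the tensor product with the algebra `A`, without signs:
`(x₁ ⊗ a₁, …, x_k ⊗ a_k) ↦ f(x₁, …, x_k) ⊗ a₁ ⋯ a_k`. -/
def tensorExtend : ∀ k : ℕ,
    MultilinearMap K (fun _ : Fin k => V) W →ₗ[K]
      MultilinearMap K (fun _ : Fin k => V ⊗[K] A) (W ⊗[K] A)
  | 0 =>
    { toFun := fun f => MultilinearMap.constOfIsEmpty K _ (f 0 ⊗ₜ[K] (1 : A))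
      map_add' := fun f g => by ext; simp [TensorProduct.add_tmul]
      map_smul' := fun r f => by ext; simp [TensorProduct.smul_tmul'] }
  | k + 1 =>
    { toFun := fun f => (tensorExtendStep A (tensorExtend k) f).uncurryLeft
      map_add' := fun f g => by
        have h : tensorExtendStep A (tensorExtend k) (f + g) =
            tensorExtendStep A (tensorExtend k) f + tensorExtendStep A (tensorExtend k) g := by
          apply TensorProduct.ext'
          intro x a
          rw [LinearMap.add_apply]
          simp only [tensorExtendStep_tmul]
          rw [show (f + g).curryLeft x = f.curryLeft x + g.curryLeft x from rfl, map_add,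
            LinearMap.compMultilinearMap_add]
        rw [h]
        rfl
      map_smul' := fun r f => by
        have h : tensorExtendStep A (tensorExtend k) (r • f) = r • tensorExtendStep A (tensorExtend k) f := by
          apply TensorProduct.ext'
          intro x a
          rw [LinearMap.smul_apply]
          simp only [tensorExtendStep_tmul]
          rw [show (r • f).curryLeft x = r • f.curryLeft x from rfl, map_smul,
            LinearMap.compMultilinearMap_smul]
        rw [h]
        rfl }

lemma tensorExtend_tmul (k : ℕ) (f : MultilinearMap K (fun _ : Fin k => V) W) (x : Fin k → V)
    (a : Fin k → A) :
    tensorExtend A k f (fun i => x i ⊗ₜ a i) = f x ⊗ₜ (List.ofFn a).prod := by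
  induction k with
  | zero =>
    simp [tensorExtend, Subsingleton.elim x 0]
  | succ k ih =>
    have h : tensorExtend A (k + 1) f (fun i => x i ⊗ₜ a i) =
        tensorExtendStep A (tensorExtend A k) f (x 0 ⊗ₜ a 0) (fun i => x i.succ ⊗ₜ a i.succ) := rfl
    rw [h, tensorExtendStep_tmul, LinearMap.compMultilinearMap_apply, ih (f.curryLeft (x 0))]
    simp only [MultilinearMap.curryLeft_apply, LinearMap.lTensor_tmul, LinearMap.mulLeft_apply,
      List.ofFn_succ, List.prod_cons]
    congr 2
    exact Fin.cons_self_tail x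

/-- Multilinear maps on `V ⊗ A` that agree on pure tensors are equal. -/
lemma multilinear_ext_tmul {U : Type*} [AddCommGroup U] [Module K U] {k : ℕ}
    {F G : MultilinearMap K (fun _ : Fin k => V ⊗[K] A) U}
    (h : ∀ (x : Fin k → V) (a : Fin k → A),
      F (fun i => x i ⊗ₜ a i) = G (fun i => x i ⊗ₜ a i)) : F = G := by
  induction k with
  | zero =>
    ext z
    rw [Subsingleton.elim z (fun i => (0 : V) ⊗ₜ (0 : A))]
    exact h _ _
  | succ k ih =>
    have : F.curryLeft = G.curryLeft := by
      apply TensorProduct.ext'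
      intro x₀ a₀
      apply ih
      intro x a
      have := h (Fin.cons x₀ x) (Fin.cons a₀ a)
      simp only [MultilinearMap.curryLeft_apply]
      convert this using 2 <;>
      · funext i
        refine Fin.cases ?_ (fun i => ?_) i <;> simp
    rw [← F.uncurry_curryLeft, this, G.uncurry_curryLeft]

end Extension

namespace LInfinityAlgebra

section Tensor

variable {K : Type v} {V W : Type u} [Field K] [AddCommGroup V] [Module K V]
  [AddCommGroup W] [Module K W] (g : LInfinityAlgebra K V) (h : LInfinityAlgebra K W) (n : ℕ)

/-- The component of total degree `m` of `g ⊗ Ω_n`. -/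
def formsGrading (m : ℤ) : Submodule K (V ⊗[K] Forms K n) :=
  Submodule.span K {z | ∃ (p : ℕ) (x : V) (ω : Forms K n),
    x ∈ g.grading (m - p) ∧ ω ∈ Forms.homogeneous K n p ∧ z = x ⊗ₜ ω}

/-- The `Ω_n`-linear extension of the `k`-ary bracket to `g ⊗ Ω_n`, with the Koszul sign
`[x₁ ⊗ ω₁, …, x_k ⊗ ω_k] = (-1)^{∑_{i < j} |ω_i| |x_j|} [x₁, …, x_k] ⊗ ω₁ ⋯ ω_k`:
decompose each `x_j` into its parts of parity `p_j`, and apply the parity automorphism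
of `Ω_n` to `ω_i` once for each `j > i` with `p_j = 1`. -/
def extendedBracket (k : ℕ) :
    MultilinearMap K (fun _ : Fin k => V ⊗[K] Forms K n) (V ⊗[K] Forms K n) :=
  ∑ p : Fin k → ZMod 2, (tensorExtend (Forms K n) k (g.bracket k)).compLinearMap fun i =>
    TensorProduct.map (g.parityProj (p i))
      (Forms.parity ^ (∑ j ∈ Finset.Ioi i, (p j).val)).toLinearMap

/-- The operator `x ⊗ ω ↦ (-1)^{|x|} x ⊗ dω`. -/
def formsD : V ⊗[K] Forms K n →ₗ[K] V ⊗[K] Forms K n :=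
  TensorProduct.map (g.parityProj 0 - g.parityProj 1) Forms.d

/-- The brackets of the `L∞`-algebra `g ⊗ Ω_n`: the extended brackets, with `1 ⊗ d` added to the
unary one. -/
def formsBracket : ∀ k : ℕ,
    MultilinearMap K (fun _ : Fin k => V ⊗[K] Forms K n) (V ⊗[K] Forms K n)
  | 0 => g.extendedBracket n 0
  | 1 => g.extendedBracket n 1 + MultilinearMap.ofSubsingleton K _ _ 0 (g.formsD n)
  | k + 2 => g.extendedBracket n (k + 2)

/-- The curvature `F(μ) = ∑_{k ≥ 1} (1 / k!) [μ, …, μ]` in `g ⊗ Ω_n`; for a nilpotent `g`, only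
finitely many terms are nonzero. -/
def curvature (μ : V ⊗[K] Forms K n) : V ⊗[K] Forms K n :=
  ∑ᶠ k : ℕ, ((k.factorial : K)⁻¹) • g.formsBracket n k fun _ => μ

/-- The set of Maurer-Cartan elements of `g ⊗ Ω_n`. -/
def MC : Set (V ⊗[K] Forms K n) :=
  {μ | μ ∈ g.formsGrading n 1 ∧ g.curvature n μ = 0}

variable {n} in
/-- The sign in the extended bracket, on homogeneous elements. -/
lemma extendedBracket_tmul (k : ℕ) (d q : Fin k → ℤ) (x : Fin k → V) (ω : Fin k → Forms K n)
    (hx : ∀ i, x i ∈ g.grading (d i))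
    (hω : ∀ i, Forms.parity (ω i) = (q i).negOnePow • ω i) :
    g.extendedBracket n k (fun i => x i ⊗ₜ ω i) =
      (∑ i, ∑ j ∈ Finset.Ioi i, q i * d j).negOnePow •
        (g.bracket k x ⊗ₜ (List.ofFn ω).prod) := by
  have hpow : ∀ (c : ℕ) (i : Fin k), (Forms.parity ^ c) (ω i) = (c * q i).negOnePow • ω i := by
    intro c i
    induction c with
    | zero => simp
    | succ c ih =>
      rw [pow_succ, AlgHom.mul_apply, hω, Units.smul_def, map_zsmul, ih, ← Units.smul_def,
        smul_smul, ← Int.negOnePow_add]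
      congr 2
      push_cast
      ring
  simp only [extendedBracket, sum_apply, MultilinearMap.compLinearMap_apply,
    TensorProduct.map_tmul, tensorExtend_tmul, AlgHom.toLinearMap_apply, hpow]
  rw [Finset.sum_eq_single (fun i => (d i : ZMod 2))]
  · have h1 : ∀ i, g.parityProj (d i : ZMod 2) (x i) = x i := fun i => by
      rw [g.parityProj_of_mem _ (hx i), if_pos rfl]
    simp only [h1]
    have h2 : ∀ (l : ℕ) (e : Fin l → ℤˣ) (η : Fin l → Forms K n),
        (List.ofFn fun i => e i • η i).prod = (∏ i, e i) • (List.ofFn η).prod := by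
      intro l
      induction l with
      | zero => intro e η; simp
      | succ l ih =>
        intro e η
        rw [List.ofFn_succ, List.prod_cons, ih, List.ofFn_succ, List.prod_cons,
          Fin.prod_univ_succ, smul_mul_smul_comm]
    rw [h2, Units.smul_def, TensorProduct.tmul_smul, ← Units.smul_def]
    congr 1
    have h3 : ∀ (s : Finset (Fin k)) (e : Fin k → ℤ),
        ∏ i ∈ s, (e i).negOnePow = (∑ i ∈ s, e i).negOnePow := by
      intro s e
      induction s using Finset.cons_induction with
      | empty => simp
      | cons a s ha ih => rw [Finset.prod_cons, Finset.sum_cons, ih, Int.negOnePow_add]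
    rw [h3, Int.negOnePow_eq_iff, ← Finset.sum_sub_distrib]
    refine Finset.even_sum _ fun i _ => ?_
    rw [Nat.cast_sum, Finset.sum_mul, ← Finset.sum_sub_distrib]
    refine Finset.even_sum _ fun j _ => ?_
    rw [mul_comm (q i), ← sub_mul]
    refine Even.mul_right ?_ _
    rw [← ZMod.intCast_eq_zero_iff_even]
    push_cast
    rw [ZMod.natCast_zmod_val, sub_self]
  · intro p _ hp
    obtain ⟨i, hi⟩ := Function.ne_iff.1 hp
    have : g.bracket k (fun i => g.parityProj (p i) (x i)) = 0 := by
      apply MultilinearMap.map_coord_zero _ i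
      rw [g.parityProj_of_mem _ (hx i), if_neg (Ne.symm hi)]
    rw [this, TensorProduct.zero_tmul]
  · intro hp
    exact absurd (Finset.mem_univ _) hp

variable {g h n} in
lemma IsHom.map_extendedBracket {f : V →ₗ[K] W} (hf : IsHom g h f) {m : ℕ}
    (θ : Fin (m + 1) → Fin (n + 1)) (k : ℕ) (z : Fin k → V ⊗[K] Forms K n) :
    TensorProduct.map f (Forms.pullback θ).toLinearMap (g.extendedBracket n k z) =
      h.extendedBracket m k
        (fun i => TensorProduct.map f (Forms.pullback θ).toLinearMap (z i)) := by
  have hpow : ∀ (c : ℕ) (a : Forms K n), Forms.pullback θ ((Forms.parity ^ c) a) =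
      (Forms.parity ^ c) (Forms.pullback θ a) := by
    intro c
    induction c with
    | zero => intro a; rfl
    | succ c ih =>
      intro a
      rw [pow_succ, pow_succ, AlgHom.mul_apply, AlgHom.mul_apply, ih]
      congr 1
      exact DFunLike.congr_fun (Forms.pullback_parity θ) a
  simp only [extendedBracket, sum_apply, map_sum]
  refine Finset.sum_congr rfl fun p _ => ?_
  have key : (TensorProduct.map f (Forms.pullback θ).toLinearMap).compMultilinearMap
      ((tensorExtend (Forms K n) k (g.bracket k)).compLinearMap fun i =>
        TensorProduct.map (g.parityProj (p i))
          (Forms.parity ^ (∑ j ∈ Finset.Ioi i, (p j).val)).toLinearMap) =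
      ((tensorExtend (Forms K m) k (h.bracket k)).compLinearMap fun i =>
        TensorProduct.map (h.parityProj (p i))
          (Forms.parity ^ (∑ j ∈ Finset.Ioi i, (p j).val)).toLinearMap).compLinearMap
        (fun _ => TensorProduct.map f (Forms.pullback θ).toLinearMap) := by
    apply multilinear_ext_tmul
    intro x a
    simp only [LinearMap.compMultilinearMap_apply, MultilinearMap.compLinearMap_apply,
      TensorProduct.map_tmul, tensorExtend_tmul, AlgHom.toLinearMap_apply, map_list_prod,
      List.map_ofFn, hf.map_bracket]
    congr 2
    · funext i
      exact LinearMap.congr_fun (hf.parityProj (p i)) (x i)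
    · congr 1
      funext i
      exact hpow _ _
  exact DFunLike.congr_fun key z

variable {g h n} in
lemma IsHom.map_formsBracket {f : V →ₗ[K] W} (hf : IsHom g h f) {m : ℕ}
    (θ : Fin (m + 1) → Fin (n + 1)) (k : ℕ) (z : Fin k → V ⊗[K] Forms K n) :
    TensorProduct.map f (Forms.pullback θ).toLinearMap (g.formsBracket n k z) =
      h.formsBracket m k
        (fun i => TensorProduct.map f (Forms.pullback θ).toLinearMap (z i)) := by
  rcases k with _ | _ | k
  · exact hf.map_extendedBracket θ 0 z
  · simp only [formsBracket, add_apply, map_add]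
    congr 1
    · exact hf.map_extendedBracket θ 1 z
    · have key : TensorProduct.map f (Forms.pullback θ).toLinearMap ∘ₗ g.formsD n =
          h.formsD m ∘ₗ TensorProduct.map f (Forms.pullback θ).toLinearMap := by
        rw [formsD, formsD, ← TensorProduct.map_comp, ← TensorProduct.map_comp]
        congr 1
        · rw [LinearMap.comp_sub, LinearMap.sub_comp, hf.parityProj, hf.parityProj]
        · ext a
          exact Forms.pullback_d θ a
      exact LinearMap.congr_fun key (z 0)
  · exact hf.map_extendedBracket θ (k + 2) z

variable {g n} in
lemma IsNilpotent.finite_support (hg : g.IsNilpotent) (μ : V ⊗[K] Forms K n) :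
    (Function.support fun k : ℕ =>
      ((k.factorial : K)⁻¹) • g.formsBracket n k fun _ => μ).Finite := by
  obtain ⟨N, hN⟩ := hg.bracket_eq_zero
  refine (Set.finite_lt_nat (N + 2)).subset fun k hk => ?_
  by_contra hkN
  apply hk
  simp only [Set.mem_ofPred_eq, not_lt] at hkN
  obtain ⟨l, rfl⟩ : ∃ l, k = l + 2 := ⟨k - 2, by omega⟩
  have : g.formsBracket n (l + 2) = 0 := by
    simp only [formsBracket, extendedBracket, hN (l + 2) (by omega), map_zero]
    refine Finset.sum_eq_zero fun p _ => ?_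
    rfl
  simp [this]

variable {g h n} in
lemma IsHom.map_curvature {f : V →ₗ[K] W} (hf : IsHom g h f) (hg : g.IsNilpotent) {m : ℕ}
    (θ : Fin (m + 1) → Fin (n + 1)) (μ : V ⊗[K] Forms K n) :
    TensorProduct.map f (Forms.pullback θ).toLinearMap (g.curvature n μ) =
      h.curvature m (TensorProduct.map f (Forms.pullback θ).toLinearMap μ) := by
  rw [curvature, curvature]
  refine (AddMonoidHom.map_finsum
    (TensorProduct.map f (Forms.pullback θ).toLinearMap).toAddMonoidHom
    (hg.finite_support μ)).trans (finsum_congr fun k => ?_)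
  simp only [LinearMap.toAddMonoidHom_coe, map_smul, hf.map_formsBracket]

variable {g h n} in
lemma IsHom.map_mem_MC {f : V →ₗ[K] W} (hf : IsHom g h f) (hg : g.IsNilpotent) {m : ℕ}
    (θ : Fin (m + 1) → Fin (n + 1)) {μ : V ⊗[K] Forms K n} (hμ : μ ∈ g.MC n) :
    TensorProduct.map f (Forms.pullback θ).toLinearMap μ ∈ h.MC m := by
  refine ⟨?_, ?_⟩
  · have : (g.formsGrading n 1).map (TensorProduct.map f (Forms.pullback θ).toLinearMap) ≤
        h.formsGrading m 1 := by
      rw [formsGrading, Submodule.map_span_le]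
      rintro _ ⟨p, x, ω, hx, hω, rfl⟩
      exact Submodule.subset_span ⟨p, f x, Forms.pullback θ ω, hf.map_grading _ _ hx,
        Forms.pullback_homogeneous θ p hω, rfl⟩
    exact this ⟨μ, hμ.1, rfl⟩
  · rw [← hf.map_curvature hg, hμ.2, map_zero]

end Tensor
end LInfinityAlgebra

/-! ### Simplicial actions and principal fibrations -/

section Simplicial

open CategoryTheory

/-- The structure of a simplicial abelian group on a simplicial set. -/
structure SimplicialAddCommGroup (G : SSet.{u}) where
  group : ∀ n, AddCommGroup (G.obj n)
  map_add : ∀ {m n : SimplexCategoryᵒᵖ} (f : m ⟶ n) (a b : G.obj m),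
    G.map f (a + b) = G.map f a + G.map f b

/-- An action of a simplicial abelian group on a simplicial set. -/
structure SimplicialAction {G : SSet.{u}} (hG : SimplicialAddCommGroup G) (E : SSet.{u}) where
  act : ∀ n, G.obj n → E.obj n → E.obj n
  zero_act : ∀ n (x : E.obj n), letI := hG.group n; act n 0 x = x
  add_act : ∀ n (a b : G.obj n) (x : E.obj n),
    letI := hG.group n; act n (a + b) x = act n a (act n b x)
  map_act : ∀ {m n : SimplexCategoryᵒᵖ} (f : m ⟶ n) (a : G.obj m) (x : E.obj m),
    E.map f (act m a x) = act n (G.map f a) (E.map f x)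

/-- `p : E ⟶ B` is a principal fibration for the given action of `G` on `E`: the action is free and
`p` identifies `B` with the quotient `E / G`. -/
structure SimplicialAction.IsPrincipalFibration {G E B : SSet.{u}}
    {hG : SimplicialAddCommGroup G} (ρ : SimplicialAction hG E) (p : E ⟶ B) : Prop where
  free : ∀ n (a : G.obj n) (x : E.obj n), ρ.act n a x = x → letI := hG.group n; a = 0
  surjective : ∀ n, Function.Surjective (p.app n)
  fiber : ∀ n (x y : E.obj n), p.app n x = p.app n y ↔ ∃ a, ρ.act n a x = y

/-- `B` is a union of connected components of `X`. -/
def SSet.Subcomplex.IsUnionOfComponents {X : SSet.{u}} (B : X.Subcomplex) : Prop :=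
  ∀ {m n : SimplexCategoryᵒᵖ} (f : m ⟶ n) (x : X.obj m), X.map f x ∈ B.obj n ↔ x ∈ B.obj m

end Simplicial

/-! ### The simplicial set `Σ(g)` -/

namespace LInfinityAlgebra

section Sigma

open CategoryTheory

variable {K : Type v} {V W : Type u} [Field K] [AddCommGroup V] [Module K V]
  [AddCommGroup W] [Module K W] {g : LInfinityAlgebra K V} {h : LInfinityAlgebra K W}

/-- The simplicial set `Σ(g)`, with `Σ_n(g) = MC(g ⊗ Ω_n)`. -/
def sigma (g : LInfinityAlgebra K V) (hg : g.IsNilpotent) : SSet.{max u v} where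
  obj n := g.MC n.unop.len
  map θ := TypeCat.ofHom fun μ =>
    ⟨TensorProduct.map LinearMap.id (Forms.pullback θ.unop.toOrderHom).toLinearMap μ.1,
      (IsHom.id g).map_mem_MC hg _ μ.2⟩
  map_id n := by
    ext μ
    change TensorProduct.map LinearMap.id (Forms.pullback (fun i => i)).toLinearMap μ.1 = μ.1
    rw [Forms.pullback_id]
    exact LinearMap.congr_fun TensorProduct.map_id μ.1
  map_comp θ η := by
    ext μ
    change TensorProduct.map LinearMap.id (Forms.pullback
      (fun i => θ.unop.toOrderHom (η.unop.toOrderHom i))).toLinearMap μ.1 =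
      TensorProduct.map LinearMap.id (Forms.pullback η.unop.toOrderHom).toLinearMap
        (TensorProduct.map LinearMap.id (Forms.pullback θ.unop.toOrderHom).toLinearMap μ.1)
    rw [Forms.pullback_comp, ← LinearMap.comp_apply, ← TensorProduct.map_comp]
    rfl

lemma IsHom.map_tensor_id_mem_MC {f : V →ₗ[K] W} (hf : IsHom g h f) (hg : g.IsNilpotent) (n : ℕ)
    {μ : V ⊗[K] Forms K n} (hμ : μ ∈ g.MC n) :
    TensorProduct.map f LinearMap.id μ ∈ h.MC n := by
  have := hf.map_mem_MC hg (fun i => i) hμ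
  rwa [Forms.pullback_id] at this

/-- The map `Σ(f) : Σ(g) ⟶ Σ(h)` induced by a map of `L∞`-algebras. -/
def sigmaMap {f : V →ₗ[K] W} (hf : IsHom g h f) (hg : g.IsNilpotent) (hh : h.IsNilpotent) :
    g.sigma hg ⟶ h.sigma hh where
  app n := TypeCat.ofHom fun μ =>
    ⟨TensorProduct.map f LinearMap.id μ.1, hf.map_tensor_id_mem_MC hg _ μ.2⟩
  naturality m n θ := by
    ext μ
    apply Subtype.ext
    change TensorProduct.map f LinearMap.id (TensorProduct.map LinearMap.id
        (Forms.pullback θ.unop.toOrderHom).toLinearMap μ.1) =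
      TensorProduct.map LinearMap.id (Forms.pullback θ.unop.toOrderHom).toLinearMap
        (TensorProduct.map f LinearMap.id μ.1)
    rw [← LinearMap.comp_apply, ← TensorProduct.map_comp, ← LinearMap.comp_apply,
      ← TensorProduct.map_comp]
    rfl

lemma IsAbelian.isNilpotent (hg : g.IsAbelian) : g.IsNilpotent := by
  refine ⟨2, ?_⟩
  rw [lcs, Submodule.span_eq_bot]
  rintro _ ⟨k, hk, d, _, x, _, rfl⟩
  rw [hg k hk]
  rfl

/-- In the abelian case, `Σ_n(g) = Z¹(g ⊗ Ω_n)`. -/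
lemma IsAbelian.curvature (hg : g.IsAbelian) (n : ℕ) (μ : V ⊗[K] Forms K n) :
    g.curvature n μ = g.formsBracket n 1 fun _ => μ := by
  rw [LInfinityAlgebra.curvature, finsum_eq_single _ 1]
  · simp
  · intro k hk
    have : g.formsBracket n k = 0 := by
      rcases k with _ | _ | k
      · simp only [formsBracket, extendedBracket, g.bracket_zero, map_zero]
        exact Finset.sum_eq_zero fun p _ => rfl
      · exact absurd rfl hk
      · simp only [formsBracket, extendedBracket, hg (k + 2) (by omega), map_zero]
        exact Finset.sum_eq_zero fun p _ => rfl
    simp [this]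

/-- The group `Z¹(g ⊗ Ω_n)` of Maurer-Cartan elements of `g ⊗ Ω_n`, for `g` abelian. -/
def IsAbelian.mcSubgroup (hg : g.IsAbelian) (n : ℕ) : AddSubgroup (V ⊗[K] Forms K n) where
  carrier := g.MC n
  zero_mem' := ⟨zero_mem _, by
    rw [hg.curvature]; exact (g.formsBracket n 1).map_coord_zero 0 rfl⟩
  add_mem' {a b} ha hb := ⟨add_mem ha.1 hb.1, by
    have ha' := ha.2
    have hb' := hb.2
    rw [hg.curvature] at ha' hb' ⊢
    have := ((MultilinearMap.ofSubsingleton K _ _ (0 : Fin 1)).symm (g.formsBracket n 1)).map_add a b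
    simp only [MultilinearMap.ofSubsingleton_symm_apply_apply] at this
    exact this.trans (by
      simp only [Function.const_def] at *
      rw [ha', hb', add_zero])⟩
  neg_mem' {a} ha := ⟨neg_mem ha.1, by
    have ha' := ha.2
    rw [hg.curvature] at ha' ⊢
    have := ((MultilinearMap.ofSubsingleton K _ _ (0 : Fin 1)).symm (g.formsBracket n 1)).map_neg a
    simp only [MultilinearMap.ofSubsingleton_symm_apply_apply] at this
    exact this.trans (by
      simp only [Function.const_def] at *
      rw [ha', neg_zero])⟩

/-- For an abelian `g`, addition makes `Σ(g)` a simplicial abelian group. -/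
def IsAbelian.sigmaGroup (hg : g.IsAbelian) : SimplicialAddCommGroup (g.sigma hg.isNilpotent) where
  group n := inferInstanceAs (AddCommGroup (hg.mcSubgroup n.unop.len))
  map_add f a b := Subtype.ext (map_add (TensorProduct.map LinearMap.id
    (Forms.pullback f.unop.toOrderHom).toLinearMap) a.1 b.1)

lemma lcs_succ_le (g : LInfinityAlgebra K V) (i : ℕ) : g.lcs (i + 1) ≤ g.lcs i := by
  induction i using Nat.strong_induction_on with
  | _ i ih =>
    rcases i with _ | _ | i
    · rw [lcs, lcs]
    · rw [show g.lcs (0 + 1) = ⊤ by rw [lcs]]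
      exact le_top
    · rw [lcs, Submodule.span_le]
      rintro _ ⟨k, hk, d, hd, x, hx, rfl⟩
      obtain ⟨a, ha⟩ : ∃ a, (d a : ℕ) ≠ 0 := by
        by_contra! hcon
        simp [hcon] at hd
      have hle : ∀ b, b ≠ a → (d b : ℕ) + d a ≤ i + 2 := by
        intro b hb
        have h1 := Finset.sum_le_sum_of_subset (f := fun j => (d j : ℕ))
          (Finset.subset_univ ({b, a} : Finset (Fin k)))
        rw [Finset.sum_pair hb] at h1
        omega
      let e : Fin k → ℕ := fun j => if j = a then d a - 1 else d j
      have he : ∀ j, e j < i + 2 := by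
        intro j
        simp only [e]
        split_ifs with hj
        · have := (d a).2; omega
        · have := hle j hj; omega
      change _ ∈ g.lcs (i + 2)
      rw [lcs]
      refine Submodule.subset_span ⟨k, hk, fun j => ⟨e j, he j⟩, ?_, x, fun j => ?_, rfl⟩
      · have h1 := Finset.add_sum_erase Finset.univ (fun j => (d j : ℕ)) (Finset.mem_univ a)
        have h2 := Finset.add_sum_erase Finset.univ e (Finset.mem_univ a)
        have h3 : ∑ j ∈ Finset.univ.erase a, e j = ∑ j ∈ Finset.univ.erase a, (d j : ℕ) :=
          Finset.sum_congr rfl fun j hj => by simp [e, Finset.ne_of_mem_erase hj]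
        have h4 : e a = d a - 1 := by simp [e]
        change ∑ j, e j = i + 1
        omega
      · simp only [e]
        split_ifs with hj
        · subst hj
          have hlt : (d j : ℕ) - 1 < i + 2 := by have := (d j).2; omega
          apply ih _ hlt
          rw [Nat.sub_add_cancel (by omega)]
          exact hx j
        · exact hx j

/-- The subspace `F^i / F^{i+1}` of `g / F^{i+1}`. -/
def lcsGr (g : LInfinityAlgebra K V) (i : ℕ) : Submodule K (V ⧸ g.lcs (i + 1)) :=
  (g.lcs i).map (g.lcs (i + 1)).mkQ

/-- The tower of the quotients `g / F^i` of a nilpotent `L∞`-algebra by the terms of its lower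
central series, with the abelian subalgebras `F^i / F^{i+1}` of `g / F^{i+1}`: there is at most one
such structure, since all brackets and gradings are determined by those of `g`. -/
structure LowerCentralTower (g : LInfinityAlgebra K V) where
  quot : ∀ i, LInfinityAlgebra K (V ⧸ g.lcs i)
  quot_nilpotent : ∀ i, (quot i).IsNilpotent
  proj : ∀ i, IsHom g (quot i) (g.lcs i).mkQ
  step : ∀ i, IsHom (quot (i + 1)) (quot i) (Submodule.factor (g.lcs_succ_le i))
  gr : ∀ i, LInfinityAlgebra K (g.lcsGr i)
  gr_abelian : ∀ i, (gr i).IsAbelian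
  incl : ∀ i, IsHom (gr i) (quot (i + 1)) (g.lcsGr i).subtype

namespace LowerCentralTower

variable (T : g.LowerCentralTower)

/-- `Σ(g / F^i)`. -/
def sigmaQuot (i : ℕ) : SSet.{max u v} := (T.quot i).sigma (T.quot_nilpotent i)

/-- `Σ(F^i / F^{i+1})`. -/
def sigmaGr (i : ℕ) : SSet.{max u v} := (T.gr i).sigma (T.gr_abelian i).isNilpotent

/-- `Σ(g) ⟶ Σ(g / F^i)`. -/
def sigmaProj (hg : g.IsNilpotent) (i : ℕ) : g.sigma hg ⟶ T.sigmaQuot i :=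
  sigmaMap (T.proj i) hg (T.quot_nilpotent i)

/-- `Σ(g / F^{i+1}) ⟶ Σ(g / F^i)`. -/
def sigmaStep (i : ℕ) : T.sigmaQuot (i + 1) ⟶ T.sigmaQuot i :=
  sigmaMap (T.step i) (T.quot_nilpotent (i + 1)) (T.quot_nilpotent i)

/-- The simplicial abelian group `Σ(F^i / F^{i+1})`. -/
def sigmaGrGroup (i : ℕ) : SimplicialAddCommGroup (T.sigmaGr i) := (T.gr_abelian i).sigmaGroup

/-- The action `ρ` of `Σ(F^i / F^{i+1})` on `Σ(g / F^{i+1})` is the addition in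
`(g / F^{i+1}) ⊗ Ω_n`. -/
def IsAdditiveAction (i : ℕ) (ρ : SimplicialAction (T.sigmaGrGroup i) (T.sigmaQuot (i + 1))) :
    Prop :=
  ∀ (n : SimplexCategoryᵒᵖ) (α : (T.gr i).MC n.unop.len) (μ : (T.quot (i + 1)).MC n.unop.len),
    (show (T.quot (i + 1)).MC n.unop.len from ρ.act n α μ).1 =
      TensorProduct.map (g.lcsGr i).subtype LinearMap.id α.1 + μ.1

end LowerCentralTower

end Sigma

end LInfinityAlgebra

end

noncomputable section

/-! ### Graded ideals, quotients and subalgebras -/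

/-! A bracket of arity at least two with an entry in `F^i` lies in `F^{i+1}`, so the tower of
quotients `g/F^i` is built from central extensions with abelian kernel `F^i/F^{i+1}`. That the `F^i`
are ideals at all also requires stability under `δ`, which the Jacobi identities provide
(`delta_mem_lcs`).

Consider one central extension with kernel `a` and total differential `D`. In the curvature of `α +
μ`, with `α` in `a ⊗ Ω_n`, all mixed brackets vanish, so `F(α + μ) = Dα + F(μ)` (`curvature_add`).
Two Maurer-Cartan lifts of the same element therefore differ by a unique cocycle of degree one in `a
⊗ Ω_n`, that is, by an element of `Σ(a)`: this is the principal action (`isPrincipalFibration`).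

To decide which elements lift, take any graded lift `x` of a Maurer-Cartan element `ν`. Its
curvature `c` lies in the kernel, and the Bianchi identity (`bianchi`) reduces there to `Dc = 0`.
The affine contraction of the simplex to a vertex `w` yields an operator `h` with `hD + Dh = 1 -
ev_w` (`formsHomotopy_totalD`). If `ν` lifts at `w`, the value of `c` at `w` is exact, hence so is
`c`, and subtracting a primitive from `x` produces a lift of `ν` (`exists_lift`). Liftability is
thus decided at a single vertex, and the image is a union of components (`isUnionOfComponents`).

The Bianchi identity combines the Jacobi identity in `g ⊗ Ω_n` (`extendedBracket_jacobi`) with the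
derivation rule for the de Rham differential (`formsD_extendedBracket`). Both are needed only for
entries of total degree one. Their signs are written as products over pairs of indices and compared
pair by pair.

The Kan property climbs the tower from the point `Σ(g/F^1)`: a horn is filled in the base, the
filler is lifted because one of its faces lifts, and the discrepancy on the faces is a horn in the
structure group, which Moore's theorem fills (`kanComplex_of_isPrincipalFibration`). -/

/-- A family of submodules is a grading as soon as it spans and there are compatible projections. -/
lemma isInternal_of_projections {ι K W : Type*} [DecidableEq ι] [Ring K] [AddCommGroup W]
    [Module K W] (G : ι → Submodule K W) (π : ι → W →ₗ[K] W)
    (h1 : ∀ i, ∀ x ∈ G i, π i x = x) (h2 : ∀ i j, i ≠ j → ∀ x ∈ G i, π j x = 0)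
    (htop : iSup G = ⊤) : DirectSum.IsInternal G := by
  rw [DirectSum.isInternal_submodule_iff_iSupIndep_and_iSup_eq_top]
  refine ⟨fun i => ?_, htop⟩
  rw [Submodule.disjoint_def]
  intro x hx hx'
  rw [← h1 i x hx]
  have : (⨆ j, ⨆ (_ : j ≠ i), G j) ≤ LinearMap.ker (π i) :=
    iSup_le fun j => iSup_le fun hj y hy => h2 j i hj y hy
  exact this hx'

lemma units_smul_mem_iff {K W : Type*} [Ring K] [AddCommGroup W] [Module K W] (P : Submodule K W)
    (u : ℤˣ) {x : W} : u • x ∈ P ↔ x ∈ P := by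
  rcases Int.units_eq_one_or u with rfl | rfl <;> simp [Units.smul_def]

lemma Finset.sum_orderEmbOfFin {M : Type*} [AddCommMonoid M] {n : ℕ} (S : Finset (Fin n))
    (f : Fin n → M) : ∑ i, f (S.orderEmbOfFin rfl i) = ∑ a ∈ S, f a := by
  rw [← Finset.sum_coe_sort S]
  exact Fintype.sum_equiv (S.orderIsoOfFin rfl).toEquiv _ _ fun i => rfl

namespace LInfinityAlgebra

section Graded

variable {K : Type v} {V W : Type u} [Field K] [AddCommGroup V] [Module K V]
  [AddCommGroup W] [Module K W]

/-- The linear map with given restrictions to the homogeneous components. -/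
def ofHomogeneous (g : LInfinityAlgebra K V) (φ : ∀ d, g.grading d →ₗ[K] W) : V →ₗ[K] W :=
  DirectSum.toModule K ℤ W φ ∘ₗ
    (LinearEquiv.ofBijective (DirectSum.coeLinearMap g.grading) g.isInternal).symm.toLinearMap

lemma ofHomogeneous_of_mem (g : LInfinityAlgebra K V) (φ : ∀ d, g.grading d →ₗ[K] W) {d : ℤ}
    {x : V} (hx : x ∈ g.grading d) : g.ofHomogeneous φ x = φ d ⟨x, hx⟩ := by
  have h : (LinearEquiv.ofBijective (DirectSum.coeLinearMap g.grading) g.isInternal).symm x =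
      DirectSum.lof K ℤ (fun d => g.grading d) d ⟨x, hx⟩ := by
    rw [LinearEquiv.symm_apply_eq]
    exact (DirectSum.coeLinearMap_lof g.grading d ⟨x, hx⟩).symm
  simp only [ofHomogeneous, LinearMap.comp_apply, LinearEquiv.coe_coe]
  rw [h, DirectSum.toModule_lof]

/-- The projection onto the component of degree `d`. -/
def degreeProj (g : LInfinityAlgebra K V) (d : ℤ) : V →ₗ[K] V :=
  g.ofHomogeneous fun e => if e = d then (g.grading e).subtype else 0

lemma degreeProj_of_mem (g : LInfinityAlgebra K V) (d : ℤ) {e : ℤ} {x : V}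
    (hx : x ∈ g.grading e) : g.degreeProj d x = if e = d then x else 0 := by
  rw [degreeProj, ofHomogeneous_of_mem _ _ hx]
  split_ifs <;> rfl

lemma induction_homogeneous (g : LInfinityAlgebra K V) {P : V → Prop}
    (h : ∀ d, ∀ x ∈ g.grading d, P x) (h0 : P 0) (hadd : ∀ x y, P x → P y → P (x + y)) (x : V) :
    P x := by
  have hx : x ∈ ⨆ d, g.grading d := by
    rw [g.isInternal.submodule_iSup_eq_top]; trivial
  exact Submodule.iSup_induction (motive := P) g.grading hx h h0 hadd

lemma degreeProj_mem (g : LInfinityAlgebra K V) (d : ℤ) (x : V) :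
    g.degreeProj d x ∈ g.grading d := by
  induction x using g.induction_homogeneous with
  | h e x hx =>
    rw [g.degreeProj_of_mem d hx]
    split_ifs with h
    · exact h ▸ hx
    · exact zero_mem _
  | h0 => simp
  | hadd x y hx hy => rw [map_add]; exact add_mem hx hy

lemma exists_sum_degreeProj (g : LInfinityAlgebra K V) (x : V) :
    ∃ s : Finset ℤ, x = ∑ d ∈ s, g.degreeProj d x := by
  -- Allowing every larger index set makes the claim additive: two summands share the union of their
  -- sets.
  suffices h : ∃ s : Finset ℤ, ∀ s', s ⊆ s' → x = ∑ d ∈ s', g.degreeProj d x by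
    obtain ⟨s, hs⟩ := h
    exact ⟨s, hs s subset_rfl⟩
  induction x using g.induction_homogeneous with
  | h e x hx =>
    refine ⟨{e}, fun s' hs' => ?_⟩
    simp only [g.degreeProj_of_mem _ hx]
    rw [Finset.sum_ite_eq, if_pos (hs' (by simp))]
  | h0 => exact ⟨∅, by simp⟩
  | hadd x y hx hy =>
    obtain ⟨s, hs⟩ := hx
    obtain ⟨t, ht⟩ := hy
    refine ⟨s ∪ t, fun s' hs' => ?_⟩
    simp only [map_add, Finset.sum_add_distrib]
    rw [← hs s' (Finset.union_subset_left hs'), ← ht s' (Finset.union_subset_right hs')]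

lemma IsHom.map_degreeProj {g : LInfinityAlgebra K V} {h : LInfinityAlgebra K W} {f : V →ₗ[K] W}
    (hf : IsHom g h f) (d : ℤ) (x : V) : f (g.degreeProj d x) = h.degreeProj d (f x) := by
  induction x using g.induction_homogeneous with
  | h e x hx =>
    rw [g.degreeProj_of_mem d hx, h.degreeProj_of_mem d (hf.map_grading e x hx)]
    split_ifs <;> simp
  | h0 => simp
  | hadd x y hx hy => simp [hx, hy]

/-- Every bracket is a sum of brackets of homogeneous components of its entries. -/
lemma bracket_eq_sum_degreeProj (g : LInfinityAlgebra K V) (k : ℕ) (x : Fin k → V) :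
    ∃ s : Finset (Fin k → ℤ),
      g.bracket k x = ∑ r ∈ s, g.bracket k fun j => g.degreeProj (r j) (x j) := by
  choose s hs using fun j => g.exists_sum_degreeProj (x j)
  refine ⟨Fintype.piFinset s, ?_⟩
  rw [← MultilinearMap.map_sum_finset (g.bracket k) (fun j d => g.degreeProj d (x j)) s]
  congr 1
  funext j
  exact hs j

/-- A homogeneous subspace that contains every bracket with at least one entry in it. -/
structure IsIdeal (g : LInfinityAlgebra K V) (I : Submodule K V) : Prop where
  degreeProj_mem : ∀ d, ∀ x ∈ I, g.degreeProj d x ∈ I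
  bracket_mem : ∀ k (x : Fin k → V) i, x i ∈ I → g.bracket k x ∈ I

/-! ### Quotients by ideals, and ideals as subalgebras -/

section Quotient

variable {g : LInfinityAlgebra K V} {I : Submodule K V}

/-- Expand the bracket of `y + (x - y)` over subsets of the entries: the term with every entry from
`y` cancels, and every other term has an entry in `I`. -/
lemma IsIdeal.bracket_sub_mem (hI : g.IsIdeal I) (k : ℕ) (x y : Fin k → V)
    (h : ∀ i, x i - y i ∈ I) : g.bracket k x - g.bracket k y ∈ I := by
  have hx : x = y + (x - y) := by simp
  rw [hx, MultilinearMap.map_add_univ, ← Finset.add_sum_erase _ _ (Finset.mem_univ Finset.univ),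
    Finset.piecewise_univ, add_sub_cancel_left]
  refine Submodule.sum_mem _ fun s hs => ?_
  obtain ⟨i, hi⟩ : ∃ i, i ∉ s := by
    by_contra! hcon
    exact Finset.ne_of_mem_erase hs (Finset.eq_univ_iff_forall.2 hcon)
  refine hI.bracket_mem k _ i ?_
  rw [Finset.piecewise_eq_of_notMem _ _ _ hi]
  exact h i

lemma IsIdeal.isInternal_map_mkQ (hI : g.IsIdeal I) :
    DirectSum.IsInternal fun d => (g.grading d).map I.mkQ := by
  refine isInternal_of_projections _
    (fun d => I.mapQ I (g.degreeProj d) fun x hx => hI.degreeProj_mem d x hx) ?_ ?_ ?_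
  · rintro d _ ⟨x, hx, rfl⟩
    simp [g.degreeProj_of_mem d hx]
  · rintro d e hde _ ⟨x, hx, rfl⟩
    simp [g.degreeProj_of_mem e hx, hde]
  · rw [← Submodule.map_iSup, g.isInternal.submodule_iSup_eq_top, Submodule.map_top,
      Submodule.range_mkQ]

/-- A linear section of the quotient map. -/
def mkQSection (I : Submodule K V) : V ⧸ I →ₗ[K] V :=
  (I.mkQ.exists_rightInverse_of_surjective I.range_mkQ).choose

lemma mkQ_mkQSection (I : Submodule K V) (x : V ⧸ I) : I.mkQ (mkQSection I x) = x :=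
  LinearMap.congr_fun (I.mkQ.exists_rightInverse_of_surjective I.range_mkQ).choose_spec x

/-- The bracket induced on a quotient. -/
def quotientBracket (g : LInfinityAlgebra K V) (I : Submodule K V) (k : ℕ) :
    MultilinearMap K (fun _ : Fin k => V ⧸ I) (V ⧸ I) :=
  I.mkQ.compMultilinearMap ((g.bracket k).compLinearMap fun _ => mkQSection I)

/-- The choice of section does not matter, since two lifts of an entry differ by an element of `I`.
Through this identity the axioms descend from `g`. -/
lemma IsIdeal.quotientBracket_mkQ (hI : g.IsIdeal I) (k : ℕ) (x : Fin k → V) :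
    g.quotientBracket I k (fun i => I.mkQ (x i)) = I.mkQ (g.bracket k x) := by
  simp only [quotientBracket, LinearMap.compMultilinearMap_apply,
    MultilinearMap.compLinearMap_apply]
  rw [← sub_eq_zero, ← map_sub, Submodule.mkQ_apply, Submodule.Quotient.mk_eq_zero]
  refine hI.bracket_sub_mem k _ _ fun i => ?_
  rw [← Submodule.Quotient.mk_eq_zero, ← Submodule.mkQ_apply, map_sub, mkQ_mkQSection, sub_self]

lemma comp_fin_cons {A B : Type*} {n : ℕ} (f : A → B) (a : A) (x : Fin n → A) :
    (fun i => f ((Fin.cons a x : Fin (n + 1) → A) i)) = Fin.cons (f a) (fun i => f (x i)) := by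
  funext i
  refine Fin.cases ?_ (fun i => ?_) i <;> simp

/-- The quotient of an `L∞`-algebra by an ideal. -/
def quotient (g : LInfinityAlgebra K V) (I : Submodule K V) (hI : g.IsIdeal I) :
    LInfinityAlgebra K (V ⧸ I) where
  grading d := (g.grading d).map I.mkQ
  isInternal := hI.isInternal_map_mkQ
  bracket := g.quotientBracket I
  bracket_zero := by
    ext x
    simp [quotientBracket, g.bracket_zero]
  bracket_mem k d x hx := by
    -- The grading of the quotient is an image, so homogeneous entries have homogeneous lifts, to
    -- which the axioms of `g` apply.
    choose y hy hyx using hx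
    obtain rfl : (fun i => I.mkQ (y i)) = x := funext hyx
    rw [hI.quotientBracket_mkQ]
    exact ⟨_, g.bracket_mem k d y hy, rfl⟩
  bracket_perm k d x hx σ := by
    choose y hy hyx using hx
    obtain rfl : (fun i => I.mkQ (y i)) = x := funext hyx
    rw [hI.quotientBracket_mkQ k y]
    refine (hI.quotientBracket_mkQ k fun i => y (σ i)).trans ?_
    rw [g.bracket_perm k d y hy σ, Units.smul_def, Units.smul_def, map_zsmul]
  jacobi n d x hx := by
    choose y hy hyx using hx
    obtain rfl : (fun i => I.mkQ (y i)) = x := funext hyx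
    have h := congrArg I.mkQ (g.jacobi n d y hy)
    rw [map_sum, map_zero] at h
    rw [← h]
    refine Finset.sum_congr rfl fun S _ => ?_
    rw [Units.smul_def, Units.smul_def, map_zsmul, hI.quotientBracket_mkQ, ← comp_fin_cons,
      hI.quotientBracket_mkQ]

lemma quotient_isHom (hI : g.IsIdeal I) : IsHom g (g.quotient I hI) I.mkQ :=
  ⟨fun _ x hx => ⟨x, hx, rfl⟩, fun k x => (hI.quotientBracket_mkQ k x).symm⟩

lemma IsIdeal.map_mkQ (hI : g.IsIdeal I) {J : Submodule K V} (hJ : g.IsIdeal J) :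
    (g.quotient I hI).IsIdeal (J.map I.mkQ) where
  degreeProj_mem := by
    rintro d _ ⟨x, hx, rfl⟩
    rw [← (quotient_isHom hI).map_degreeProj]
    exact ⟨_, hJ.degreeProj_mem d x hx, rfl⟩
  bracket_mem := by
    intro k x i hi
    obtain ⟨z, hz, hzx⟩ := hi
    choose y hy using fun j => I.mkQ_surjective (x j)
    -- The lift of the `i`-th entry has to be the one inside `J`; the others are arbitrary.
    obtain rfl : (fun j => I.mkQ (Function.update y i z j)) = x := by
      funext j
      by_cases hj : j = i
      · subst hj; simpa using hzx
      · simpa [hj] using hy j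
    rw [← (quotient_isHom hI).map_bracket]
    exact ⟨_, hJ.bracket_mem k _ i (by simpa using hz), rfl⟩

/-- The restriction of a bracket to an ideal. -/
def IsIdeal.bracket (hI : g.IsIdeal I) (k : ℕ) : MultilinearMap K (fun _ : Fin k => I) I :=
  ((g.bracket k).compLinearMap fun _ => I.subtype).codRestrict I fun x => by
    -- In arity zero there is no entry to place the value in the ideal, so the vanishing of the
    -- nullary bracket is needed.
    rcases k with _ | k
    · rw [g.bracket_zero]; exact zero_mem _
    · exact hI.bracket_mem _ (fun i => (x i : V)) 0 (x 0).2

lemma IsIdeal.coe_bracket (hI : g.IsIdeal I) (k : ℕ) (x : Fin k → I) :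
    (hI.bracket k x : V) = g.bracket k fun i => (x i : V) := rfl

/-- An ideal is an `L∞`-algebra in its own right. -/
def IsIdeal.subalgebra (hI : g.IsIdeal I) : LInfinityAlgebra K I where
  grading d := (g.grading d).comap I.subtype
  isInternal := by
    refine isInternal_of_projections _
      (fun d => (g.degreeProj d).restrict fun x hx => hI.degreeProj_mem d x hx) ?_ ?_ ?_
    · intro d x hx
      ext
      simpa using g.degreeProj_of_mem d (Submodule.mem_comap.1 hx)
    · intro d e hde x hx
      ext
      simpa [hde] using g.degreeProj_of_mem e (Submodule.mem_comap.1 hx)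
    · rw [eq_top_iff]
      rintro x -
      obtain ⟨s, hs⟩ := g.exists_sum_degreeProj (x : V)
      have hx : x = ∑ d ∈ s, ⟨g.degreeProj d x, hI.degreeProj_mem d x x.2⟩ := by
        ext; simpa using hs
      rw [hx]
      exact Submodule.sum_mem _ fun d _ => Submodule.mem_iSup_of_mem d (g.degreeProj_mem d x)
  bracket := hI.bracket
  bracket_zero := by
    ext x
    simp [hI.coe_bracket, g.bracket_zero]
  bracket_mem k d x hx := g.bracket_mem k d (fun i => x i) hx
  bracket_perm k d x hx σ := by
    ext
    simpa [Units.smul_def, hI.coe_bracket] using g.bracket_perm k d (fun i => x i) hx σ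
  jacobi n d x hx := by
    have h := g.jacobi n d (fun i => x i) hx
    ext
    rw [Submodule.coe_zero, ← h, AddSubmonoidClass.coe_finsetSum]
    refine Finset.sum_congr rfl fun S _ => ?_
    rw [Units.smul_def, Units.smul_def, AddSubgroupClass.coe_zsmul, hI.coe_bracket,
      comp_fin_cons (fun y : I => (y : V)), hI.coe_bracket]

lemma IsIdeal.subalgebra_isHom (hI : g.IsIdeal I) : IsHom hI.subalgebra g I.subtype :=
  ⟨fun _ _ hx => hx, fun _ _ => rfl⟩

end Quotient

/-! ### The lower central series -/

section LowerCentralSeries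

variable (g : LInfinityAlgebra K V)

lemma lcs_zero : g.lcs 0 = ⊤ := by rw [lcs]

lemma lcs_one : g.lcs 1 = ⊤ := by rw [lcs]

/-- Each exponent is bounded by the sum, so the restriction `i_j ≤ i` in the definition of the
series is automatic. Sum zero is the case of `F^1`, the whole space. -/
lemma bracket_mem_lcs {k : ℕ} (hk : 2 ≤ k) (e : Fin k → ℕ) (x : Fin k → V)
    (hx : ∀ j, x j ∈ g.lcs (e j)) : g.bracket k x ∈ g.lcs (∑ j, e j + 1) := by
  obtain h | ⟨m, hm⟩ : ∑ j, e j = 0 ∨ ∃ m, ∑ j, e j = m + 1 := by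
    cases h : ∑ j, e j <;> simp
  · rw [h, zero_add, lcs_one]; trivial
  · rw [hm, lcs]
    have he : ∀ j, e j < m + 2 := fun j => by
      have := Finset.single_le_sum (fun i _ => Nat.zero_le (e i)) (Finset.mem_univ j)
      omega
    exact Submodule.subset_span ⟨k, hk, fun j => ⟨e j, he j⟩, hm, x, hx, rfl⟩

/-- Give the distinguished entry weight `i` and all others weight zero, which costs nothing because
`F^0` is everything. -/
lemma bracket_mem_lcs_succ {k : ℕ} (hk : 2 ≤ k) {i : ℕ} (x : Fin k → V) (j : Fin k)
    (hx : x j ∈ g.lcs i) : g.bracket k x ∈ g.lcs (i + 1) := by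
  have h := g.bracket_mem_lcs hk (Pi.single j i) x fun l => by
    by_cases hl : l = j
    · subst hl; simpa using hx
    · simp [hl, lcs_zero]
  rwa [Finset.sum_pi_single' j i Finset.univ, if_pos (Finset.mem_univ j)] at h

/-- Split the entries of a generator into homogeneous components. By induction these stay in their
`F^{i_j}`, and each resulting bracket is homogeneous, so a degree projection keeps it or kills it.
-/
lemma lcs_degreeProj_mem (i : ℕ) : ∀ d, ∀ x ∈ g.lcs i, g.degreeProj d x ∈ g.lcs i := by
  induction i using Nat.strong_induction_on with
  | _ i ih =>
    rcases i with _ | _ | i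
    · simp [lcs_zero]
    · simp [lcs_one]
    · intro d
      suffices h : g.lcs (i + 2) ≤ (g.lcs (i + 2)).comap (g.degreeProj d) from h
      conv_lhs => rw [lcs]
      rw [Submodule.span_le]
      rintro _ ⟨k, hk, e, he, x, hx, rfl⟩
      obtain ⟨s, hs⟩ := g.bracket_eq_sum_degreeProj k x
      simp only [Submodule.comap_coe, Set.mem_preimage, SetLike.mem_coe]
      rw [hs, map_sum]
      refine Submodule.sum_mem _ fun r _ => ?_
      rw [g.degreeProj_of_mem d
        (g.bracket_mem k r _ fun j => g.degreeProj_mem (r j) (x j))]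
      split_ifs
      · have h := g.bracket_mem_lcs hk (fun j => (e j : ℕ)) (fun j => g.degreeProj (r j) (x j))
          fun j => ih _ (e j).2 _ _ (hx j)
        rwa [he] at h
      · exact zero_mem _

lemma bracket_univ {k : ℕ} (x : Fin k → V) :
    g.bracket (Finset.univ : Finset (Fin k)).card
      (fun i => x ((Finset.univ : Finset (Fin k)).orderEmbOfFin rfl i)) = g.bracket k x := by
  -- The cardinality of `univ` equals `k` only propositionally; generalizing the arity allows
  -- substitution.
  have h : ∀ (m : ℕ) (hm : (Finset.univ : Finset (Fin k)).card = m),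
      g.bracket m (fun i => x (Finset.univ.orderEmbOfFin hm i)) = g.bracket k x := by
    intro m hm
    obtain rfl : k = m := by simpa using hm
    congr 1
    funext i
    congr 1
    have := Finset.orderEmbOfFin_unique' hm (f := RelEmbedding.refl _) (fun _ => Finset.mem_univ _)
    rw [← this]
    rfl
  exact h _ rfl

/-- The differential, as a linear map. -/
def delta : V →ₗ[K] V :=
  (MultilinearMap.ofSubsingleton K V V (0 : Fin 1)).symm (g.bracket 1)

lemma delta_apply (x : V) : g.delta x = g.bracket 1 fun _ => x := rfl

lemma bracket_of_card_eq_one {m : ℕ} (hm : m = 1) (x : Fin m → V) (i : Fin m) :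
    g.bracket m x = g.delta (x i) := by
  subst hm
  rw [delta_apply]
  congr 1
  funext j
  rw [Subsingleton.elim i j]

/-- The Jacobi identity expresses `δ[x_1, …, x_k]` through nested brackets whose outer arity is at
least two. An inner bracket of arity at least two gains a step in the filtration, and one of arity
one is `δ x_j`, which stays in `F^{i_j}` by induction because `i_j` is smaller than the index in
question. -/
lemma delta_mem_lcs (i : ℕ) : ∀ x ∈ g.lcs i, g.delta x ∈ g.lcs i := by
  induction i using Nat.strong_induction_on with
  | _ i ih =>
    rcases i with _ | _ | i
    · simp [lcs_zero]
    · simp [lcs_one]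
    suffices h : g.lcs (i + 2) ≤ (g.lcs (i + 2)).comap g.delta from h
    conv_lhs => rw [lcs]
    rw [Submodule.span_le]
    rintro _ ⟨k, hk, e, he, x', hx', rfl⟩
    obtain ⟨s, hs⟩ := g.bracket_eq_sum_degreeProj k x'
    simp only [Submodule.comap_coe, Set.mem_preimage, SetLike.mem_coe]
    rw [hs, map_sum]
    refine Submodule.sum_mem _ fun r _ => ?_
    set x : Fin k → V := fun j => g.degreeProj (r j) (x' j) with hxdef
    have hx : ∀ j, x j ∈ g.lcs (e j) := fun j => g.lcs_degreeProj_mem _ _ _ (hx' j)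
    have jac := g.jacobi k r x fun j => g.degreeProj_mem (r j) (x' j)
    -- The term of the full subset is `δ` of the bracket, up to sign; it is isolated.
    rw [← Finset.add_sum_erase _ _ (Finset.mem_univ Finset.univ), add_eq_zero_iff_eq_neg] at jac
    rw [g.bracket_of_card_eq_one (by simp) _ 0, Fin.cons_zero, g.bracket_univ] at jac
    rw [← units_smul_mem_iff (g.lcs (i + 2)), jac]
    refine neg_mem (Submodule.sum_mem _ fun S hS => ?_)
    rw [units_smul_mem_iff]
    have hS' : Sᶜ.card ≠ 0 := by
      simpa [Finset.compl_eq_empty_iff] using Finset.ne_of_mem_erase hS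
    -- The empty subset contributes an inner bracket of arity zero, hence nothing.
    rcases Nat.eq_zero_or_pos S.card with h0 | hpos
    · rw [MultilinearMap.map_coord_zero _ 0]
      · exact zero_mem _
      · rw [Fin.cons_zero]
        have : ∀ (m : ℕ) (y : Fin m → V), m = 0 → g.bracket m y = 0 := by
          rintro m y rfl
          rw [g.bracket_zero]; rfl
        exact this _ _ h0
    · have hinner : g.bracket S.card (fun i => x (S.orderEmbOfFin rfl i)) ∈
          g.lcs (∑ a ∈ S, (e a : ℕ)) := by
        rw [← S.sum_orderEmbOfFin fun a => (e a : ℕ)]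
        by_cases h1 : S.card = 1
        · have hsum := Fintype.sum_eq_single (⟨0, hpos⟩ : Fin S.card)
            (f := fun i => (e (S.orderEmbOfFin rfl i) : ℕ)) fun j hj =>
              absurd (Fin.ext (by have := j.2; simp only; omega)) hj
          rw [hsum, g.bracket_of_card_eq_one h1 _ ⟨0, hpos⟩]
          exact ih _ (e _).2 _ (hx _)
        · exact g.lcs_succ_le _ (g.bracket_mem_lcs (by omega) _ _ fun j => hx _)
      have houter := g.bracket_mem_lcs (k := Sᶜ.card + 1) (by omega)
        (Fin.cons (∑ a ∈ S, (e a : ℕ)) fun j => (e (Sᶜ.orderEmbOfFin rfl j) : ℕ))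
        (Fin.cons (g.bracket S.card fun i => x (S.orderEmbOfFin rfl i))
          fun j => x (Sᶜ.orderEmbOfFin rfl j)) (by
          intro j
          refine Fin.cases ?_ (fun j => ?_) j
          · simpa using hinner
          · simpa using hx _)
      rw [Fin.sum_cons, Sᶜ.sum_orderEmbOfFin fun a => (e a : ℕ),
        Finset.sum_add_sum_compl, he] at houter
      exact houter

lemma lcs_isIdeal (i : ℕ) : g.IsIdeal (g.lcs i) where
  degreeProj_mem := g.lcs_degreeProj_mem i
  bracket_mem k x j hj := by
    rcases k with _ | _ | k
    · exact j.elim0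
    · rw [g.bracket_of_card_eq_one rfl x j]
      exact g.delta_mem_lcs i _ hj
    · exact g.lcs_succ_le i (g.bracket_mem_lcs_succ (by omega) x j hj)

-- By induction the entries of a generator lift with their filtration index, hence the generator
-- lifts. Applied to `V → V ⧸ F^i`, it shows that the quotient is nilpotent.
variable {g} in
lemma IsHom.lcs_le_map {h : LInfinityAlgebra K W} {f : V →ₗ[K] W} (hf : IsHom g h f)
    (hsurj : Function.Surjective f) (i : ℕ) : h.lcs i ≤ (g.lcs i).map f := by
  induction i using Nat.strong_induction_on with
  | _ i ih =>
    rcases i with _ | _ | i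
    · rw [lcs_zero, lcs_zero, Submodule.map_top, LinearMap.range_eq_top.2 hsurj]
    · rw [lcs_one, lcs_one, Submodule.map_top, LinearMap.range_eq_top.2 hsurj]
    · conv_lhs => rw [lcs]
      rw [Submodule.span_le]
      rintro _ ⟨k, hk, e, he, x, hx, rfl⟩
      choose y hy hyx using fun j => ih _ (e j).2 (hx j)
      obtain rfl : (fun j => f (y j)) = x := funext hyx
      rw [← hf.map_bracket]
      have := g.bracket_mem_lcs hk (fun j => (e j : ℕ)) y hy
      rw [he] at this
      exact ⟨_, this, rfl⟩

lemma quotient_lcs_isNilpotent (i : ℕ) : (g.quotient _ (g.lcs_isIdeal i)).IsNilpotent := by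
  refine ⟨i, ?_⟩
  rw [eq_bot_iff]
  refine ((quotient_isHom (g.lcs_isIdeal i)).lcs_le_map (g.lcs i).mkQ_surjective i).trans ?_
  rintro _ ⟨x, hx, rfl⟩
  simpa using hx

lemma lcsGr_isIdeal (i : ℕ) : (g.quotient _ (g.lcs_isIdeal (i + 1))).IsIdeal (g.lcsGr i) :=
  (g.lcs_isIdeal (i + 1)).map_mkQ (g.lcs_isIdeal i)

/-- Brackets of valency at least two in `g / F^{i+1}` vanish if one entry lies in
`F^i / F^{i+1}`. -/
lemma quotient_bracket_lcsGr (i : ℕ) {k : ℕ} (hk : 2 ≤ k) (x : Fin k → V ⧸ g.lcs (i + 1))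
    (j : Fin k) (hj : x j ∈ g.lcsGr i) :
    (g.quotient _ (g.lcs_isIdeal (i + 1))).bracket k x = 0 := by
  obtain ⟨z, hz, hzx⟩ := hj
  choose y hy using fun j => (g.lcs (i + 1)).mkQ_surjective (x j)
  obtain rfl : (fun l => (g.lcs (i + 1)).mkQ (Function.update y j z l)) = x := by
    funext l
    by_cases hl : l = j
    · subst hl; simpa using hzx
    · simpa [hl] using hy l
  rw [← (quotient_isHom (g.lcs_isIdeal (i + 1))).map_bracket, Submodule.mkQ_apply,
    Submodule.Quotient.mk_eq_zero]
  exact g.bracket_mem_lcs_succ hk _ j (by simpa using hz)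

/-- The tower of quotients by the terms of the lower central series. -/
def lowerCentralTower : g.LowerCentralTower where
  quot i := g.quotient _ (g.lcs_isIdeal i)
  quot_nilpotent := g.quotient_lcs_isNilpotent
  proj i := quotient_isHom (g.lcs_isIdeal i)
  step i := by
    refine ⟨?_, fun k x => ?_⟩
    · rintro d _ ⟨x, hx, rfl⟩
      exact ⟨x, hx, rfl⟩
    · choose y hy using fun j => (g.lcs (i + 1)).mkQ_surjective (x j)
      obtain rfl : (fun j => (g.lcs (i + 1)).mkQ (y j)) = x := funext hy
      rw [← (quotient_isHom (g.lcs_isIdeal (i + 1))).map_bracket]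
      exact (quotient_isHom (g.lcs_isIdeal i)).map_bracket k y
  gr i := (g.lcsGr_isIdeal i).subalgebra
  gr_abelian i k hk := by
    ext x
    rcases k with _ | k
    · omega
    · exact g.quotient_bracket_lcsGr i hk (fun j => x j) 0 (x 0).2
  incl i := (g.lcsGr_isIdeal i).subalgebra_isHom

end LowerCentralSeries

end Graded

end LInfinityAlgebra

/-! ### The Poincaré lemma on the simplex -/

namespace Forms

open Polynomial

variable {K : Type v} [Field K] {n : ℕ}

lemma algebraMap_mem_homogeneous (r : K) : algebraMap K (Forms K n) r ∈ homogeneous K n 0 := by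
  rw [homogeneous, pow_zero, mul_one]
  exact Subalgebra.algebraMap_mem _ r

lemma t_mem_homogeneous (i : Fin (n + 1)) : t K i ∈ homogeneous K n 0 := by
  rw [homogeneous, pow_zero, mul_one]
  exact Algebra.subset_adjoin ⟨i, rfl⟩

lemma one_mem_homogeneous : (1 : Forms K n) ∈ homogeneous K n 0 := by
  simpa using algebraMap_mem_homogeneous (n := n) (1 : K)

lemma dt_mem_homogeneous (i : Fin (n + 1)) : dt K i ∈ homogeneous K n 1 := by
  rw [homogeneous, pow_one, ← one_mul (dt K i)]
  exact Submodule.mul_mem_mul (Subalgebra.one_mem _) (Submodule.subset_span ⟨i, rfl⟩)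

lemma commute_of_mem_adjoin {a : Forms K n} (ha : a ∈ Algebra.adjoin K (Set.range (t K)))
    {b : Forms K n} (hb : b ∈ Submodule.span K (Set.range (dt K))) : Commute a b := by
  induction hb using Submodule.span_induction with
  | mem b hb =>
    obtain ⟨j, rfl⟩ := hb
    induction ha using Algebra.adjoin_induction with
    | mem a ha => obtain ⟨i, rfl⟩ := ha; exact t_mul_dt i j
    | algebraMap r => exact Algebra.commutes r _
    | add a b _ _ ha hb => exact ha.add_left hb
    | mul a b _ _ ha hb => exact ha.mul_left hb
  | zero => exact Commute.zero_right a
  | add b c _ _ hb hc => exact hb.add_right hc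
  | smul r b _ hb => exact hb.smul_right r

/-- Functions commute with the span of the `dt_i`, so the factors can be regrouped, and the algebra
of functions is idempotent under multiplication. -/
lemma homogeneous_mul (p q : ℕ) :
    homogeneous K n p * homogeneous K n q = homogeneous K n (p + q) := by
  have h : Commute (Subalgebra.toSubmodule (Algebra.adjoin K (Set.range (t K (n := n)))))
      (Submodule.span K (Set.range (dt K))) :=
    Submodule.mul_comm_of_commute fun _ ha _ hb => commute_of_mem_adjoin ha hb
  have h2 := (Algebra.adjoin K (Set.range (t K (n := n)))).isIdempotentElem_toSubmodule.eq
  rw [homogeneous, homogeneous, mul_assoc, ← mul_assoc (_ ^ p), ← (h.pow_right p).eq, mul_assoc,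
    ← mul_assoc, h2, ← pow_add, homogeneous]

lemma mul_mem_homogeneous {p q : ℕ} {a b : Forms K n} (ha : a ∈ homogeneous K n p)
    (hb : b ∈ homogeneous K n q) : a * b ∈ homogeneous K n (p + q) := by
  rw [← homogeneous_mul]; exact Submodule.mul_mem_mul ha hb

/-- Reduces a statement about degrees to generators and products. Stability under scalars need not
be assumed: it is multiplication by a constant, of degree zero. -/
lemma homogeneous_induction {P : ℕ → Forms K n → Prop} (alg : ∀ r, P 0 (algebraMap K _ r))
    (ht : ∀ i, P 0 (t K i)) (hdt : ∀ i, P 1 (dt K i))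
    (add : ∀ p a b, P p a → P p b → P p (a + b))
    (mul : ∀ p q a b, P p a → P q b → P (p + q) (a * b)) {p : ℕ} {a : Forms K n}
    (ha : a ∈ homogeneous K n p) : P p a := by
  have hL : ∀ b ∈ Submodule.span K (Set.range (dt K (n := n))), P 1 b := by
    have hsmul : ∀ (r : K) (b : Forms K n), P 1 b → P 1 (r • b) := fun r b hb => by
      have := mul 0 1 _ _ (alg r) hb
      rwa [zero_add, ← Algebra.smul_def] at this
    intro b hb
    induction hb using Submodule.span_induction with
    | mem b hb => obtain ⟨j, rfl⟩ := hb; exact hdt j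
    | zero => simpa using hsmul 0 _ (hdt 0)
    | add b c _ _ hb hc => exact add _ _ _ hb hc
    | smul r b _ hb => exact hsmul r b hb
  have hA : ∀ b ∈ Algebra.adjoin K (Set.range (t K (n := n))), P 0 b := by
    intro b hb
    induction hb using Algebra.adjoin_induction with
    | mem a ha => obtain ⟨i, rfl⟩ := ha; exact ht i
    | algebraMap r => exact alg r
    | add a b _ _ ha hb => exact add _ _ _ ha hb
    | mul a b _ _ ha hb => exact mul 0 0 _ _ ha hb
  induction p generalizing a with
  | zero =>
    rw [homogeneous, pow_zero, mul_one] at ha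
    exact hA a ha
  | succ p ih =>
    rw [homogeneous, pow_succ, ← mul_assoc] at ha
    induction ha using Submodule.mul_induction_on' with
    | mem_mul_mem b hb c hc => exact mul _ _ _ _ (ih hb) (hL c hc)
    | add b _ c _ hb hc => exact add _ _ _ hb hc

lemma parity_of_mem {p : ℕ} {a : Forms K n} (ha : a ∈ homogeneous K n p) :
    parity a = (p : ℤ).negOnePow • a := by
  refine homogeneous_induction (P := fun p a => parity a = (p : ℤ).negOnePow • a) ?_ ?_ ?_ ?_ ?_ ha
  · simp
  · simp
  · simp [Units.smul_def]
  · intro p a b ha hb; rw [map_add, ha, hb, smul_add]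
  · intro p q a b ha hb
    rw [map_mul, ha, hb, smul_mul_smul_comm, ← Int.negOnePow_add, Nat.cast_add]

lemma parity_parity (a : Forms K n) : parity (parity a) = a := by
  have : (parity (K := K) (n := n)).comp parity = AlgHom.id K _ := by
    apply algHom_ext <;> intro i <;> simp
  exact DFunLike.congr_fun this a

@[simp] lemma d_algebraMap (r : K) : d (algebraMap K (Forms K n) r) = 0 := by
  simp [d, Matrix.algebraMap_matrix_apply]

lemma d_parity (a : Forms K n) : d (parity a) = -parity (d a) := by
  induction a using Forms.induction with
  | hK r => simp
  | ht i => simp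
  | hdt i => simp
  | hadd a b ha hb => simp only [map_add, ha, hb]; abel
  | hmul a b ha hb => simp only [map_mul, d_mul, map_add, ha, hb]; noncomm_ring

lemma d_d (a : Forms K n) : d (d a) = 0 := by
  induction a using Forms.induction with
  | hK r => simp
  | ht i => simp
  | hdt i => simp
  | hadd a b ha hb => simp [ha, hb]
  | hmul a b ha hb => simp [d_mul, ha, hb, d_parity]

lemma d_mem_homogeneous {p : ℕ} {a : Forms K n} (ha : a ∈ homogeneous K n p) :
    d a ∈ homogeneous K n (p + 1) := by
  refine (homogeneous_induction
    (P := fun p a => a ∈ homogeneous K n p ∧ d a ∈ homogeneous K n (p + 1)) ?_ ?_ ?_ ?_ ?_ ha).2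
  · exact fun r => ⟨algebraMap_mem_homogeneous r, by simp⟩
  · exact fun i => ⟨t_mem_homogeneous i, by simpa using dt_mem_homogeneous i⟩
  · exact fun i => ⟨dt_mem_homogeneous i, by simp⟩
  · intro p a b ha hb
    exact ⟨add_mem ha.1 hb.1, by rw [map_add]; exact add_mem ha.2 hb.2⟩
  · intro p q a b ha hb
    refine ⟨mul_mem_homogeneous ha.1 hb.1, ?_⟩
    rw [d_mul, parity_of_mem ha.1]
    refine add_mem ?_ ?_
    · rw [add_right_comm]
      exact mul_mem_homogeneous ha.2 hb.1
    · rw [smul_mul_assoc, units_smul_mem_iff, add_assoc]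
      exact mul_mem_homogeneous ha.1 hb.2

/-! ### Forms with a polynomial parameter, and the contraction to a vertex -/

/-- The differential of polynomials with coefficients in the forms, with `X` constant. -/
def polyD : (Forms K n)[X] →ₗ[K] (Forms K n)[X] :=
  Polynomial.lsum fun i => ((monomial i).restrictScalars K).comp d

/-- Integration of polynomials from `0` to `1`. -/
def polyIntegral : (Forms K n)[X] →ₗ[K] Forms K n :=
  Polynomial.lsum fun i => ((i + 1 : K)⁻¹) • LinearMap.id

/-- Evaluation of polynomials at a scalar. -/
def polyEval (c : K) : (Forms K n)[X] →ₐ[K] Forms K n :=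
  { eval₂RingHom' (RingHom.id _) (algebraMap K (Forms K n) c)
      fun a => (Algebra.commutes c a).symm with
    commutes' := fun r => by simp [Polynomial.algebraMap_apply, eval₂RingHom'] }

@[simp] lemma polyD_monomial (i : ℕ) (a : Forms K n) : polyD (monomial i a) = monomial i (d a) := by
  simp [polyD, Polynomial.lsum]

@[simp] lemma polyIntegral_monomial (i : ℕ) (a : Forms K n) :
    polyIntegral (monomial i a) = ((i + 1 : K)⁻¹) • a := by
  simp [polyIntegral, Polynomial.lsum]

@[simp] lemma polyEval_monomial (c : K) (i : ℕ) (a : Forms K n) :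
    polyEval c (monomial i a) = a * (algebraMap K _ c) ^ i :=
  eval₂_monomial _ _

@[simp] lemma polyEval_C (c : K) (a : Forms K n) : polyEval c (C a) = a :=
  eval₂_C _ _

@[simp] lemma polyEval_X (c : K) : polyEval c (X : (Forms K n)[X]) = algebraMap K _ c :=
  eval₂_X _ _

@[simp] lemma polyD_C (a : Forms K n) : polyD (C a) = C (d a) := polyD_monomial 0 a

@[simp] lemma polyD_X : polyD (X : (Forms K n)[X]) = 0 := by
  have := polyD_monomial 1 (1 : Forms K n)
  rw [monomial_one_one_eq_X] at this
  rw [this]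
  have h : d (1 : Forms K n) = 0 := by simpa using d_algebraMap (n := n) (1 : K)
  simp [h]

lemma polyD_mul (p q : (Forms K n)[X]) :
    polyD (p * q) = polyD p * q + p.map (parity (K := K) (n := n)).toRingHom * polyD q := by
  induction p using Polynomial.induction_on' with
  | add p p' hp hp' => simp only [add_mul, map_add, hp, hp', Polynomial.map_add]; abel
  | monomial i a =>
    induction q using Polynomial.induction_on' with
    | add q q' hq hq' => simp only [mul_add, map_add, hq, hq']; abel
    | monomial j b => simp [monomial_mul_monomial, d_mul]

lemma polyIntegral_polyD (p : (Forms K n)[X]) : polyIntegral (polyD p) = d (polyIntegral p) := by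
  induction p using Polynomial.induction_on' with
  | add p p' hp hp' => simp [hp, hp']
  | monomial i a => simp

/-- The fundamental theorem of calculus. Characteristic zero enters the Poincaré lemma here, through
the invertibility of `i + 1`. -/
lemma polyIntegral_derivative [CharZero K] (p : (Forms K n)[X]) :
    polyIntegral (derivative p) = polyEval 1 p - polyEval 0 p := by
  induction p using Polynomial.induction_on' with
  | add p p' hp hp' => simp only [map_add, hp, hp']; abel
  | monomial i a =>
    rcases i with _ | i
    · simp
    · have h : ((i : K) + 1) ≠ 0 := by exact_mod_cast Nat.succ_ne_zero i
      have h2 : a * ((i : Forms K n) + 1) = ((i : K) + 1) • a := by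
        rw [Algebra.smul_def, Algebra.commutes]; simp
      simp [h2, smul_smul, mul_inv_cancel₀ h]

/-- The value of `t_i` at the vertex `w`. -/
def vertexValue (w i : Fin (n + 1)) : Forms K n := if w = i then 1 else 0

lemma sum_vertexValue (w : Fin (n + 1)) : ∑ i, (vertexValue w i : Forms K n) = 1 := by
  simp [vertexValue]

lemma commute_vertexValue (w i : Fin (n + 1)) (a : Forms K n) :
    a * vertexValue w i = vertexValue w i * a := by
  unfold vertexValue; split_ifs <;> simp

lemma parity_vertexValue (w i : Fin (n + 1)) :
    parity (vertexValue w i : Forms K n) = vertexValue w i := by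
  unfold vertexValue; split_ifs <;> simp

lemma d_vertexValue (w i : Fin (n + 1)) : d (vertexValue w i : Forms K n) = 0 := by
  unfold vertexValue
  split_ifs
  · simpa using d_algebraMap (n := n) (1 : K)
  · simp

/-- The coordinate `t_i` along the affine contraction of the simplex to the vertex `w`. -/
def contractT (w i : Fin (n + 1)) : (Forms K n)[X] :=
  C (vertexValue w i) + X * C (t K i - vertexValue w i)

lemma sum_contractT (w : Fin (n + 1)) : ∑ i, contractT (K := K) w i = 1 := by
  simp only [contractT, Finset.sum_add_distrib, ← Finset.mul_sum, ← map_sum,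
    Finset.sum_sub_distrib, sum_t, sum_vertexValue]
  simp

lemma vertexDiff_comm (w i j : Fin (n + 1)) :
    (t K i - vertexValue w i) * (t K j - vertexValue w j) =
      (t K j - vertexValue w j) * (t K i - vertexValue w i) := by
  simp only [sub_mul, mul_sub, t_mul_t i j, commute_vertexValue w _ (t K _),
    commute_vertexValue w i (vertexValue w j)]
  abel

lemma vertexDiff_comm_dt (w i j : Fin (n + 1)) :
    (t K i - vertexValue w i) * dt K j = dt K j * (t K i - vertexValue w i) := by
  simp only [sub_mul, mul_sub, t_mul_dt, commute_vertexValue]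

lemma C_mul_X' (a : Forms K n) (p : (Forms K n)[X]) : C a * (X * p) = X * (C a * p) := by
  rw [← mul_assoc, ← mul_assoc, (commute_X (C a)).eq]

lemma contractT_commute_C (w i : Fin (n + 1)) {a : Forms K n}
    (ha : (t K i - vertexValue w i) * a = a * (t K i - vertexValue w i)) :
    contractT w i * C a = C a * contractT w i := by
  simp only [contractT, add_mul, mul_add, C_mul_X', mul_assoc, ← C_mul, ha, commute_vertexValue]

lemma contractT_commute_X (w i : Fin (n + 1)) (p : (Forms K n)[X]) :
    contractT w i * (X * p) = X * (contractT w i * p) := by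
  rw [← mul_assoc, ← mul_assoc, (commute_X (contractT w i)).eq]

lemma contractT_comm (w i j : Fin (n + 1)) :
    contractT (K := K) w i * contractT w j = contractT w j * contractT w i := by
  conv_lhs => rw [contractT.eq_def w j]
  conv_rhs => rw [contractT.eq_def w j]
  rw [mul_add, add_mul, contractT_commute_X, contractT_commute_C, contractT_commute_C, mul_assoc]
  · exact vertexDiff_comm w i j
  · exact commute_vertexValue w j _

/-- The pullback of forms along the affine contraction `(s, x) ↦ s x + (1 - s) w` of the simplex to
the vertex `w`: if `P + ds Q` is the pullback of `ω`, its value on `ω` is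
`!![(-1)^{|ω|} P, Q; 0, P]`. -/
def contraction (w : Fin (n + 1)) :
    Forms K n →ₐ[K] Matrix (Fin 2) (Fin 2) (Forms K n)[X] :=
  lift (fun i => !![contractT w i, 0; 0, contractT w i])
    -- The differential of `v_i + s (t_i - v_i)` is `s dt_i + ds (t_i - v_i)`, which gives `P` and
    -- `Q` on `dt_i`.
    (fun i => !![-(X * C (dt K i)), C (t K i - vertexValue w i); 0, X * C (dt K i)])
    (fun i j => by
      simp only [Matrix.mul_fin_two, mul_zero, zero_mul, add_zero, zero_add, contractT_comm w i j])
    (fun i j => by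
      simp only [Matrix.mul_fin_two, mul_zero, zero_mul, add_zero, zero_add, mul_neg, neg_mul,
        contractT_commute_X, mul_assoc,
        contractT_commute_C w i (vertexDiff_comm_dt w i j),
        contractT_commute_C w i (vertexDiff_comm w i j), neg_zero])
    (fun i j => by
      have h : (X * C (dt K i)) * (X * C (dt K j)) =
          -((X * C (dt K j)) * (X * C (dt K i)) : (Forms K n)[X]) := by
        simp only [mul_assoc, C_mul_X', ← C_mul, dt_mul_dt i j, C_neg, mul_neg]
      have h2 : ∀ i j, C (t K i - vertexValue w i) * (X * C (dt K j)) =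
          (X * C (dt K j)) * (C (t K i - vertexValue w i) : (Forms K n)[X]) := by
        intro i j
        simp only [mul_assoc, C_mul_X', ← C_mul, vertexDiff_comm_dt]
      ext a b : 1
      fin_cases a <;> fin_cases b <;>
      simp only [Matrix.mul_fin_two, mul_zero, zero_mul, add_zero, zero_add, mul_neg, neg_mul,
        neg_neg, h2, Matrix.neg_apply, Matrix.of_apply, Matrix.cons_val, neg_zero, neg_add_rev,
        Fin.zero_eta, Fin.mk_one, Fin.isValue]
      · exact h
      · exact h)
    (by
      have := sum_contractT (K := K) w
      ext a b : 1
      fin_cases a <;> fin_cases b <;> simp [Matrix.sum_apply, this])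
    (by
      have h : ∑ i, X * C (dt K i) = (0 : (Forms K n)[X]) := by
        rw [← Finset.mul_sum, ← map_sum, sum_dt]; simp
      have h2 : ∑ i, C (t K i - vertexValue w i) = (0 : (Forms K n)[X]) := by
        rw [← map_sum, Finset.sum_sub_distrib, sum_t, sum_vertexValue]; simp
      ext a b : 1
      fin_cases a <;> fin_cases b <;>
        simp only [Matrix.sum_apply, Matrix.of_apply, Matrix.cons_val, Fin.zero_eta, Fin.mk_one,
          Fin.isValue, Finset.sum_neg_distrib, h, h2, neg_zero, Finset.sum_const_zero,
          Matrix.zero_apply])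

@[simp] lemma contraction_t (w i : Fin (n + 1)) :
    contraction w (t K i) = !![contractT w i, 0; 0, contractT w i] := lift_t i

@[simp] lemma contraction_dt (w i : Fin (n + 1)) : contraction w (dt K i) =
    !![-(X * C (dt K i)), C (t K i - vertexValue w i); 0, X * C (dt K i)] := lift_dt i

/-- The part of the contraction that does not involve `ds`. -/
def contractP (w : Fin (n + 1)) (a : Forms K n) : (Forms K n)[X] := contraction w a 1 1

/-- The coefficient of `ds` in the contraction. -/
def contractQ (w : Fin (n + 1)) : Forms K n →ₗ[K] (Forms K n)[X] where
  toFun a := contraction w a 0 1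
  map_add' a b := by simp
  map_smul' r a := by simp

/-- The coefficientwise parity automorphism. -/
def polyParity : (Forms K n)[X] →+* (Forms K n)[X] :=
  Polynomial.mapRingHom (parity (K := K) (n := n)).toRingHom

@[simp] lemma polyParity_C (a : Forms K n) : polyParity (C a) = C (parity a) := map_C _
@[simp] lemma polyParity_X : polyParity (X : (Forms K n)[X]) = X := map_X _

lemma polyParity_contractT (w i : Fin (n + 1)) :
    polyParity (contractT (K := K) w i) = contractT w i := by
  simp [contractT, parity_vertexValue]

lemma contraction_one_zero (w : Fin (n + 1)) (a : Forms K n) : contraction w a 1 0 = 0 := by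
  induction a using Forms.induction with
  | hK r => simp [Matrix.algebraMap_matrix_apply]
  | ht i => simp
  | hdt i => simp
  | hadd a b ha hb => simp [ha, hb]
  | hmul a b ha hb => simp [Matrix.mul_apply, ha, hb]

/-- The upper diagonal entry is `P` twisted by parity; with this, matrix multiplication becomes the
twisted product rule `contractQ_mul`. -/
lemma contraction_zero_zero (w : Fin (n + 1)) (a : Forms K n) :
    contraction w a 0 0 = contractP w (parity a) := by
  unfold contractP
  induction a using Forms.induction with
  | hK r => simp [Matrix.algebraMap_matrix_apply]
  | ht i => simp
  | hdt i => simp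
  | hadd a b ha hb => simp [ha, hb]
  | hmul a b ha hb => simp [Matrix.mul_apply, ha, hb, contraction_one_zero]

section

variable (w : Fin (n + 1))

@[simp] lemma contractP_algebraMap (r : K) :
    contractP w (algebraMap K (Forms K n) r) = algebraMap K _ r := by
  simp [contractP, Matrix.algebraMap_matrix_apply]

@[simp] lemma contractP_t (i : Fin (n + 1)) : contractP w (t K i) = contractT w i := by
  simp [contractP]

@[simp] lemma contractP_dt (i : Fin (n + 1)) : contractP w (dt K i) = X * C (dt K i) := by
  simp [contractP]

@[simp] lemma contractP_add (a b : Forms K n) :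
    contractP w (a + b) = contractP w a + contractP w b := by
  simp [contractP]

@[simp] lemma contractP_neg (a : Forms K n) : contractP w (-a) = -contractP w a := by
  simp [contractP]

@[simp] lemma contractP_mul (a b : Forms K n) :
    contractP w (a * b) = contractP w a * contractP w b := by
  simp [contractP, Matrix.mul_apply, contraction_one_zero]

@[simp] lemma contractQ_algebraMap (r : K) : contractQ w (algebraMap K (Forms K n) r) = 0 := by
  simp [contractQ, Matrix.algebraMap_matrix_apply]

@[simp] lemma contractQ_t (i : Fin (n + 1)) : contractQ w (t K i) = 0 := by
  simp [contractQ]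

@[simp] lemma contractQ_dt (i : Fin (n + 1)) :
    contractQ w (dt K i) = C (t K i - vertexValue w i) := by
  simp [contractQ]

lemma contractQ_mul (a b : Forms K n) : contractQ w (a * b) =
    contractP w (parity a) * contractQ w b + contractQ w a * contractP w b := by
  rw [← contraction_zero_zero]
  simp [contractQ, contractP, Matrix.mul_apply]

lemma polyParity_contractP (a : Forms K n) :
    polyParity (contractP w a) = contractP w (parity a) := by
  induction a using Forms.induction with
  | hK r => simp
  | ht i => simp [polyParity_contractT]
  | hdt i => simp
  | hadd a b ha hb => simp [ha, hb]
  | hmul a b ha hb => simp [ha, hb]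

lemma contractQ_parity (a : Forms K n) :
    contractQ w (parity a) = -polyParity (contractQ w a) := by
  induction a using Forms.induction with
  | hK r => simp
  | ht i => simp
  | hdt i => simp [parity_vertexValue]
  | hadd a b ha hb => simp only [map_add, ha, hb]; abel
  | hmul a b ha hb =>
    simp only [map_mul, contractQ_mul, map_add, ha, hb, polyParity_contractP]
    noncomm_ring

/-- The component free of `ds` in the statement that pullback commutes with the de Rham
differential. -/
lemma polyD_contractP (a : Forms K n) : polyD (contractP w a) = contractP w (d a) := by
  induction a using Forms.induction with
  | hK r =>
    rw [contractP_algebraMap, d_algebraMap, Polynomial.algebraMap_apply, polyD_C, d_algebraMap]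
    simp [contractP]
  | ht i =>
    rw [contractP_t, contractT, map_add, polyD_C, d_vertexValue, polyD_mul, polyD_X, polyD_C,
      map_X, d_t, contractP_dt, map_sub d, d_t, d_vertexValue]
    simp
  | hdt i =>
    rw [contractP_dt, polyD_mul, polyD_X, polyD_C]
    simp [contractP]
  | hadd a b ha hb => simp [ha, hb]
  | hmul a b ha hb =>
    rw [contractP_mul, polyD_mul, ha, hb, d_mul, contractP_add, contractP_mul, contractP_mul,
      ← polyParity_contractP]
    rfl

/-- The `ds`-component of the same statement: the differential of `P + ds Q` is `dP + ds (∂P/∂s -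
dQ)`, with `d` in the directions of the simplex. -/
lemma contractQ_d (a : Forms K n) :
    contractQ w (d a) = derivative (contractP w a) - polyD (contractQ w a) := by
  induction a using Forms.induction with
  | hK r => simp [Polynomial.algebraMap_apply]
  | ht i => simp [contractT]
  | hdt i => simp [d_vertexValue]
  | hadd a b ha hb => simp only [map_add, contractP_add, ha, hb]; abel
  | hmul a b ha hb =>
    have h1 : ∀ p q : (Forms K n)[X], polyD (p * q) = polyD p * q + polyParity p * polyD q :=
      polyD_mul
    simp only [d_mul, map_add, contractQ_mul, contractP_mul, derivative_mul, h1, ha, hb,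
      polyParity_contractP, polyD_contractP, contractQ_parity, parity_parity, d_parity,
      contractP_neg]
    noncomm_ring

lemma polyEval_one_contractP (a : Forms K n) : polyEval 1 (contractP w a) = a := by
  induction a using Forms.induction with
  | hK r => simp
  | ht i => simp [contractT]
  | hdt i => simp
  | hadd a b ha hb => simp [ha, hb]
  | hmul a b ha hb => simp [ha, hb]

lemma polyEval_zero_contractP (a : Forms K n) :
    polyEval 0 (contractP w a) = pullback (fun _ : Fin (n + 1) => w) a := by
  induction a using Forms.induction with
  | hK r => simp
  | ht i =>
    simp only [contractP_t, contractT, pullback_t, map_add, map_mul, polyEval_C, polyEval_X,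
      map_zero, zero_mul, add_zero, vertexValue]
    split_ifs with h <;> simp [h, sum_t]
  | hdt i =>
    by_cases h : w = i <;> simp [h, sum_dt]
  | hadd a b ha hb => simp [ha, hb]
  | hmul a b ha hb => simp [ha, hb]

/-- The homotopy between the identity and the evaluation at the vertex `w`. -/
def homotopy : Forms K n →ₗ[K] Forms K n := polyIntegral.comp (contractQ w)

/-- Integrate `contractQ_d` over `s` from `0` to `1`. At `s = 1` the contraction is the identity, at
`s = 0` it is constant at `w`. -/
lemma homotopy_d [CharZero K] (a : Forms K n) : homotopy w (d a) + d (homotopy w a) =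
    a - pullback (fun _ : Fin (n + 1) => w) a := by
  simp only [homotopy, LinearMap.comp_apply, contractQ_d, map_sub, polyIntegral_derivative,
    polyIntegral_polyD, polyEval_one_contractP, polyEval_zero_contractP]
  abel

end

/-! ### The homotopy lowers the degree by one -/

/-- The polynomials with coefficients in `G`. -/
def coeffsIn (G : Submodule K (Forms K n)) : Submodule K (Forms K n)[X] where
  carrier := {p | ∀ i, p.coeff i ∈ G}
  add_mem' hp hq i := by rw [coeff_add]; exact add_mem (hp i) (hq i)
  zero_mem' i := by rw [coeff_zero]; exact zero_mem _
  smul_mem' r p hp i := by rw [coeff_smul]; exact G.smul_mem r (hp i)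

lemma C_mem_coeffsIn {G : Submodule K (Forms K n)} {a : Forms K n} (ha : a ∈ G) :
    C a ∈ coeffsIn G := by
  intro i
  rw [coeff_C]
  split_ifs
  · exact ha
  · exact zero_mem _

lemma X_mul_C_mem_coeffsIn {G : Submodule K (Forms K n)} {a : Forms K n} (ha : a ∈ G) :
    X * C a ∈ coeffsIn G := by
  intro i
  rcases i with _ | i
  · simp
  · rw [coeff_X_mul]; exact C_mem_coeffsIn ha i

lemma mul_mem_coeffsIn {G H I : Submodule K (Forms K n)} (h : G * H ≤ I) {p q : (Forms K n)[X]}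
    (hp : p ∈ coeffsIn G) (hq : q ∈ coeffsIn H) : p * q ∈ coeffsIn I := by
  intro i
  rw [coeff_mul]
  exact Submodule.sum_mem _ fun x _ => h (Submodule.mul_mem_mul (hp _) (hq _))

lemma polyIntegral_mem {G : Submodule K (Forms K n)} {p : (Forms K n)[X]}
    (hp : p ∈ coeffsIn G) : polyIntegral p ∈ G :=
  Submodule.sum_mem _ fun i _ => G.smul_mem _ (hp i)

/-- The forms of degree `p - 1`; none if `p = 0`. -/
def homogeneousPred : ℕ → Submodule K (Forms K n)
  | 0 => ⊥
  | p + 1 => homogeneous K n p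

lemma homogeneous_mul_pred (p q : ℕ) :
    homogeneous K n p * homogeneousPred q ≤ homogeneousPred (p + q) := by
  rcases q with _ | q
  · simp [homogeneousPred]
  · exact (homogeneous_mul p q).le

lemma homogeneousPred_mul (p q : ℕ) :
    homogeneousPred p * homogeneous K n q ≤ homogeneousPred (p + q) := by
  rcases p with _ | p
  · simp [homogeneousPred]
  · rw [add_right_comm]
    exact (homogeneous_mul p q).le

lemma vertexValue_mem_homogeneous (w i : Fin (n + 1)) :
    vertexValue w i ∈ homogeneous K n 0 := by
  unfold vertexValue
  split_ifs
  · exact one_mem_homogeneous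
  · exact zero_mem _

/-- The induction carries the degree of `contractP` along, since the product rule for `contractQ`
involves both. -/
lemma contract_mem {w : Fin (n + 1)} {p : ℕ} {a : Forms K n} (ha : a ∈ homogeneous K n p) :
    contractQ w a ∈ coeffsIn (homogeneousPred p) := by
  refine (homogeneous_induction (P := fun p a => a ∈ homogeneous K n p ∧
    contractP w a ∈ coeffsIn (homogeneous K n p) ∧ contractQ w a ∈ coeffsIn (homogeneousPred p))
      ?_ ?_ ?_ ?_ ?_ ha).2.2
  · intro r
    refine ⟨algebraMap_mem_homogeneous r, ?_, by simp⟩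
    rw [contractP_algebraMap, Polynomial.algebraMap_apply]
    exact C_mem_coeffsIn (algebraMap_mem_homogeneous r)
  · intro i
    refine ⟨t_mem_homogeneous i, ?_, by simp⟩
    rw [contractP_t]
    exact add_mem (C_mem_coeffsIn (vertexValue_mem_homogeneous w i)) (X_mul_C_mem_coeffsIn
      (sub_mem (t_mem_homogeneous i) (vertexValue_mem_homogeneous w i)))
  · intro i
    refine ⟨dt_mem_homogeneous i, ?_, ?_⟩
    · rw [contractP_dt]
      exact X_mul_C_mem_coeffsIn (dt_mem_homogeneous i)
    · rw [contractQ_dt]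
      exact C_mem_coeffsIn (sub_mem (t_mem_homogeneous i) (vertexValue_mem_homogeneous w i))
  · rintro p a b ⟨ha, ha', ha''⟩ ⟨hb, hb', hb''⟩
    refine ⟨add_mem ha hb, ?_, ?_⟩
    · rw [contractP_add]; exact add_mem ha' hb'
    · rw [map_add]; exact add_mem ha'' hb''
  · rintro p q a b ⟨ha, ha', ha''⟩ ⟨hb, hb', hb''⟩
    refine ⟨mul_mem_homogeneous ha hb, ?_, ?_⟩
    · rw [contractP_mul]; exact mul_mem_coeffsIn (homogeneous_mul p q).le ha' hb'
    · rw [contractQ_mul]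
      refine add_mem (mul_mem_coeffsIn (homogeneous_mul_pred p q) ?_ hb'')
        (mul_mem_coeffsIn (homogeneousPred_mul p q) ha'' hb')
      rw [← polyParity_contractP]
      intro i
      rw [polyParity, coe_mapRingHom, coeff_map]
      have := parity_of_mem (ha' i)
      change parity _ ∈ _
      rw [this, units_smul_mem_iff]
      exact ha' i

lemma homotopy_mem {w : Fin (n + 1)} {p : ℕ} {a : Forms K n} (ha : a ∈ homogeneous K n p) :
    homotopy w a ∈ homogeneousPred p :=
  polyIntegral_mem (contract_mem ha)

end Forms

/-! ### Koszul signs -/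

section Signs

lemma negOnePow_sum {ι : Type*} (s : Finset ι) (e : ι → ℤ) :
    (∑ i ∈ s, e i).negOnePow = ∏ i ∈ s, (e i).negOnePow := by
  induction s using Finset.cons_induction with
  | empty => simp
  | cons a s ha ih => rw [Finset.prod_cons, Finset.sum_cons, Int.negOnePow_add, ih]

/-- The product over all pairs `i < j`. -/
def pairProd {k : ℕ} (f : Fin k → Fin k → ℤˣ) : ℤˣ :=
  ∏ i, ∏ j, if i < j then f i j else 1

/-- Signs in this form can be multiplied and compared pair by pair, which reduces a sign identity to
a few parity checks. -/
lemma negOnePow_sum_pairs {k : ℕ} (f : Fin k → Fin k → ℤ) :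
    (∑ i, ∑ j ∈ Finset.Ioi i, f i j).negOnePow = pairProd fun i j => (f i j).negOnePow := by
  simp only [negOnePow_sum, pairProd]
  refine Finset.prod_congr rfl fun i _ => ?_
  rw [← Finset.prod_filter]
  refine Finset.prod_congr ?_ fun _ _ => rfl
  ext j; simp

lemma prod_mem_eq_prod_univ {ι M : Type*} [Fintype ι] [DecidableEq ι] [CommMonoid M]
    (S : Finset ι) (f : ι → M) : ∏ a ∈ S, f a = ∏ a, if a ∈ S then f a else 1 := by
  rw [Finset.prod_ite_mem, Finset.univ_inter]

lemma prod_orderEmbOfFin {M : Type*} [CommMonoid M] {n : ℕ} (S : Finset (Fin n))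
    (f : Fin n → M) : ∏ i, f (S.orderEmbOfFin rfl i) = ∏ a, if a ∈ S then f a else 1 := by
  rw [← prod_mem_eq_prod_univ, ← Finset.prod_coe_sort S]
  exact Fintype.prod_equiv (S.orderIsoOfFin rfl).toEquiv _ _ fun i => rfl

lemma pairProd_orderEmbOfFin {n : ℕ} (S : Finset (Fin n)) (f : Fin n → Fin n → ℤˣ) :
    (pairProd fun i j => f (S.orderEmbOfFin rfl i) (S.orderEmbOfFin rfl j)) =
      pairProd fun a b => if a ∈ S ∧ b ∈ S then f a b else 1 := by
  unfold pairProd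
  have h : ∀ i j, (if i < j then f (S.orderEmbOfFin rfl i) (S.orderEmbOfFin rfl j) else 1) =
      (fun a b => if a < b then f a b else 1) (S.orderEmbOfFin rfl i) (S.orderEmbOfFin rfl j) := by
    intro i j
    simp only [OrderEmbedding.lt_iff_lt]
  simp only [h]
  rw [prod_orderEmbOfFin S fun a => ∏ j, (fun a b => if a < b then f a b else 1) a
    (S.orderEmbOfFin rfl j)]
  refine Finset.prod_congr rfl fun a _ => ?_
  rw [prod_orderEmbOfFin S fun b => if a < b then f a b else 1]
  by_cases ha : a ∈ S
  · rw [if_pos ha]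
    refine Finset.prod_congr rfl fun b _ => ?_
    by_cases hb : b ∈ S <;> simp [ha, hb]
  · simp [ha]

lemma pairProd_succ {k : ℕ} (f : Fin (k + 1) → Fin (k + 1) → ℤˣ) :
    pairProd f = (∏ j : Fin k, f 0 j.succ) * pairProd fun i j => f i.succ j.succ := by
  simp [pairProd, Fin.prod_univ_succ]

lemma pairProd_mul {k : ℕ} (f g : Fin k → Fin k → ℤˣ) :
    pairProd f * pairProd g = pairProd fun i j => f i j * g i j := by
  simp only [pairProd, ← Finset.prod_mul_distrib]
  refine Finset.prod_congr rfl fun i _ => Finset.prod_congr rfl fun j _ => ?_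
  split_ifs <;> simp

lemma pairProd_congr {k : ℕ} {f g : Fin k → Fin k → ℤˣ} (h : ∀ i j, i < j → f i j = g i j) :
    pairProd f = pairProd g := by
  refine Finset.prod_congr rfl fun i _ => Finset.prod_congr rfl fun j _ => ?_
  split_ifs with hij
  · exact h i j hij
  · rfl

/-- A product over `S × Sᶜ` as a product over pairs `i < j`. -/
lemma prod_prod_compl {n : ℕ} (S : Finset (Fin n)) (f : Fin n → Fin n → ℤˣ) :
    ∏ a ∈ S, ∏ b ∈ Sᶜ, f a b =
      pairProd fun i j => (if i ∈ S ∧ j ∉ S then f i j else 1) *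
        if i ∉ S ∧ j ∈ S then f j i else 1 := by
  rw [← pairProd_mul]
  have h : (pairProd fun i j => if i ∉ S ∧ j ∈ S then f j i else 1) =
      ∏ i, ∏ j, if j < i then (if i ∈ S ∧ j ∉ S then f i j else 1) else 1 := by
    rw [pairProd, Finset.prod_comm]
    simp only [and_comm]
  rw [h, pairProd, ← Finset.prod_mul_distrib]
  simp only [← Finset.prod_mul_distrib]
  rw [prod_mem_eq_prod_univ]
  refine Finset.prod_congr rfl fun a _ => ?_
  by_cases ha : a ∈ S
  · rw [if_pos ha, prod_mem_eq_prod_univ]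
    refine Finset.prod_congr rfl fun b _ => ?_
    by_cases hb : b ∈ S
    · simp [hb]
    · have hab : a ≠ b := fun h => hb (h ▸ ha)
      rcases hab.lt_or_gt with h | h <;> simp [ha, hb, h, h.not_gt]
  · simp [ha]

lemma unshuffleSign_eq {n : ℕ} (d : Fin n → ℤ) (S : Finset (Fin n)) :
    unshuffleSign d S = pairProd fun i j => if i ∉ S ∧ j ∈ S then -(d j * d i).negOnePow else 1 := by
  rw [unshuffleSign, prod_prod_compl]
  refine pairProd_congr fun i j hij => ?_
  simp [hij, hij.not_gt]

/-- The sign rule behind the Jacobi identities in the tensor product with the forms, on elements of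
total degree one. -/
lemma sign_jacobi {n : ℕ} (q : Fin n → ℤ) (S : Finset (Fin n)) :
    (pairProd fun i j => if i ∈ S ∧ j ∈ S then (q i * (1 - q j)).negOnePow else 1) *
      ((∏ a ∈ S, ∏ b ∈ Sᶜ, (q a * (1 - q b)).negOnePow) *
      (pairProd fun i j => if i ∈ Sᶜ ∧ j ∈ Sᶜ then (q i * (1 - q j)).negOnePow else 1)) *
      (∏ a ∈ S, ∏ b ∈ Sᶜ, if b < a then (q a * q b).negOnePow else 1) =
    unshuffleSign (fun i => 1 - q i) S * pairProd fun i j => (q i * (1 - q j)).negOnePow := by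
  rw [unshuffleSign_eq, prod_prod_compl, prod_prod_compl]
  simp only [pairProd_mul]
  refine pairProd_congr fun i j hij => ?_
  by_cases hi : i ∈ S <;> by_cases hj : j ∈ S <;> simp [hi, hj, hij, hij.not_gt]
  -- Only the inverted pairs are left, `i ∉ S` and `j ∈ S`; there both exponents have the parity of
  -- `q j`.
  rw [← Int.negOnePow_add, ← Int.negOnePow_add, ← Int.negOnePow_succ, Int.negOnePow_eq_iff]
  exact ⟨q j - 1, by ring⟩

end Signs

/-! ### The brackets of the tensor product on elements of total degree one -/

namespace Forms

variable {K : Type v} [Field K] {n : ℕ}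

lemma dt_mul_eq (i : Fin (n + 1)) (b : Forms K n) : dt K i * b = parity b * dt K i := by
  induction b using Forms.induction with
  | hK r => simpa using (Algebra.commutes r _).symm
  | ht j => simp [t_mul_dt]
  | hdt j => simp [dt_mul_dt i j]
  | hadd a b ha hb => simp [mul_add, add_mul, ha, hb]
  | hmul a b ha hb => rw [← mul_assoc, ha, mul_assoc, hb, map_mul, mul_assoc]

lemma t_mul_eq (i : Fin (n + 1)) (b : Forms K n) : t K i * b = b * t K i := by
  induction b using Forms.induction with
  | hK r => exact (Algebra.commutes r _).symm
  | ht j => exact t_mul_t i j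
  | hdt j => exact t_mul_dt i j
  | hadd a b ha hb => simp [mul_add, add_mul, ha, hb]
  | hmul a b ha hb => rw [← mul_assoc, ha, mul_assoc, hb, mul_assoc]

/-- Forms commute up to the Koszul sign. -/
lemma mul_comm_of_mem {p q : ℕ} {a b : Forms K n} (ha : a ∈ homogeneous K n p)
    (hb : b ∈ homogeneous K n q) : a * b = (p * q : ℤ).negOnePow • (b * a) := by
  refine homogeneous_induction (P := fun p a => a * b = (p * q : ℤ).negOnePow • (b * a))
    ?_ ?_ ?_ ?_ ?_ ha
  · intro r; simpa using Algebra.commutes r b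
  · intro i; simpa using t_mul_eq i b
  · intro i; rw [dt_mul_eq, parity_of_mem hb, smul_mul_assoc]; simp
  · intro p a a' h h'; rw [add_mul, mul_add, h, h', smul_add]
  · intro p p' a a' h h'
    rw [mul_assoc, h', mul_smul_comm, ← mul_assoc, h, smul_mul_assoc, smul_smul, mul_assoc,
      ← Int.negOnePow_add]
    congr 2
    push_cast; ring

lemma list_prod_mem_homogeneous {k : ℕ} {q : Fin k → ℕ} {ω : Fin k → Forms K n}
    (h : ∀ i, ω i ∈ homogeneous K n (q i)) :
    (List.ofFn ω).prod ∈ homogeneous K n (∑ i, q i) := by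
  induction k with
  | zero => simpa using one_mem_homogeneous
  | succ k ih =>
    rw [List.ofFn_succ, List.prod_cons, Fin.sum_univ_succ]
    exact mul_mem_homogeneous (h 0) (ih fun i => h i.succ)

lemma list_map_prod_mul {ι : Type*} (l : List ι) {q : ι → ℕ} {ω : ι → Forms K n}
    (h : ∀ i, ω i ∈ homogeneous K n (q i)) {p : ℕ} {b : Forms K n}
    (hb : b ∈ homogeneous K n p) : (l.map ω).prod * b =
      (l.map fun a => ((q a : ℤ) * p).negOnePow).prod • (b * (l.map ω).prod) := by
  induction l with
  | nil => simp
  | cons a l ih =>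
    simp only [List.map_cons, List.prod_cons]
    rw [mul_assoc, ih, mul_smul_comm, ← mul_assoc, mul_comm_of_mem (h a) hb, smul_mul_assoc,
      smul_smul, mul_comm (List.prod _), mul_assoc]

/-- Induction on the increasing list. Its head precedes all other entries, so it creates a sign only
if it fails `s`: then it must move left across all the forms that satisfy `s`. -/
lemma list_filter_prod {ι : Type*} [LinearOrder ι] (l : List ι) (hl : l.Pairwise (· < ·))
    (s : ι → Prop) [DecidablePred s] {q : ι → ℕ} {ω : ι → Forms K n}
    (h : ∀ i, ω i ∈ homogeneous K n (q i)) :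
    ((l.filter fun a => s a).map ω).prod * ((l.filter fun a => ¬ s a).map ω).prod =
      (l.map fun a => (l.map fun b => if s a ∧ ¬ s b ∧ b < a then
        ((q a : ℤ) * q b).negOnePow else 1).prod).prod • (l.map ω).prod := by
  induction l with
  | nil => simp
  | cons c l ih =>
    rw [List.pairwise_cons] at hl
    have ih := ih hl.2
    simp only [List.map_cons, List.prod_cons, lt_self_iff_false, and_false, if_false, one_mul,
      List.prod_map_mul]
    have h1 : (l.map fun b => if s c ∧ ¬ s b ∧ b < c then
        ((q c : ℤ) * q b).negOnePow else 1).prod = 1 := by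
      refine List.prod_eq_one fun x hx => ?_
      obtain ⟨b, hb, rfl⟩ := List.mem_map.1 hx
      rw [if_neg fun hcon => (hl.1 b hb).not_gt hcon.2.2]
    rw [h1, one_mul]
    by_cases hc : s c
    · have h2 : (l.map fun a => if s a ∧ ¬ s c ∧ c < a then
          ((q a : ℤ) * q c).negOnePow else 1).prod = 1 := by
        refine List.prod_eq_one fun x hx => ?_
        obtain ⟨b, hb, rfl⟩ := List.mem_map.1 hx
        simp [hc]
      rw [h2, one_mul]
      simp only [List.filter_cons, hc, decide_true, if_true, not_true, decide_false,
        List.map_cons, List.prod_cons, Bool.false_eq_true, if_false]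
      rw [mul_assoc, ih, mul_smul_comm]
    · have h2 : (l.map fun a => if s a ∧ ¬ s c ∧ c < a then
          ((q a : ℤ) * q c).negOnePow else 1).prod =
          ((l.filter fun a => s a).map fun a => ((q a : ℤ) * q c).negOnePow).prod := by
        have h3 : ∀ l' : List ι, (∀ a ∈ l', c < a) → (l'.map fun a => if s a ∧ ¬ s c ∧ c < a then
            ((q a : ℤ) * q c).negOnePow else 1).prod =
            ((l'.filter fun a => s a).map fun a => ((q a : ℤ) * q c).negOnePow).prod := by
          intro l' hl'
          induction l' with
          | nil => simp
          | cons e l' ih' =>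
            rw [List.map_cons, List.prod_cons, ih' fun a ha => hl' a (List.mem_cons_of_mem _ ha)]
            by_cases he : s e <;> simp [he, hc, hl' e]
        exact h3 l hl.1
      rw [h2]
      simp only [List.filter_cons, hc, decide_true, if_true, not_false_eq_true, decide_false,
        List.map_cons, List.prod_cons, Bool.false_eq_true, if_false]
      rw [← mul_assoc, list_map_prod_mul _ h (h c), smul_mul_assoc, mul_assoc, ih,
        mul_smul_comm, smul_smul]

lemma ofFn_orderEmbOfFin {α : Type*} {k : ℕ} (S : Finset (Fin k)) (ω : Fin k → α) :
    List.ofFn (fun i => ω (S.orderEmbOfFin rfl i)) =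
      ((List.finRange k).filter fun a => a ∈ S).map ω := by
  have h : (List.finRange k).filter (fun a => a ∈ S) = S.sort := by
    refine List.Perm.eq_of_pairwise' (r := (· ≤ ·)) ?_ (S.pairwise_sort _) ?_
    · exact ((List.pairwise_lt_finRange k).imp fun h => h.le).filter _
    · refine (List.perm_ext_iff_of_nodup ((List.nodup_finRange k).filter _) (S.sort_nodup _)).2 ?_
      intro a; simp
  rw [h, ← S.listMap_orderEmbOfFin_finRange rfl, List.map_map, List.ofFn_eq_map]
  rfl

lemma prod_unshuffle {k : ℕ} (S : Finset (Fin k)) {q : Fin k → ℕ} {ω : Fin k → Forms K n}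
    (h : ∀ i, ω i ∈ homogeneous K n (q i)) :
    (List.ofFn fun i => ω (S.orderEmbOfFin rfl i)).prod *
        (List.ofFn fun i => ω (Sᶜ.orderEmbOfFin rfl i)).prod =
      (∏ a ∈ S, ∏ b ∈ Sᶜ, if b < a then ((q a : ℤ) * q b).negOnePow else 1) •
        (List.ofFn ω).prod := by
  rw [ofFn_orderEmbOfFin, ofFn_orderEmbOfFin]
  have := list_filter_prod (List.finRange k) (List.pairwise_lt_finRange k) (fun a => a ∈ S) h
  simp only [Finset.mem_compl]
  rw [this, List.ofFn_eq_map, ← Fin.prod_univ_def]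
  congr 1
  rw [prod_mem_eq_prod_univ S]
  refine Finset.prod_congr rfl fun a _ => ?_
  rw [← Fin.prod_univ_def, prod_mem_eq_prod_univ Sᶜ]
  by_cases ha : a ∈ S
  · rw [if_pos ha]
    refine Finset.prod_congr rfl fun b _ => ?_
    by_cases hb : b ∈ S <;> simp [ha, hb]
  · simp [ha]

end Forms

/-- A multilinear map that takes a spanning set into a submodule takes the span into it. -/
lemma MultilinearMap.mem_of_mem_span {K M U : Type*} [CommRing K] [AddCommGroup M] [Module K M]
    [AddCommGroup U] [Module K U] {k : ℕ} (F : MultilinearMap K (fun _ : Fin k => M) U)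
    {s : Set M} {P : Submodule K U} (h : ∀ z : Fin k → M, (∀ i, z i ∈ s) → F z ∈ P)
    (z : Fin k → M) (hz : ∀ i, z i ∈ Submodule.span K s) : F z ∈ P := by
  -- Induction on the set `T` of positions that hold arbitrary elements of the span while the others
  -- hold generators.
  have key : ∀ (T : Finset (Fin k)) (z : Fin k → M), (∀ i ∈ T, z i ∈ Submodule.span K s) →
      (∀ i ∉ T, z i ∈ s) → F z ∈ P := by
    intro T
    induction T using Finset.induction_on with
    | empty => exact fun z _ hz => h z fun i => hz i (by simp)
    | insert a T ha ih =>
      intro z hz hz'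
      have hQ : ∀ y ∈ Submodule.span K s, F (Function.update z a y) ∈ P := by
        intro y hy
        induction hy using Submodule.span_induction with
        | mem y hy =>
          apply ih
          · intro i hi
            rw [Function.update_of_ne (by rintro rfl; exact ha hi)]
            exact hz i (Finset.mem_insert_of_mem hi)
          · intro i hi
            by_cases hia : i = a
            · subst hia; simpa using hy
            · rw [Function.update_of_ne hia]
              exact hz' i (by simp [hia, hi])
        | zero => rw [F.map_update_zero]; exact zero_mem _
        | add y y' _ _ hy hy' => rw [F.map_update_add]; exact add_mem hy hy'
        | smul r y _ hy => rw [F.map_update_smul]; exact P.smul_mem r hy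
      have := hQ (z a) (hz a (by simp))
      rwa [Function.update_eq_self] at this
  exact key Finset.univ z (fun i _ => hz i) (by simp)

namespace LInfinityAlgebra

section Brackets

variable {K : Type v} {V W : Type u} [Field K] [AddCommGroup V] [Module K V]
  [AddCommGroup W] [Module K W] (g : LInfinityAlgebra K V) {n : ℕ}

lemma extendedBracket_of_mem (k : ℕ) (d : Fin k → ℤ) (q : Fin k → ℕ) (x : Fin k → V)
    (ω : Fin k → Forms K n) (hx : ∀ i, x i ∈ g.grading (d i))
    (hω : ∀ i, ω i ∈ Forms.homogeneous K n (q i)) :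
    g.extendedBracket n k (fun i => x i ⊗ₜ ω i) =
      (pairProd fun i j => ((q i : ℤ) * d j).negOnePow) • (g.bracket k x ⊗ₜ (List.ofFn ω).prod) := by
  rw [g.extendedBracket_tmul k d (fun i => (q i : ℤ)) x ω hx fun i => Forms.parity_of_mem (hω i),
    negOnePow_sum_pairs]

lemma smul_tmul_units (u : ℤˣ) (x : V) (ω : Forms K n) :
    (u • x) ⊗ₜ[K] ω = u • (x ⊗ₜ[K] ω) := by
  rcases Int.units_eq_one_or u with rfl | rfl <;> simp [Units.smul_def, TensorProduct.neg_tmul]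

lemma tmul_smul_units (u : ℤˣ) (x : V) (ω : Forms K n) :
    x ⊗ₜ[K] (u • ω) = u • (x ⊗ₜ[K] ω) := by
  rcases Int.units_eq_one_or u with rfl | rfl <;> simp [Units.smul_def, TensorProduct.tmul_neg]

lemma MultilinearMap.map_cons_units_smul {U M : Type*} [AddCommGroup U] [Module K U]
    [AddCommGroup M] [Module K M] {k : ℕ}
    (F : MultilinearMap K (fun _ : Fin (k + 1) => U) M) (u : ℤˣ) (y : U) (z : Fin k → U) :
    F (Fin.cons (u • y) z) = u • F (Fin.cons y z) := by
  have h : ∀ y, F (Fin.cons y z) = F.curryLeft y z := fun y => rfl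
  rw [h, h]
  rcases Int.units_eq_one_or u with rfl | rfl <;> simp [Units.smul_def]

/-- Three signs occur: one for the inner bracket, one for the outer bracket, one for restoring the
order of the forms. By `sign_jacobi` they combine to the unshuffle sign times a factor independent
of `S`, so the Jacobi identity of `g` passes to `g ⊗ Ω_n`. -/
lemma extendedBracket_nested {k : ℕ} (q : Fin k → ℕ) (x : Fin k → V)
    (ω : Fin k → Forms K n) (hx : ∀ i, x i ∈ g.grading (1 - q i))
    (hω : ∀ i, ω i ∈ Forms.homogeneous K n (q i)) (S : Finset (Fin k)) :
    g.extendedBracket n (Sᶜ.card + 1)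
        (Fin.cons (g.extendedBracket n S.card fun i =>
          x (S.orderEmbOfFin rfl i) ⊗ₜ ω (S.orderEmbOfFin rfl i))
          fun j => x (Sᶜ.orderEmbOfFin rfl j) ⊗ₜ ω (Sᶜ.orderEmbOfFin rfl j)) =
      (unshuffleSign (fun i => 1 - (q i : ℤ)) S *
        pairProd fun i j => ((q i : ℤ) * (1 - q j)).negOnePow) •
        (g.bracket (Sᶜ.card + 1) (Fin.cons (g.bracket S.card fun i => x (S.orderEmbOfFin rfl i))
          fun j => x (Sᶜ.orderEmbOfFin rfl j)) ⊗ₜ (List.ofFn ω).prod) := by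
  rw [g.extendedBracket_of_mem S.card _ _ _ _ (fun i => hx (S.orderEmbOfFin rfl i))
    (fun i => hω (S.orderEmbOfFin rfl i)), MultilinearMap.map_cons_units_smul]
  have hcons : (Fin.cons ((g.bracket S.card fun i => x (S.orderEmbOfFin rfl i)) ⊗ₜ[K]
      (List.ofFn fun i => ω (S.orderEmbOfFin rfl i)).prod)
        (fun j => x (Sᶜ.orderEmbOfFin rfl j) ⊗ₜ[K] ω (Sᶜ.orderEmbOfFin rfl j)) :
        Fin (Sᶜ.card + 1) → V ⊗[K] Forms K n) =
      fun i => (Fin.cons (g.bracket S.card fun i => x (S.orderEmbOfFin rfl i))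
          (fun j => x (Sᶜ.orderEmbOfFin rfl j)) : Fin (Sᶜ.card + 1) → V) i ⊗ₜ
        (Fin.cons (List.ofFn fun i => ω (S.orderEmbOfFin rfl i)).prod
          (fun j => ω (Sᶜ.orderEmbOfFin rfl j)) : Fin (Sᶜ.card + 1) → Forms K n) i := by
    funext i
    refine Fin.cases ?_ (fun i => ?_) i <;> simp
  rw [hcons, g.extendedBracket_of_mem (Sᶜ.card + 1)
    (Fin.cons (∑ i, (1 - (q (S.orderEmbOfFin rfl i) : ℤ)) + 2 - S.card)
      fun j => 1 - (q (Sᶜ.orderEmbOfFin rfl j) : ℤ))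
    (Fin.cons (∑ i, q (S.orderEmbOfFin rfl i)) fun j => q (Sᶜ.orderEmbOfFin rfl j))]
  · rw [List.ofFn_cons, List.prod_cons, Forms.prod_unshuffle S hω, tmul_smul_units, smul_smul,
      smul_smul, ← sign_jacobi, pairProd_succ]
    congr 3
    · exact pairProd_orderEmbOfFin S fun a b => ((q a : ℤ) * (1 - q b)).negOnePow
    -- As first entry, the inner bracket contributes only its form degree to the outer sign; its
    -- degree in `V` never appears.
    · simp only [Fin.cons_zero, Fin.cons_succ]
      congr 1
      · rw [Finset.prod_comm, prod_mem_eq_prod_univ Sᶜ]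
        refine (prod_orderEmbOfFin Sᶜ fun b => ((↑(∑ i, q (S.orderEmbOfFin rfl i)) : ℤ) *
          (1 - q b)).negOnePow).trans ?_
        refine Finset.prod_congr rfl fun b _ => ?_
        rw [Nat.cast_sum, Finset.sum_mul, negOnePow_sum,
          prod_orderEmbOfFin S fun a => ((q a : ℤ) * (1 - q b)).negOnePow, ← prod_mem_eq_prod_univ]
      · exact pairProd_orderEmbOfFin Sᶜ fun a b => ((q a : ℤ) * (1 - q b)).negOnePow
  · intro i
    refine Fin.cases ?_ (fun i => ?_) i
    · exact g.bracket_mem _ _ _ fun i => hx _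
    · exact hx _
  · intro i
    refine Fin.cases ?_ (fun i => ?_) i
    · exact Forms.list_prod_mem_homogeneous fun i => hω _
    · exact hω _

lemma extendedBracket_jacobi_tmul {k : ℕ} (q : Fin k → ℕ) (x : Fin k → V)
    (ω : Fin k → Forms K n) (hx : ∀ i, x i ∈ g.grading (1 - q i))
    (hω : ∀ i, ω i ∈ Forms.homogeneous K n (q i)) :
    ∑ S : Finset (Fin k), ((-1 : ℤˣ) ^ S.card) • g.extendedBracket n (Sᶜ.card + 1)
        (Fin.cons (g.extendedBracket n S.card fun i =>
          x (S.orderEmbOfFin rfl i) ⊗ₜ ω (S.orderEmbOfFin rfl i))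
          fun j => x (Sᶜ.orderEmbOfFin rfl j) ⊗ₜ ω (Sᶜ.orderEmbOfFin rfl j)) = 0 := by
  have h := g.jacobi k (fun i => 1 - (q i : ℤ)) x hx
  have h2 := congrArg (fun y => (pairProd fun i j => ((q i : ℤ) * (1 - q j)).negOnePow) •
    (y ⊗ₜ[K] (List.ofFn ω).prod)) h
  simp only [TensorProduct.zero_tmul, smul_zero, TensorProduct.sum_tmul, Finset.smul_sum] at h2
  rw [← h2]
  refine Finset.sum_congr rfl fun S _ => ?_
  rw [g.extendedBracket_nested q x ω hx hω, smul_tmul_units, smul_smul, smul_smul]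
  congr 1
  rw [← mul_assoc, mul_comm]

lemma neg_one_pow_units_smul {M : Type*} [AddCommGroup M] [Module K M] (m : ℕ) (y : M) :
    ((-1 : ℤˣ) ^ m) • y = ((-1 : K) ^ m) • y := by
  rw [Units.smul_def, ← Int.cast_smul_eq_zsmul K]
  push_cast
  rfl

/-- The nested bracket that belongs to a subset of the set of entries. -/
def nestedBracket (n : ℕ) {k : ℕ} (S : Finset (Fin k)) :
    MultilinearMap K (fun _ : Fin k => V ⊗[K] Forms K n) (V ⊗[K] Forms K n) :=
  (MultilinearMap.curryFinFinset K (V ⊗[K] Forms K n) (V ⊗[K] Forms K n) (s := S) rfl rfl).symm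
    ((g.extendedBracket n (Sᶜ.card + 1)).curryLeft.compMultilinearMap
      (g.extendedBracket n S.card))

lemma nestedBracket_apply {k : ℕ} (S : Finset (Fin k)) (z : Fin k → V ⊗[K] Forms K n) :
    g.nestedBracket n S z = g.extendedBracket n (Sᶜ.card + 1)
        (Fin.cons (g.extendedBracket n S.card fun i => z (S.orderEmbOfFin rfl i))
          fun j => z (Sᶜ.orderEmbOfFin rfl j)) := by
  simp [nestedBracket]

/-- The Jacobi identity for elements of degree one. -/
lemma extendedBracket_jacobi {k : ℕ} (z : Fin k → V ⊗[K] Forms K n)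
    (hz : ∀ i, z i ∈ g.formsGrading n 1) :
    ∑ S : Finset (Fin k), ((-1 : ℤˣ) ^ S.card) • g.extendedBracket n (Sᶜ.card + 1)
        (Fin.cons (g.extendedBracket n S.card fun i => z (S.orderEmbOfFin rfl i))
          fun j => z (Sᶜ.orderEmbOfFin rfl j)) = 0 := by
  have h := MultilinearMap.mem_of_mem_span
    (∑ S : Finset (Fin k), ((-1 : K) ^ S.card) • g.nestedBracket n S) (P := ⊥)
    (fun z hz => ?_) z hz
  · rw [Submodule.mem_bot] at h
    rw [← h]
    simp only [neg_one_pow_units_smul (K := K), sum_apply, smul_apply,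
      nestedBracket_apply]
  · choose q x ω hx hω hzz using hz
    obtain rfl : z = fun i => x i ⊗ₜ ω i := funext hzz
    rw [Submodule.mem_bot, ← g.extendedBracket_jacobi_tmul q x ω hx hω]
    simp only [neg_one_pow_units_smul (K := K), sum_apply, smul_apply,
      nestedBracket_apply]

/-- `y ↦ [y, μ, …, μ]`. -/
def bracketCons (μ : V ⊗[K] Forms K n) (l : ℕ) : V ⊗[K] Forms K n →ₗ[K] V ⊗[K] Forms K n where
  toFun y := g.extendedBracket n (l + 1) (Fin.cons y fun _ => μ)
  map_add' y y' := by
    exact DFunLike.congr_fun ((g.extendedBracket n (l + 1)).curryLeft.map_add y y') fun _ => μ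
  map_smul' r y := by
    exact DFunLike.congr_fun ((g.extendedBracket n (l + 1)).curryLeft.map_smul r y) fun _ => μ

/-- With all entries equal, a subset matters only through its cardinality `m`. Dividing by `k!`
turns the binomial coefficient into `1 / (m! (k - m)!)`. -/
lemma jacobi_diag [CharZero K] {μ : V ⊗[K] Forms K n} (hμ : μ ∈ g.formsGrading n 1) (k : ℕ) :
    ∑ p ∈ Finset.HasAntidiagonal.antidiagonal k,
      ((-1 : K) ^ p.1 * (p.1.factorial : K)⁻¹ * (p.2.factorial : K)⁻¹) •
      g.bracketCons μ p.2 (g.extendedBracket n p.1 fun _ => μ) = 0 := by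
  have h := g.extendedBracket_jacobi (k := k) (fun _ => μ) fun _ => hμ
  have h2 := Finset.sum_powerset_apply_card (fun m => ((-1 : ℤˣ) ^ m) •
    g.bracketCons μ (k - m) (g.extendedBracket n m fun _ => μ))
    (x := (Finset.univ : Finset (Fin k)))
  rw [Finset.powerset_univ, Finset.card_univ, Fintype.card_fin] at h2
  have h1 : ∀ S : Finset (Fin k), ((-1 : ℤˣ) ^ S.card) • g.extendedBracket n (Sᶜ.card + 1)
      (Fin.cons (g.extendedBracket n S.card fun _ => μ) fun _ => μ) =
      ((-1 : ℤˣ) ^ S.card) • g.bracketCons μ (k - S.card)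
        (g.extendedBracket n S.card fun _ => μ) := fun S =>
    congrArg (fun l => ((-1 : ℤˣ) ^ S.card) •
      g.bracketCons μ l (g.extendedBracket n S.card fun _ => μ))
      (show Sᶜ.card = k - S.card by rw [Finset.card_compl, Fintype.card_fin])
  simp only [h1] at h
  rw [h2] at h
  rw [Finset.Nat.sum_antidiagonal_eq_sum_range_succ_mk]
  have h3 := congrArg (fun y => ((k.factorial : K)⁻¹) • y) h
  simp only [smul_zero, Finset.smul_sum] at h3
  rw [← h3]
  refine Finset.sum_congr rfl fun m hm => ?_
  have hm' : m ≤ k := by simpa [Nat.lt_succ_iff] using hm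
  rw [neg_one_pow_units_smul (K := K), ← Nat.cast_smul_eq_nsmul K, smul_smul, smul_smul]
  congr 1
  have f1 : (k.factorial : K) ≠ 0 := by exact_mod_cast k.factorial_ne_zero
  have f2 : (m.factorial : K) ≠ 0 := by exact_mod_cast m.factorial_ne_zero
  have f3 : ((k - m).factorial : K) ≠ 0 := by exact_mod_cast (k - m).factorial_ne_zero
  have hc : (k.choose m : K) * m.factorial * (k - m).factorial = k.factorial := by
    exact_mod_cast Nat.choose_mul_factorial_mul_factorial hm'
  rw [← hc]
  have hc0 : (k.choose m : K) ≠ 0 := by exact_mod_cast (Nat.choose_pos hm').ne'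
  field_simp

end Brackets

end LInfinityAlgebra

/-! ### The de Rham differential as a derivation of the brackets -/

section Signs

/-- Separates the pairs that contain `i` from the others, so that moving one entry to the front
changes only the first factor. -/
lemma pairProd_succAbove {k : ℕ} (i : Fin (k + 1)) (f : Fin (k + 1) → Fin (k + 1) → ℤˣ) :
    pairProd f = (∏ j : Fin k, if i.succAbove j < i then f (i.succAbove j) i
      else f i (i.succAbove j)) * pairProd fun a b => f (i.succAbove a) (i.succAbove b) := by
  unfold pairProd
  rw [Fin.prod_univ_succAbove _ i]
  simp only [Fin.prod_univ_succAbove _ i, lt_self_iff_false, if_false, one_mul]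
  rw [Finset.prod_mul_distrib, ← mul_assoc, ← Finset.prod_mul_distrib]
  congr 1
  · refine Finset.prod_congr rfl fun j _ => ?_
    rcases (i.succAbove_ne j).lt_or_gt with h | h <;> simp [h, h.not_gt]
  · simp [Fin.succAbove_lt_succAbove_iff]

/-- The sign rule for the compatibility of the de Rham differential with the brackets, on elements
of total degree one. -/
lemma sign_leibniz {k : ℕ} (q : Fin (k + 1) → ℤ) (i : Fin (k + 1)) :
    (pairProd fun a b => (q a * (1 - q b)).negOnePow) *
      ((∑ j, (1 - q j) + 2 - ((k + 1 : ℕ) : ℤ)).negOnePow *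
        ∏ j, if j < i then (q i * q j).negOnePow else 1) =
    (-1) ^ (k + 1) * ((1 - q i).negOnePow *
      (((∏ j : Fin k, ((q i + 1) * (1 - q (i.succAbove j))).negOnePow) *
          pairProd fun a b => (q (i.succAbove a) * (1 - q (i.succAbove b))).negOnePow) *
        ∏ j, if j < i then -((1 - q i) * (1 - q j)).negOnePow else 1)) := by
  -- This is the sign of applying the differential to a bracket with value in the indicated degree;
  -- the arity contributes `(-1)^(k+1)`.
  have h1 : (∑ j, (1 - q j) + 2 - ((k + 1 : ℕ) : ℤ)).negOnePow =
      (-1) ^ (k + 1) * ((1 - q i).negOnePow * ∏ j : Fin k, (1 - q (i.succAbove j)).negOnePow) := by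
    rw [add_sub_assoc, Int.negOnePow_add, Fin.sum_univ_succAbove _ i, Int.negOnePow_add,
      negOnePow_sum, mul_comm]
    congr 1
    rw [Int.negOnePow_sub, Int.negOnePow_even 2 even_two, one_mul, Int.negOnePow_def, zpow_natCast]
  rw [h1, pairProd_succAbove i, Fin.prod_univ_succAbove _ i, Fin.prod_univ_succAbove _ i]
  simp only [lt_self_iff_false, if_false, one_mul]
  have h2 : (∏ j : Fin k, if i.succAbove j < i then (q (i.succAbove j) * (1 - q i)).negOnePow
        else (q i * (1 - q (i.succAbove j))).negOnePow) *
      ((∏ j : Fin k, (1 - q (i.succAbove j)).negOnePow) *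
        ∏ j : Fin k, if i.succAbove j < i then (q i * q (i.succAbove j)).negOnePow else 1) =
      (∏ j : Fin k, ((q i + 1) * (1 - q (i.succAbove j))).negOnePow) *
        ∏ j : Fin k, if i.succAbove j < i then
          -((1 - q i) * (1 - q (i.succAbove j))).negOnePow else 1 := by
    simp only [← Finset.prod_mul_distrib]
    refine Finset.prod_congr rfl fun j _ => ?_
    split_ifs
    · rw [← Int.negOnePow_add, ← Int.negOnePow_add, mul_neg, ← Int.negOnePow_add,
        ← Int.negOnePow_succ, Int.negOnePow_eq_iff]
      exact ⟨q (i.succAbove j) - 1 , by ring⟩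
    · rw [mul_one, mul_one, ← Int.negOnePow_add]
      congr 1
      ring
  have h3 : ∀ A P s c D E G H : ℤˣ, A * (D * E) = G * H →
      A * P * (s * (c * D) * E) = s * (c * (G * P * H)) := by
    intro A P s c D E G H h
    calc A * P * (s * (c * D) * E) = s * (c * (P * (A * (D * E)))) := by ac_rfl
      _ = s * (c * (P * (G * H))) := by rw [h]
      _ = _ := by ac_rfl
  exact h3 _ _ _ _ _ _ _ _ h2

end Signs

namespace Forms

variable {K : Type v} [Field K] {n : ℕ}

/-- The Leibniz rule with each `d ω_i` moved to the front. Passing `d` across `ω_j` contributes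
`q_j` and moving `d ω_i` back contributes `(q_i + 1) q_j`, so the exponent is `q_i q_j` modulo two.
-/
lemma d_list_prod {k : ℕ} {q : Fin (k + 1) → ℕ} {ω : Fin (k + 1) → Forms K n}
    (h : ∀ i, ω i ∈ homogeneous K n (q i)) :
    d (List.ofFn ω).prod = ∑ i, (∏ j, if j < i then ((q i : ℤ) * q j).negOnePow else 1) •
      (d (ω i) * (List.ofFn fun j => ω (i.succAbove j)).prod) := by
  induction k with
  | zero => simp
  | succ k ih =>
    conv_rhs => rw [Fin.sum_univ_succ]
    rw [List.ofFn_succ (f := ω), List.prod_cons, d_mul, ih fun i => h i.succ, parity_of_mem (h 0)]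
    congr 1
    · simp
    · rw [Finset.mul_sum]
      refine Finset.sum_congr rfl fun i _ => ?_
      have hp : (∏ j, if j < i.succ then ((q i.succ : ℤ) * q j).negOnePow else 1) =
          ((q i.succ : ℤ) * q 0).negOnePow *
            ∏ j : Fin (k + 1), if j < i then ((q i.succ : ℤ) * q j.succ).negOnePow else 1 := by
        rw [Fin.prod_univ_succ]
        simp only [Fin.succ_pos, if_true, Fin.succ_lt_succ_iff]
      rw [hp, List.ofFn_succ, List.prod_cons]
      simp only [Fin.succ_succAbove_zero, Fin.succ_succAbove_succ]
      rw [mul_smul_comm, smul_mul_assoc, ← mul_assoc,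
        mul_comm_of_mem (h 0) (d_mem_homogeneous (h i.succ)), smul_mul_assoc, smul_smul, smul_smul,
        mul_assoc (d _)]
      have hs : ((q i.succ : ℤ) * q 0).negOnePow =
          (q 0 : ℤ).negOnePow * ((q 0 : ℤ) * (q i.succ + 1 : ℕ)).negOnePow := by
        rw [← Int.negOnePow_add, Int.negOnePow_eq_iff]
        exact ⟨-q 0, by push_cast; ring⟩
      rw [hs]
      congr 1
      ac_rfl

end Forms

namespace LInfinityAlgebra

section Brackets

variable {K : Type v} {V W : Type u} [Field K] [AddCommGroup V] [Module K V]
  [AddCommGroup W] [Module K W] (g : LInfinityAlgebra K V) {n : ℕ}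

lemma parityProj_sub_of_mem {d : ℤ} {x : V} (hx : x ∈ g.grading d) :
    (g.parityProj 0 - g.parityProj 1) x = d.negOnePow • x := by
  rw [LinearMap.sub_apply, g.parityProj_of_mem 0 hx, g.parityProj_of_mem 1 hx]
  rcases Int.even_or_odd d with h | h
  · have : (d : ZMod 2) = 0 := (ZMod.intCast_eq_zero_iff_even).2 h
    simp [this, Int.negOnePow_even d h]
  · have : (d : ZMod 2) = 1 := (ZMod.intCast_eq_one_iff_odd).2 h
    simp [this, Int.negOnePow_odd d h, Units.smul_def]

lemma formsD_tmul {d : ℤ} {x : V} (hx : x ∈ g.grading d) (ω : Forms K n) :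
    g.formsD n (x ⊗ₜ ω) = d.negOnePow • (x ⊗ₜ Forms.d ω) := by
  rw [formsD, TensorProduct.map_tmul, parityProj_sub_of_mem g hx, smul_tmul_units]

lemma formsD_formsD (z : V ⊗[K] Forms K n) : g.formsD n (g.formsD n z) = 0 := by
  have h : g.formsD n ∘ₗ g.formsD n = 0 := by
    rw [formsD, ← TensorProduct.map_comp]
    have : (Forms.d (K := K) (n := n)) ∘ₗ Forms.d = 0 := LinearMap.ext Forms.d_d
    rw [this, TensorProduct.map_zero_right]
  exact LinearMap.congr_fun h z

/-- The cycle that brings `i` to the front inverts exactly the pairs formed by `i` and a smaller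
index. -/
lemma bracket_cons_succAbove {k : ℕ} (d : Fin (k + 1) → ℤ) (x : Fin (k + 1) → V)
    (hx : ∀ i, x i ∈ g.grading (d i)) (i : Fin (k + 1)) :
    g.bracket (k + 1) (Fin.cons (x i) fun j => x (i.succAbove j)) =
      (∏ j, if j < i then -(d i * d j).negOnePow else 1) • g.bracket (k + 1) x := by
  have h := g.bracket_perm (k + 1) d x hx i.cycleRange.symm
  have h1 : (fun j => x (i.cycleRange.symm j)) = Fin.cons (x i) fun j => x (i.succAbove j) := by
    funext j
    refine Fin.cases ?_ (fun j => ?_) j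
    · rw [Fin.cycleRange_symm_zero, Fin.cons_zero]
    · rw [Fin.cycleRange_symm_succ, Fin.cons_succ]
  rw [← h1, h]
  congr 1
  rw [wedgeSign, Fin.prod_univ_succ]
  simp only [Fin.prod_univ_succ, Fin.cycleRange_symm_zero, Fin.cycleRange_symm_succ,
    lt_self_iff_false, false_and, and_false, if_false, one_mul, Fin.succ_pos, true_and,
    Fin.not_lt_zero, Fin.succ_lt_succ_iff, Fin.succAbove_lt_succAbove_iff]
  have h2 : ∀ a b : Fin k, ¬ (a < b ∧ b < a) := fun a b h => h.1.asymm h.2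
  simp only [h2, if_false, Finset.prod_const_one, mul_one]
  rw [← Fin.prod_univ_succ (fun j => if j < i then -(d i * d j).negOnePow else 1),
    Fin.prod_univ_succAbove _ i]
  simp

/-- `(z_1, …, z_k) ↦ [D z_i, z_1, …, z_k]`, with `z_i` omitted. -/
def bracketD (n : ℕ) {k : ℕ} (i : Fin (k + 1)) :
    MultilinearMap K (fun _ : Fin (k + 1) => V ⊗[K] Forms K n) (V ⊗[K] Forms K n) :=
  ((g.extendedBracket n (k + 1)).curryLeft ∘ₗ g.formsD n).uncurryLeft.domDomCongr
    i.cycleRange.symm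

lemma bracketD_apply {k : ℕ} (i : Fin (k + 1)) (z : Fin (k + 1) → V ⊗[K] Forms K n) :
    g.bracketD n i z =
      g.extendedBracket n (k + 1) (Fin.cons (g.formsD n (z i)) fun j => z (i.succAbove j)) := by
  have h : g.bracketD n i z = g.extendedBracket n (k + 1)
      (Fin.cons (g.formsD n (z (i.cycleRange.symm 0))) fun j => z (i.cycleRange.symm j.succ)) := rfl
  rw [h]
  simp only [Fin.cycleRange_symm_zero, Fin.cycleRange_symm_succ]

lemma formsD_extendedBracket_tmul {k : ℕ} (q : Fin (k + 1) → ℕ) (x : Fin (k + 1) → V)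
    (ω : Fin (k + 1) → Forms K n) (hx : ∀ i, x i ∈ g.grading (1 - q i))
    (hω : ∀ i, ω i ∈ Forms.homogeneous K n (q i)) :
    g.formsD n (g.extendedBracket n (k + 1) fun i => x i ⊗ₜ ω i) =
      ((-1 : ℤˣ) ^ (k + 1)) • ∑ i, g.extendedBracket n (k + 1)
        (Fin.cons (g.formsD n (x i ⊗ₜ ω i)) fun j => x (i.succAbove j) ⊗ₜ ω (i.succAbove j)) := by
  rw [g.extendedBracket_of_mem _ _ _ _ _ hx hω, Units.smul_def, map_zsmul, ← Units.smul_def,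
    g.formsD_tmul (g.bracket_mem (k + 1) _ x hx), Forms.d_list_prod hω, TensorProduct.tmul_sum,
    Finset.smul_sum, Finset.smul_sum, Finset.smul_sum]
  refine Finset.sum_congr rfl fun i _ => ?_
  rw [g.formsD_tmul (hx i), MultilinearMap.map_cons_units_smul]
  have hcons : (Fin.cons (x i ⊗ₜ[K] Forms.d (ω i))
        (fun j => x (i.succAbove j) ⊗ₜ[K] ω (i.succAbove j)) : Fin (k + 1) → V ⊗[K] Forms K n) =
      fun j => (Fin.cons (x i) (fun j => x (i.succAbove j)) : Fin (k + 1) → V) j ⊗ₜ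
        (Fin.cons (Forms.d (ω i)) (fun j => ω (i.succAbove j)) : Fin (k + 1) → Forms K n) j := by
    funext j
    refine Fin.cases ?_ (fun j => ?_) j <;> simp
  rw [hcons, g.extendedBracket_of_mem (k + 1)
    (Fin.cons (1 - (q i : ℤ)) fun j => 1 - (q (i.succAbove j) : ℤ))
    (Fin.cons (q i + 1) fun j => q (i.succAbove j)), g.bracket_cons_succAbove _ x hx i,
    List.ofFn_cons, List.prod_cons, tmul_smul_units, smul_tmul_units, smul_smul, smul_smul,
    smul_smul, smul_smul, smul_smul]
  · congr 1
    have := sign_leibniz (fun i => (q i : ℤ)) i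
    rw [mul_assoc, this, pairProd_succ]
    simp only [Fin.cons_zero, Fin.cons_succ, Nat.cast_add, Nat.cast_one, mul_assoc]
  · intro j
    refine Fin.cases ?_ (fun j => ?_) j
    · exact hx i
    · exact hx _
  · intro j
    refine Fin.cases ?_ (fun j => ?_) j
    · exact Forms.d_mem_homogeneous (hω i)
    · exact hω _

/-- For entries of total degree one, the sign of moving the differential past earlier entries
cancels that of moving `D z_i` to the front. What remains is the parity of the degree `2 - (k + 1)`
of the bracket. -/
lemma formsD_extendedBracket {k : ℕ} (z : Fin (k + 1) → V ⊗[K] Forms K n)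
    (hz : ∀ i, z i ∈ g.formsGrading n 1) :
    g.formsD n (g.extendedBracket n (k + 1) z) =
      ((-1 : K) ^ (k + 1)) • ∑ i, g.extendedBracket n (k + 1)
        (Fin.cons (g.formsD n (z i)) fun j => z (i.succAbove j)) := by
  have h := MultilinearMap.mem_of_mem_span
    ((g.formsD n).compMultilinearMap (g.extendedBracket n (k + 1)) -
      ((-1 : K) ^ (k + 1)) • ∑ i, g.bracketD n i) (P := ⊥) (fun z hz => ?_) z hz
  · rw [Submodule.mem_bot, sub_apply, sub_eq_zero] at h
    simpa only [LinearMap.compMultilinearMap_apply, smul_apply, sum_apply, bracketD_apply] using h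
  · choose q x ω hx hω hzz using hz
    obtain rfl : z = fun i => x i ⊗ₜ ω i := funext hzz
    rw [Submodule.mem_bot, sub_apply, sub_eq_zero]
    simp only [LinearMap.compMultilinearMap_apply, smul_apply, sum_apply, bracketD_apply]
    rw [g.formsD_extendedBracket_tmul q x ω hx hω, neg_one_pow_units_smul (K := K)]

lemma formsD_extendedBracket_diag {μ : V ⊗[K] Forms K n} (hμ : μ ∈ g.formsGrading n 1) (k : ℕ) :
    g.formsD n (g.extendedBracket n (k + 1) fun _ => μ) =
      ((-1 : K) ^ (k + 1) * (k + 1)) • g.bracketCons μ k (g.formsD n μ) := by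
  rw [g.formsD_extendedBracket _ fun _ => hμ, Finset.sum_const, Finset.card_univ,
    Fintype.card_fin, ← Nat.cast_smul_eq_nsmul K, smul_smul]
  push_cast
  rfl

end Brackets

end LInfinityAlgebra

/-! ### Curvature and the Bianchi identity -/

namespace LInfinityAlgebra

section Curvature

variable {K : Type v} {V W : Type u} [Field K] [AddCommGroup V] [Module K V]
  [AddCommGroup W] [Module K W] (g : LInfinityAlgebra K V) {n : ℕ}

lemma extendedBracket_eq_zero {k : ℕ} (h : g.bracket k = 0) : g.extendedBracket n k = 0 := by
  simp only [extendedBracket, h, map_zero]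
  exact Finset.sum_eq_zero fun p _ => rfl

lemma extendedBracket_mem {k : ℕ} (z : Fin k → V ⊗[K] Forms K n)
    (hz : ∀ i, z i ∈ g.formsGrading n 1) : g.extendedBracket n k z ∈ g.formsGrading n 2 := by
  refine MultilinearMap.mem_of_mem_span _ (fun z hz => ?_) z hz
  choose q x ω hx hω hzz using hz
  obtain rfl : z = fun i => x i ⊗ₜ ω i := funext hzz
  rw [g.extendedBracket_of_mem _ _ _ _ _ hx hω, units_smul_mem_iff]
  refine Submodule.subset_span ⟨∑ i, q i, _, _, ?_, Forms.list_prod_mem_homogeneous hω, rfl⟩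
  have h := g.bracket_mem k _ x hx
  have hd : ∑ i, (1 - (q i : ℤ)) + 2 - k = 2 - ((∑ i, q i : ℕ) : ℤ) := by
    rw [Finset.sum_sub_distrib]
    push_cast
    simp
    ring
  rwa [hd] at h

lemma formsD_mem {m : ℤ} {z : V ⊗[K] Forms K n} (hz : z ∈ g.formsGrading n m) :
    g.formsD n z ∈ g.formsGrading n (m + 1) := by
  induction hz using Submodule.span_induction with
  | mem z hz =>
    obtain ⟨p, x, ω, hx, hω, rfl⟩ := hz
    rw [g.formsD_tmul hx, units_smul_mem_iff]
    refine Submodule.subset_span ⟨p + 1, x, _, ?_, Forms.d_mem_homogeneous hω, rfl⟩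
    have : m + 1 - ((p + 1 : ℕ) : ℤ) = m - p := by push_cast; ring
    rwa [this]
  | zero => rw [map_zero]; exact zero_mem _
  | add x y _ _ hx hy => rw [map_add]; exact add_mem hx hy
  | smul r x _ hx => rw [map_smul]; exact Submodule.smul_mem _ _ hx

lemma formsBracket_diag (k : ℕ) (μ : V ⊗[K] Forms K n) :
    g.formsBracket n k (fun _ => μ) =
      g.extendedBracket n k (fun _ => μ) + if k = 1 then g.formsD n μ else 0 := by
  rcases k with _ | _ | k
  · simp [formsBracket]
  · simp [formsBracket]
  · simp [formsBracket]

/-- Replaces the formally infinite sum by a finite one and separates `1 ⊗ d` from the brackets. The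
bound `2 ≤ M` ensures that arity one is included. -/
lemma curvature_eq {M : ℕ} (hM : ∀ k, M ≤ k → g.bracket k = 0) (hM2 : 2 ≤ M)
    (μ : V ⊗[K] Forms K n) :
    g.curvature n μ = ∑ k ∈ Finset.range M, ((k.factorial : K)⁻¹) •
      g.extendedBracket n k (fun _ => μ) + g.formsD n μ := by
  rw [curvature, finsum_eq_sum_of_support_subset (s := Finset.range M)]
  · simp only [formsBracket_diag, smul_add, Finset.sum_add_distrib]
    congr 1
    rw [Finset.sum_eq_single 1]
    · simp
    · intro k _ hk; simp [hk]
    · intro h; simp at h; omega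
  · intro k hk
    by_contra hkM
    simp only [Finset.coe_range, Set.mem_Iio, not_lt] at hkM
    apply hk
    beta_reduce
    rw [formsBracket_diag, g.extendedBracket_eq_zero (hM k hkM), if_neg (by omega)]
    simp

lemma curvature_mem (hg : g.IsNilpotent) {μ : V ⊗[K] Forms K n} (hμ : μ ∈ g.formsGrading n 1) :
    g.curvature n μ ∈ g.formsGrading n 2 := by
  obtain ⟨N, hN⟩ := hg.bracket_eq_zero
  rw [g.curvature_eq (M := N + 2) (fun k hk => hN k (by omega)) (by omega)]
  have h := g.formsD_mem hμ
  rw [one_add_one_eq_two] at h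
  exact add_mem (Submodule.sum_mem _ fun k _ => Submodule.smul_mem _ _
    (g.extendedBracket_mem _ fun _ => hμ)) h

lemma bracketCons_eq_zero {l : ℕ} (h : g.bracket (l + 1) = 0) (μ : V ⊗[K] Forms K n) :
    g.bracketCons μ l = 0 := by
  refine LinearMap.ext fun y => ?_
  change g.extendedBracket n (l + 1) _ = 0
  rw [g.extendedBracket_eq_zero h]
  rfl

/-- The Bianchi identity. -/
lemma bianchi [CharZero K] (hg : g.IsNilpotent) {μ : V ⊗[K] Forms K n}
    (hμ : μ ∈ g.formsGrading n 1) :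
    ∃ M, ∑ l ∈ Finset.range (M + 1), ((-1 : K) ^ l * (l.factorial : K)⁻¹) •
      g.bracketCons μ l (g.curvature n μ) + g.formsD n (g.curvature n μ) = 0 := by
  obtain ⟨N, hN⟩ := hg.bracket_eq_zero
  set M := N + 1 with hM
  have hM' : ∀ k, M + 1 ≤ k → g.bracket k = 0 := fun k hk => hN k (by omega)
  set E : ℕ → V ⊗[K] Forms K n := fun k => g.extendedBracket n k (fun _ => μ) with hE
  have hE0 : ∀ k, M + 1 ≤ k → E k = 0 := fun k hk => by
    simp only [hE, g.extendedBracket_eq_zero (hM' k hk)]; rfl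
  have hC0 : ∀ l, M ≤ l → g.bracketCons μ l = 0 := fun l hl =>
    g.bracketCons_eq_zero (hM' _ (by omega)) μ
  refine ⟨M, ?_⟩
  -- The bracket part of the curvature, inserted into brackets with `μ`, vanishes by the Jacobi
  -- identity: the terms are grouped by `m = l + k`, at most `2 * M`.
  have h1 : ∑ l ∈ Finset.range (M + 1), ((-1 : K) ^ l * (l.factorial : K)⁻¹) •
      g.bracketCons μ l (∑ k ∈ Finset.range (M + 1), ((k.factorial : K)⁻¹) • E k) = 0 := by
    simp only [map_sum, map_smul, Finset.smul_sum, smul_smul]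
    rw [← Finset.sum_product', ← Finset.sum_fiberwise_of_maps_to
      (t := Finset.range (2 * M + 1)) (g := fun p : ℕ × ℕ => p.1 + p.2)
      (fun p hp => by simp only [Finset.mem_product, Finset.mem_range] at hp ⊢; omega)]
    refine Finset.sum_eq_zero fun m _ => ?_
    -- The factor `(-1)^m` trades the sign of the inner arity for that of `l`.
    have hj := congrArg (fun y => ((-1 : K) ^ m) • y) (g.jacobi_diag hμ m)
    simp only [smul_zero, Finset.smul_sum, smul_smul] at hj
    rw [← Finset.Nat.sum_antidiagonal_swap] at hj
    rw [← hj]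
    refine (Finset.sum_subset (fun p hp => ?_) fun p hp hp' => ?_).trans
      (Finset.sum_congr rfl fun p hp => ?_)
    · exact Finset.HasAntidiagonal.mem_antidiagonal.2 (Finset.mem_filter.1 hp).2
    · simp only [Finset.mem_filter, Finset.mem_product, Finset.mem_range, not_and] at hp'
      -- A point of the antidiagonal outside the square of summation has a coordinate beyond the
      -- last nonzero bracket.
      rcases lt_or_ge p.1 M with h | h
      · rw [hE0 p.2]
        · simp
        · by_contra hcon
          exact hp' ⟨by omega, by omega⟩ (Finset.HasAntidiagonal.mem_antidiagonal.1 hp)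
      · simp [hC0 p.1 h]
    · simp only [Prod.fst_swap, Prod.snd_swap]
      congr 1
      rw [← Finset.HasAntidiagonal.mem_antidiagonal.1 hp, pow_add]
      have : ((-1 : K) ^ p.2) * (-1) ^ p.2 = 1 := by
        rw [← mul_pow]; simp
      linear_combination (-(-1 : K) ^ p.1 * (p.1.factorial : K)⁻¹ * (p.2.factorial : K)⁻¹) * this
  -- The derivation rule gives `k + 1` equal terms, and `(k + 1) / (k + 1)! = 1 / k!`; they cancel
  -- the brackets with `1 ⊗ d` of `μ` as inner entry.
  have h2 : g.formsD n (∑ k ∈ Finset.range (M + 1), ((k.factorial : K)⁻¹) • E k) =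
      -∑ l ∈ Finset.range (M + 1), ((-1 : K) ^ l * (l.factorial : K)⁻¹) •
        g.bracketCons μ l (g.formsD n μ) := by
    rw [map_sum, Finset.sum_range_succ', Finset.sum_range_succ _ M, hC0 M le_rfl]
    have h0 : E 0 = 0 := by simp only [hE, g.extendedBracket_eq_zero g.bracket_zero]; rfl
    rw [h0, smul_zero, map_zero, add_zero, LinearMap.zero_apply, smul_zero, add_zero,
      ← Finset.sum_neg_distrib]
    refine Finset.sum_congr rfl fun k _ => ?_
    rw [map_smul, g.formsD_extendedBracket_diag hμ, smul_smul, ← neg_smul]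
    congr 1
    have hk : (k : K) + 1 ≠ 0 := by exact_mod_cast Nat.succ_ne_zero k
    have hf : (k.factorial : K) ≠ 0 := by exact_mod_cast k.factorial_ne_zero
    rw [Nat.factorial_succ]
    push_cast
    field_simp
    ring
  rw [g.curvature_eq hM' (by omega)]
  simp only [map_add, smul_add, Finset.sum_add_distrib, formsD_formsD, add_zero]
  rw [h1, h2]
  abel

end Curvature

end LInfinityAlgebra

/-! ### The total differential and the Poincaré lemma with coefficients -/

namespace LInfinityAlgebra

section TotalDifferential

variable {K : Type v} {V W : Type u} [Field K] [AddCommGroup V] [Module K V]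
  [AddCommGroup W] [Module K W] (g : LInfinityAlgebra K V) (n : ℕ)

/-- Linear maps out of `V ⊗ Ω_n` agree if they agree on the pure tensors with a homogeneous first
factor. -/
lemma tensor_hom_ext {M : Type*} [AddCommGroup M] [Module K M] {n : ℕ}
    {F G : V ⊗[K] Forms K n →ₗ[K] M}
    (h : ∀ d, ∀ x ∈ g.grading d, ∀ ω, F (x ⊗ₜ ω) = G (x ⊗ₜ ω)) : F = G := by
  apply TensorProduct.ext'
  intro x ω
  induction x using g.induction_homogeneous with
  | h d x hx => exact h d x hx ω
  | h0 => simp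
  | hadd x y hx hy => rw [TensorProduct.add_tmul, map_add, map_add, hx, hy]

/-- The total differential `δ ⊗ 1 + 1 ⊗ d`. -/
def totalD : V ⊗[K] Forms K n →ₗ[K] V ⊗[K] Forms K n :=
  TensorProduct.map g.delta LinearMap.id + g.formsD n

variable {n}

lemma extendedBracket_one (z : Fin 1 → V ⊗[K] Forms K n) :
    g.extendedBracket n 1 z = TensorProduct.map g.delta LinearMap.id (z 0) := by
  have h : (MultilinearMap.ofSubsingleton K (V ⊗[K] Forms K n) (V ⊗[K] Forms K n) (0 : Fin 1)).symm
      (g.extendedBracket n 1) = TensorProduct.map g.delta LinearMap.id := by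
    apply g.tensor_hom_ext
    intro d x hx ω
    change g.extendedBracket n 1 (fun _ => x ⊗ₜ ω) = _
    simp only [extendedBracket, sum_apply, MultilinearMap.compLinearMap_apply,
      TensorProduct.map_tmul, tensorExtend_tmul, LinearMap.id_apply]
    rw [Finset.sum_eq_single fun _ => (d : ZMod 2)]
    · simp [g.parityProj_of_mem _ hx, delta_apply]
    · intro p _ hp
      have : (d : ZMod 2) ≠ p 0 := fun h => hp (funext fun i => by rw [h, Subsingleton.elim i 0])
      have h0 : g.bracket 1 (fun i => g.parityProj (p i) x) = 0 :=
        MultilinearMap.map_coord_zero _ 0 (by rw [g.parityProj_of_mem _ hx, if_neg this])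
      rw [h0, TensorProduct.zero_tmul]
    · simp
  rw [← h]
  change _ = g.extendedBracket n 1 (fun _ => z 0)
  congr 1
  funext i
  rw [Subsingleton.elim i 0]

lemma formsBracket_one (z : V ⊗[K] Forms K n) :
    g.formsBracket n 1 (fun _ => z) = g.totalD n z := by
  rw [formsBracket_diag, extendedBracket_one]
  simp [totalD]

lemma IsAbelian.curvature_eq_totalD {g : LInfinityAlgebra K V} (hg : g.IsAbelian)
    (z : V ⊗[K] Forms K n) : g.curvature n z = g.totalD n z := by
  rw [hg.curvature, formsBracket_one]

lemma totalD_tmul {d : ℤ} {x : V} (hx : x ∈ g.grading d) (ω : Forms K n) :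
    g.totalD n (x ⊗ₜ ω) = g.delta x ⊗ₜ ω + d.negOnePow • (x ⊗ₜ Forms.d ω) := by
  rw [totalD, LinearMap.add_apply, TensorProduct.map_tmul, g.formsD_tmul hx, LinearMap.id_apply]

lemma delta_mem_grading {d : ℤ} {x : V} (hx : x ∈ g.grading d) :
    g.delta x ∈ g.grading (d + 1) := by
  have h := g.bracket_mem 1 (fun _ => d) (fun _ => x) fun _ => hx
  have hd : ∑ _i : Fin 1, d + 2 - ((1 : ℕ) : ℤ) = d + 1 := by simp; ring
  rwa [hd] at h

/-- The contraction of `V ⊗ Ω_n` to the vertex `w`. -/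
def formsHomotopy (w : Fin (n + 1)) : V ⊗[K] Forms K n →ₗ[K] V ⊗[K] Forms K n :=
  TensorProduct.map (g.parityProj 0 - g.parityProj 1) (Forms.homotopy w)

lemma formsHomotopy_tmul (w : Fin (n + 1)) {d : ℤ} {x : V} (hx : x ∈ g.grading d)
    (ω : Forms K n) : g.formsHomotopy w (x ⊗ₜ ω) = d.negOnePow • (x ⊗ₜ Forms.homotopy w ω) := by
  rw [formsHomotopy, TensorProduct.map_tmul, g.parityProj_sub_of_mem hx, smul_tmul_units]

lemma units_smul_map {M N : Type*} [AddCommGroup M] [AddCommGroup N] [Module K M] [Module K N]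
    (F : M →ₗ[K] N) (e : ℤˣ) (x : M) : F (e • x) = e • F x := by
  rw [Units.smul_def, map_zsmul, ← Units.smul_def]

/-- The Poincaré lemma. -/
lemma formsHomotopy_totalD [CharZero K] (w : Fin (n + 1)) (z : V ⊗[K] Forms K n) :
    g.formsHomotopy w (g.totalD n z) + g.totalD n (g.formsHomotopy w z) =
      z - TensorProduct.map LinearMap.id (Forms.pullback fun _ : Fin (n + 1) => w).toLinearMap z := by
  have h : g.formsHomotopy w ∘ₗ g.totalD n + g.totalD n ∘ₗ g.formsHomotopy w =
      LinearMap.id - TensorProduct.map LinearMap.id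
        (Forms.pullback fun _ : Fin (n + 1) => w).toLinearMap := by
    apply g.tensor_hom_ext
    intro d x hx ω
    simp only [LinearMap.add_apply, LinearMap.comp_apply, LinearMap.sub_apply, LinearMap.id_apply,
      TensorProduct.map_tmul, AlgHom.toLinearMap_apply]
    -- The two terms with `δ` carry the signs `(-1)^(d+1)` and `(-1)^d` and cancel. The two terms
    -- with the de Rham differential carry `(-1)^d` twice and reduce to `homotopy_d`.
    rw [g.totalD_tmul hx, g.formsHomotopy_tmul w hx, map_add, units_smul_map, units_smul_map,
      g.formsHomotopy_tmul w hx, g.totalD_tmul hx, g.formsHomotopy_tmul w (g.delta_mem_grading hx),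
      smul_add, smul_smul, smul_smul, ← Int.negOnePow_add, Int.negOnePow_even (d + d) ⟨d, rfl⟩,
      one_smul, one_smul, Int.negOnePow_succ, ← TensorProduct.tmul_sub, ← Forms.homotopy_d,
      TensorProduct.tmul_add, Units.neg_smul]
    abel
  exact LinearMap.congr_fun h z

lemma formsHomotopy_mem (w : Fin (n + 1)) {m : ℤ} {z : V ⊗[K] Forms K n}
    (hz : z ∈ g.formsGrading n (m + 1)) : g.formsHomotopy w z ∈ g.formsGrading n m := by
  induction hz using Submodule.span_induction with
  | mem z hz =>
    obtain ⟨p, x, ω, hx, hω, rfl⟩ := hz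
    rw [g.formsHomotopy_tmul w hx, units_smul_mem_iff]
    have h := Forms.homotopy_mem (w := w) hω
    rcases p with _ | p
    -- On functions the homotopy vanishes, so no component of form degree `-1` arises.
    · rw [(Submodule.mem_bot K).1 h, TensorProduct.tmul_zero]
      exact zero_mem _
    · refine Submodule.subset_span ⟨p, x, _, ?_, h, rfl⟩
      have : m + 1 - ((p + 1 : ℕ) : ℤ) = m - p := by push_cast; ring
      rwa [this] at hx
  | zero => rw [map_zero]; exact zero_mem _
  | add x y _ _ hx hy => rw [map_add]; exact add_mem hx hy
  | smul r x _ hx => rw [map_smul]; exact Submodule.smul_mem _ _ hx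

variable {g} {h : LInfinityAlgebra K W}

lemma IsHom.map_totalD {f : V →ₗ[K] W} (hf : IsHom g h f) {m : ℕ}
    (θ : Fin (m + 1) → Fin (n + 1)) (z : V ⊗[K] Forms K n) :
    TensorProduct.map f (Forms.pullback θ).toLinearMap (g.totalD n z) =
      h.totalD m (TensorProduct.map f (Forms.pullback θ).toLinearMap z) := by
  rw [← formsBracket_one, ← formsBracket_one, hf.map_formsBracket]

lemma map_pullback_id (f : V →ₗ[K] W) :
    TensorProduct.map f (Forms.pullback (K := K) fun i : Fin (n + 1) => i).toLinearMap =
      TensorProduct.map f LinearMap.id := by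
  rw [Forms.pullback_id]; rfl

lemma IsHom.map_id_totalD {f : V →ₗ[K] W} (hf : IsHom g h f) (z : V ⊗[K] Forms K n) :
    TensorProduct.map f LinearMap.id (g.totalD n z) =
      h.totalD n (TensorProduct.map f LinearMap.id z) := by
  have := hf.map_totalD (fun i : Fin (n + 1) => i) z
  rwa [map_pullback_id] at this

lemma IsHom.map_id_curvature {f : V →ₗ[K] W} (hf : IsHom g h f) (hg : g.IsNilpotent)
    (z : V ⊗[K] Forms K n) : TensorProduct.map f LinearMap.id (g.curvature n z) =
      h.curvature n (TensorProduct.map f LinearMap.id z) := by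
  have := hf.map_curvature hg (fun i : Fin (n + 1) => i) z
  rwa [map_pullback_id] at this

lemma map_mem_formsGrading {f : V →ₗ[K] W} (hf : ∀ d, ∀ x ∈ g.grading d, f x ∈ h.grading d)
    {m : ℕ} (θ : Fin (m + 1) → Fin (n + 1)) {c : ℤ} {z : V ⊗[K] Forms K n}
    (hz : z ∈ g.formsGrading n c) :
    TensorProduct.map f (Forms.pullback θ).toLinearMap z ∈ h.formsGrading m c := by
  have : (g.formsGrading n c).map (TensorProduct.map f (Forms.pullback θ).toLinearMap) ≤
      h.formsGrading m c := by
    rw [formsGrading, Submodule.map_span_le]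
    rintro _ ⟨p, x, ω, hx, hω, rfl⟩
    exact Submodule.subset_span ⟨p, f x, Forms.pullback θ ω, hf _ _ hx,
      Forms.pullback_homogeneous θ p hω, rfl⟩
  exact this ⟨z, hz, rfl⟩

lemma map_id_mem_formsGrading {f : V →ₗ[K] W}
    (hf : ∀ d, ∀ x ∈ g.grading d, f x ∈ h.grading d) {c : ℤ} {z : V ⊗[K] Forms K n}
    (hz : z ∈ g.formsGrading n c) : TensorProduct.map f LinearMap.id z ∈ h.formsGrading n c := by
  have := map_mem_formsGrading hf (fun i : Fin (n + 1) => i) hz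
  rwa [map_pullback_id] at this

lemma pullback_map_comm {f : V →ₗ[K] W} {m : ℕ} (θ : Fin (m + 1) → Fin (n + 1))
    (z : V ⊗[K] Forms K n) :
    TensorProduct.map LinearMap.id (Forms.pullback θ).toLinearMap
        (TensorProduct.map f LinearMap.id z) =
      TensorProduct.map f LinearMap.id
        (TensorProduct.map LinearMap.id (Forms.pullback θ).toLinearMap z) := by
  rw [← LinearMap.comp_apply, ← TensorProduct.map_comp, ← LinearMap.comp_apply,
    ← TensorProduct.map_comp]
  rfl

end TotalDifferential

/-! ### Central extensions -/

/-- A central extension of `L∞`-algebras with abelian kernel, with a splitting of the underlying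
graded vector spaces. -/
structure CentralExtension {K : Type v} {U V W : Type u} [Field K] [AddCommGroup U] [Module K U]
    [AddCommGroup V] [Module K V] [AddCommGroup W] [Module K W] (a : LInfinityAlgebra K U)
    (e : LInfinityAlgebra K V) (b : LInfinityAlgebra K W) (ι : U →ₗ[K] V) (f : V →ₗ[K] W) where
  isHom_ι : IsHom a e ι
  isHom_f : IsHom e b f
  abelian : a.IsAbelian
  central : ∀ k, 2 ≤ k → ∀ (x : Fin k → V) i, x i ∈ LinearMap.range ι → e.bracket k x = 0
  f_comp_ι : f ∘ₗ ι = 0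
  r : V →ₗ[K] U
  s : W →ₗ[K] V
  r_grading : ∀ d, ∀ x ∈ e.grading d, r x ∈ a.grading d
  s_grading : ∀ d, ∀ x ∈ b.grading d, s x ∈ e.grading d
  r_comp_ι : r ∘ₗ ι = LinearMap.id
  f_comp_s : f ∘ₗ s = LinearMap.id
  splitting : ι ∘ₗ r + s ∘ₗ f = LinearMap.id

namespace CentralExtension

variable {K : Type v} {U V W : Type u} [Field K] [AddCommGroup U] [Module K U]
  [AddCommGroup V] [Module K V] [AddCommGroup W] [Module K W] {a : LInfinityAlgebra K U}
  {e : LInfinityAlgebra K V} {b : LInfinityAlgebra K W} {ι : U →ₗ[K] V} {f : V →ₗ[K] W}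
  (C : CentralExtension a e b ι f) {n : ℕ}

include C

lemma map_f_map_ι (α : U ⊗[K] Forms K n) :
    TensorProduct.map f LinearMap.id (TensorProduct.map ι LinearMap.id α) = 0 := by
  rw [← LinearMap.comp_apply, ← TensorProduct.map_comp, C.f_comp_ι, TensorProduct.map_zero_left,
    LinearMap.zero_apply]

lemma map_ι_injective : Function.Injective
    (TensorProduct.map ι (LinearMap.id : Forms K n →ₗ[K] Forms K n)) := by
  refine Function.LeftInverse.injective (g := TensorProduct.map C.r LinearMap.id) fun α => ?_
  rw [← LinearMap.comp_apply, ← TensorProduct.map_comp, C.r_comp_ι, LinearMap.id_comp,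
    TensorProduct.map_id, LinearMap.id_apply]

lemma map_f_map_s (z : W ⊗[K] Forms K n) :
    TensorProduct.map f LinearMap.id (TensorProduct.map C.s LinearMap.id z) = z := by
  rw [← LinearMap.comp_apply, ← TensorProduct.map_comp, C.f_comp_s, LinearMap.id_comp,
    TensorProduct.map_id, LinearMap.id_apply]

/-- Exactness after tensoring. The preimage comes from the retraction `r`, which is graded, so the
total degree is preserved. -/
lemma exists_of_map_f_eq_zero {c : ℤ} {z : V ⊗[K] Forms K n} (hz : z ∈ e.formsGrading n c)
    (h : TensorProduct.map f LinearMap.id z = 0) :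
    ∃ α ∈ a.formsGrading n c, TensorProduct.map ι LinearMap.id α = z := by
  refine ⟨TensorProduct.map C.r LinearMap.id z, map_id_mem_formsGrading C.r_grading hz, ?_⟩
  have h1 : TensorProduct.map (ι ∘ₗ C.r + C.s ∘ₗ f) (LinearMap.id : Forms K n →ₗ[K] Forms K n) z =
      z := by rw [C.splitting, TensorProduct.map_id, LinearMap.id_apply]
  have h2 : TensorProduct.map (C.s ∘ₗ f) (LinearMap.id : Forms K n →ₗ[K] Forms K n) z = 0 := by
    have := congrArg (TensorProduct.map C.s LinearMap.id) h
    rwa [← LinearMap.comp_apply, ← TensorProduct.map_comp, LinearMap.id_comp, map_zero] at this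
  rw [TensorProduct.map_add_left, LinearMap.add_apply, h2, add_zero] at h1
  rw [← LinearMap.comp_apply, ← TensorProduct.map_comp, LinearMap.id_comp]
  exact h1

/-- An element of `a ⊗ Ω_n` need not be a pure tensor. It is fixed by the projector `ι ∘ r`, so that
projector can be put into the `i`-th entry and the vanishing checked on pure tensors; parity
projections preserve the image of `ι`. -/
lemma extendedBracket_eq_zero {k : ℕ} (hk : 2 ≤ k) (z : Fin k → V ⊗[K] Forms K n) (i : Fin k)
    (α : U ⊗[K] Forms K n) (hz : z i = TensorProduct.map ι LinearMap.id α) :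
    e.extendedBracket n k z = 0 := by
  have hp : TensorProduct.map (ι ∘ₗ C.r) LinearMap.id (z i) = z i := by
    rw [hz, ← LinearMap.comp_apply, ← TensorProduct.map_comp, LinearMap.comp_assoc, C.r_comp_ι,
      LinearMap.comp_id, LinearMap.comp_id]
  have hz' : z = fun j => (if j = i then TensorProduct.map (ι ∘ₗ C.r) LinearMap.id
      else LinearMap.id : V ⊗[K] Forms K n →ₗ[K] V ⊗[K] Forms K n) (z j) := by
    funext j
    split_ifs with hj
    · rw [hj, hp]
    · rfl
  have key : (e.extendedBracket n k).compLinearMap (fun j =>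
      (if j = i then TensorProduct.map (ι ∘ₗ C.r) LinearMap.id
      else LinearMap.id : V ⊗[K] Forms K n →ₗ[K] V ⊗[K] Forms K n)) = 0 := by
    apply multilinear_ext_tmul
    intro x ω
    have hx : (fun j => (if j = i then TensorProduct.map (ι ∘ₗ C.r) LinearMap.id
        else LinearMap.id : V ⊗[K] Forms K n →ₗ[K] V ⊗[K] Forms K n) (x j ⊗ₜ ω j)) =
        fun j => (if j = i then ι (C.r (x j)) else x j) ⊗ₜ ω j := by
      funext j
      split_ifs <;> simp
    rw [MultilinearMap.compLinearMap_apply, hx]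
    simp only [extendedBracket, sum_apply, MultilinearMap.compLinearMap_apply,
      TensorProduct.map_tmul, tensorExtend_tmul]
    refine Finset.sum_eq_zero fun p _ => ?_
    rw [C.central k hk _ i, TensorProduct.zero_tmul]
    rw [if_pos rfl]
    refine ⟨a.parityProj (p i) (C.r (x i)), ?_⟩
    exact LinearMap.congr_fun (C.isHom_ι.parityProj (p i)) _
  rw [hz']
  exact DFunLike.congr_fun key z

/-- In arity at least two, multilinear expansion leaves only the term without a central entry. -/
lemma extendedBracket_add (k : ℕ) (α : U ⊗[K] Forms K n) (μ : V ⊗[K] Forms K n) :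
    (e.extendedBracket n k fun _ => TensorProduct.map ι LinearMap.id α + μ) =
      (if k = 1 then TensorProduct.map e.delta LinearMap.id (TensorProduct.map ι LinearMap.id α)
        else 0) + e.extendedBracket n k fun _ => μ := by
  rcases k with _ | _ | k
  · simp [e.extendedBracket_eq_zero e.bracket_zero]
  · simp [extendedBracket_one]
  · have h := MultilinearMap.map_add_univ (e.extendedBracket n (k + 2))
      (fun _ => TensorProduct.map ι LinearMap.id α) (fun _ => μ)
    rw [if_neg (by omega), zero_add]
    refine h.trans ((Finset.sum_eq_single ∅ (fun T _ hT => ?_) (by simp)).trans (by simp))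
    obtain ⟨i, hi⟩ := Finset.nonempty_of_ne_empty hT
    exact C.extendedBracket_eq_zero (by omega) _ i α (Finset.piecewise_eq_of_mem _ _ _ hi)

/-- The curvature is affine along the kernel with linear part the total differential. Both the
torsor structure of the fibres and the obstruction argument rest on this. -/
lemma curvature_add (he : e.IsNilpotent) (α : U ⊗[K] Forms K n) (μ : V ⊗[K] Forms K n) :
    e.curvature n (TensorProduct.map ι LinearMap.id α + μ) =
      TensorProduct.map ι LinearMap.id (a.totalD n α) + e.curvature n μ := by
  obtain ⟨N, hN⟩ := he.bracket_eq_zero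
  have hN' : ∀ k, N + 2 ≤ k → e.bracket k = 0 := fun k hk => hN k (by omega)
  rw [e.curvature_eq hN' (by omega), e.curvature_eq hN' (by omega), C.isHom_ι.map_id_totalD,
    totalD, LinearMap.add_apply, map_add]
  simp only [C.extendedBracket_add, smul_add, Finset.sum_add_distrib]
  rw [Finset.sum_eq_single 1]
  · simp
    abel
  · intro k _ hk; simp [hk]
  · intro h; simp at h

lemma add_mem_MC (he : e.IsNilpotent) {α : U ⊗[K] Forms K n} (hα : α ∈ a.MC n)
    {μ : V ⊗[K] Forms K n} (hμ : μ ∈ e.MC n) :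
    TensorProduct.map ι LinearMap.id α + μ ∈ e.MC n := by
  refine ⟨add_mem (map_id_mem_formsGrading C.isHom_ι.map_grading hα.1) hμ.1, ?_⟩
  have h := hα.2
  rw [C.abelian.curvature_eq_totalD] at h
  rw [C.curvature_add he, hμ.2, h, map_zero, add_zero]

lemma exists_add_eq (he : e.IsNilpotent) {μ ν : V ⊗[K] Forms K n} (hμ : μ ∈ e.MC n)
    (hν : ν ∈ e.MC n)
    (h : TensorProduct.map f LinearMap.id μ = TensorProduct.map f LinearMap.id ν) :
    ∃ α ∈ a.MC n, TensorProduct.map ι LinearMap.id α + μ = ν := by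
  obtain ⟨α, hα, hα'⟩ := C.exists_of_map_f_eq_zero (sub_mem hν.1 hμ.1)
    (by rw [map_sub, h, sub_self])
  have hadd : TensorProduct.map ι LinearMap.id α + μ = ν := by rw [hα', sub_add_cancel]
  refine ⟨α, ⟨hα, ?_⟩, hadd⟩
  have hc := C.curvature_add he α μ
  rw [hadd, hμ.2, hν.2, add_zero] at hc
  rw [C.abelian.curvature_eq_totalD]
  exact C.map_ι_injective (by rw [← hc, map_zero])

/-- The curvature of a lift of a Maurer-Cartan element is a cocycle of the kernel. -/
lemma exists_curvature_lift [CharZero K] (he : e.IsNilpotent) {μ : V ⊗[K] Forms K n}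
    (hμ : μ ∈ e.formsGrading n 1)
    (h : b.curvature n (TensorProduct.map f LinearMap.id μ) = 0) :
    ∃ c ∈ a.formsGrading n 2, TensorProduct.map ι LinearMap.id c = e.curvature n μ ∧
      a.totalD n c = 0 := by
  obtain ⟨c, hc, hc'⟩ := C.exists_of_map_f_eq_zero (e.curvature_mem he hμ)
    (by rw [C.isHom_f.map_id_curvature he, h])
  refine ⟨c, hc, hc', C.map_ι_injective ?_⟩
  obtain ⟨M, hM⟩ := e.bianchi he hμ
  -- The curvature is central, so for `l ≥ 1` its brackets with `μ` vanish; the terms left are `δ`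
  -- and `1 ⊗ d`.
  rw [Finset.sum_range_succ', Finset.sum_eq_zero, zero_add] at hM
  · have h0 : e.bracketCons μ 0 (e.curvature n μ) =
        TensorProduct.map e.delta LinearMap.id (e.curvature n μ) := by
      change e.extendedBracket n 1 _ = _
      rw [extendedBracket_one]
      rfl
    rw [h0] at hM
    rw [C.isHom_ι.map_id_totalD, hc', map_zero, totalD, LinearMap.add_apply, ← hM]
    simp
  · intro l _
    have : e.bracketCons μ (l + 1) (e.curvature n μ) = 0 :=
      C.extendedBracket_eq_zero (by omega) _ 0 c hc'.symm
    rw [this, smul_zero]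

/-- A Maurer-Cartan element lifts if its restriction to some vertex lifts. -/
lemma exists_lift [CharZero K] (he : e.IsNilpotent) (w : Fin (n + 1)) {ν : W ⊗[K] Forms K n}
    (hν : ν ∈ b.MC n) {μ : V ⊗[K] Forms K n} (hμ : μ ∈ e.MC n)
    (h : TensorProduct.map f LinearMap.id μ = TensorProduct.map LinearMap.id
      (Forms.pullback fun _ : Fin (n + 1) => w).toLinearMap ν) :
    ∃ μ' ∈ e.MC n, TensorProduct.map f LinearMap.id μ' = ν := by
  set θ : Fin (n + 1) → Fin (n + 1) := fun _ => w with hθ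
  set x := TensorProduct.map C.s LinearMap.id ν with hx
  have hx1 : x ∈ e.formsGrading n 1 := map_id_mem_formsGrading C.s_grading hν.1
  have hfx : TensorProduct.map f LinearMap.id x = ν := C.map_f_map_s ν
  obtain ⟨c, hc, hcx, hDc⟩ := C.exists_curvature_lift he hx1 (by rw [hfx, hν.2])
  have hθx : TensorProduct.map LinearMap.id (Forms.pullback θ).toLinearMap x ∈
      e.formsGrading n 1 := map_mem_formsGrading (fun _ _ h => h) θ hx1
  -- The given lift at the vertex and the restriction of `x` to it differ by `y` in the kernel.
  -- Comparing curvatures shows that the value of `c` at the vertex is `-Dy`.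
  obtain ⟨y, hy, hy'⟩ := C.exists_of_map_f_eq_zero (sub_mem hμ.1 hθx) (by
    rw [map_sub, h, ← pullback_map_comm, hfx, sub_self])
  have hcurv := C.curvature_add he y
    (TensorProduct.map LinearMap.id (Forms.pullback θ).toLinearMap x)
  rw [hy', sub_add_cancel, hμ.2, ← (IsHom.id e).map_curvature he θ x, ← hcx, pullback_map_comm,
    ← map_add] at hcurv
  have hcy : a.totalD n y +
      TensorProduct.map LinearMap.id (Forms.pullback θ).toLinearMap c = 0 :=
    C.map_ι_injective (by rw [← hcurv, map_zero])
  have hP := a.formsHomotopy_totalD w c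
  rw [hDc, map_zero, zero_add] at hP
  -- By the Poincaré lemma `D(hc)` is `c` minus its value at `w`; the summand `-y` supplies that
  -- value, so `β` is a primitive of `c`.
  set β := a.formsHomotopy w c - y with hβ
  have hβD : a.totalD n β = c := by
    rw [hβ, map_sub, hP, sub_sub, add_comm, hcy, sub_zero]
  have hβ1 : β ∈ a.formsGrading n 1 := by
    refine sub_mem (a.formsHomotopy_mem w ?_) hy
    rwa [one_add_one_eq_two]
  refine ⟨TensorProduct.map ι LinearMap.id (-β) + x,
    ⟨add_mem (map_id_mem_formsGrading C.isHom_ι.map_grading (neg_mem hβ1)) hx1, ?_⟩, ?_⟩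
  · rw [C.curvature_add he, ← hcx, map_neg, hβD, map_neg, neg_add_cancel]
  · rw [map_add, C.map_f_map_ι, zero_add, hfx]

end CentralExtension

end LInfinityAlgebra

/-! ### The lower central tower as a sequence of central extensions -/

namespace LInfinityAlgebra

section GradedSplitting

variable {K : Type v} {V W : Type u} [Field K] [AddCommGroup V] [Module K V]
  [AddCommGroup W] [Module K W]

/-- A surjective graded linear map has a graded section. -/
lemma IsHom.exists_graded_section {e : LInfinityAlgebra K V} {b : LInfinityAlgebra K W}
    {f : V →ₗ[K] W} (hf : IsHom e b f) (hs : Function.Surjective f) :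
    ∃ s : W →ₗ[K] V, f ∘ₗ s = LinearMap.id ∧ ∀ d, ∀ x ∈ b.grading d, s x ∈ e.grading d := by
  obtain ⟨s₀, hs₀⟩ := f.exists_rightInverse_of_surjective (LinearMap.range_eq_top.2 hs)
  -- Any linear section becomes graded when its values on degree `d` are replaced by their degree
  -- `d` components.
  set s := b.ofHomogeneous fun d => e.degreeProj d ∘ₗ s₀ ∘ₗ (b.grading d).subtype with hs
  have hsx : ∀ d, ∀ x ∈ b.grading d, s x = e.degreeProj d (s₀ x) := fun d x hx => by
    rw [hs, b.ofHomogeneous_of_mem _ hx]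
    rfl
  refine ⟨s, b.hom_ext_of_homogeneous fun d x hx => ?_, fun d x hx => ?_⟩
  · rw [LinearMap.comp_apply, hsx d x hx, hf.map_degreeProj, ← LinearMap.comp_apply f, hs₀,
      LinearMap.id_apply, b.degreeProj_of_mem d hx, if_pos rfl]
  · rw [hsx d x hx]
    exact e.degreeProj_mem d _

variable (g : LInfinityAlgebra K V) (i : ℕ)

lemma factor_mem_lcsGr_iff (x : V ⧸ g.lcs (i + 1)) :
    Submodule.factor (g.lcs_succ_le i) x = 0 ↔ x ∈ g.lcsGr i := by
  obtain ⟨y, rfl⟩ := (g.lcs (i + 1)).mkQ_surjective x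
  constructor
  · intro h
    exact ⟨y, (Submodule.Quotient.mk_eq_zero _).1 h, rfl⟩
  · rintro ⟨z, hz, hzy⟩
    rw [← hzy]
    exact (Submodule.Quotient.mk_eq_zero _).2 hz

/-- The kernel of the step is `F^i/F^{i+1}`, and a graded section `s` splits it: the retraction is
`1 - s f`. -/
lemma exists_centralExtension :
    Nonempty (CentralExtension (g.lowerCentralTower.gr i) (g.lowerCentralTower.quot (i + 1))
      (g.lowerCentralTower.quot i) (g.lcsGr i).subtype
      (Submodule.factor (g.lcs_succ_le i))) := by
  set f := Submodule.factor (g.lcs_succ_le i) with hf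
  have hstep := g.lowerCentralTower.step i
  obtain ⟨s, hs, hsd⟩ := hstep.exists_graded_section (Submodule.factor_surjective _)
  have hsf : ∀ x, f (s x) = x := LinearMap.congr_fun hs
  have hr : ∀ x, (LinearMap.id - s ∘ₗ f : _ →ₗ[K] _) x ∈ g.lcsGr i := fun x => by
    rw [← factor_mem_lcsGr_iff, LinearMap.sub_apply, map_sub]
    exact sub_eq_zero.2 (hsf _).symm
  have hιf : ∀ x : g.lcsGr i, f x = 0 := fun x => (g.factor_mem_lcsGr_iff i x).2 x.2
  exact ⟨{
    isHom_ι := g.lowerCentralTower.incl i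
    isHom_f := hstep
    abelian := g.lowerCentralTower.gr_abelian i
    central := fun k hk x j hj =>
      g.quotient_bracket_lcsGr i hk x j (by rwa [Submodule.range_subtype] at hj)
    f_comp_ι := LinearMap.ext hιf
    r := LinearMap.codRestrict (g.lcsGr i) (LinearMap.id - s ∘ₗ f) hr
    s := s
    r_grading := fun d x hx => sub_mem hx (hsd d _ (hstep.map_grading d x hx))
    s_grading := hsd
    r_comp_ι := by
      ext x
      simp [hιf]
    f_comp_s := hs
    splitting := by
      ext x
      simp }⟩

end GradedSplitting

end LInfinityAlgebra

/-! ### Principal fibrations and the Kan condition -/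

section PrincipalFibration

open CategoryTheory Simplicial Opposite

namespace SSet

lemma δ_δ_of_isCompatible {Z : SSet.{u}} {n : ℕ} {k : Fin (n + 3)}
    {f : ∀ j : Fin (n + 3), j ≠ k → (Δ[n + 1] ⟶ Z)} (hf : horn.IsCompatible f)
    (a b : Fin (n + 2)) (hab : a ≤ b) (ha : a.castSucc ≠ k) (hb : b.succ ≠ k) :
    Z.δ b (yonedaEquiv (f a.castSucc ha)) = Z.δ a (yonedaEquiv (f b.succ hb)) := by
  have h := hf a.castSucc b.succ ha hb (Fin.castSucc_lt_succ_iff.2 hab)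
  rw [← stdSimplex.yonedaEquiv_δ_comp, ← stdSimplex.yonedaEquiv_δ_comp]
  exact congrArg _ h

/-- The Kan condition in terms of the faces of simplices. -/
lemma kanComplex_iff_exists_faces {Z : SSet.{u}} : KanComplex Z ↔
    ∀ (n : ℕ) (k : Fin (n + 3)) (y : Fin (n + 3) → Z _⦋n + 1⦌),
      (∀ a b : Fin (n + 2), a ≤ b → a.castSucc ≠ k → b.succ ≠ k →
        Z.δ b (y a.castSucc) = Z.δ a (y b.succ)) →
      ∃ z : Z _⦋n + 2⦌, ∀ j, j ≠ k → Z.δ j z = y j := by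
  rw [KanComplex.iff]
  constructor
  · intro h n k y hy
    obtain ⟨φ, hφ⟩ := h (n := n + 1) (i := k) (fun j _ => yonedaEquiv.symm (y j)) (by
      intro j l hj hl hjl
      rw [stdSimplex.δ_comp_yonedaEquiv_symm, stdSimplex.δ_comp_yonedaEquiv_symm]
      obtain ⟨a, rfl⟩ := j.eq_castSucc_of_ne_last (Fin.ne_last_of_lt hjl)
      obtain ⟨b, rfl⟩ := l.eq_succ_of_ne_zero (Fin.ne_zero_of_lt hjl)
      rw [Fin.pred_succ, Fin.castPred_castSucc,
        hy a b (Fin.castSucc_lt_succ_iff.1 hjl) hj hl])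
    refine ⟨yonedaEquiv φ, fun j hj => ?_⟩
    rw [← stdSimplex.yonedaEquiv_δ_comp, hφ j hj, Equiv.apply_symm_apply]
  · intro h n k f hf
    rcases n with _ | n
    · have hk : ∀ k : Fin 2, ∃ j : Fin 2, j ≠ k ∧ ∀ l, l ≠ k → l = j := by decide
      -- A one-dimensional horn is a single vertex, filled by a degenerate edge.
      obtain ⟨j, hj, hj'⟩ := hk k
      refine ⟨yonedaEquiv.symm (Z.σ 0 (yonedaEquiv (f j hj))), fun l hl => ?_⟩
      obtain rfl := hj' l hl
      rw [stdSimplex.δ_comp_yonedaEquiv_symm, Equiv.symm_apply_eq]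
      rcases Fin.exists_fin_two.1 ⟨l, rfl⟩ with rfl | rfl
      · exact δ_comp_σ_self_apply (S := Z) 0 _
      · exact δ_comp_σ_succ_apply (S := Z) 0 _
    · obtain ⟨j₀, hj₀⟩ := exists_ne k
      obtain ⟨z, hz⟩ := h n k
        -- The value at the missing face `k` is arbitrary; some existing face serves as a default.
        (fun j => if hj : j ≠ k then yonedaEquiv (f j hj) else yonedaEquiv (f j₀ hj₀)) (by
          intro a b hab ha hb
          rw [dif_pos ha, dif_pos hb]
          exact δ_δ_of_isCompatible hf a b hab ha hb)
      refine ⟨yonedaEquiv.symm z, fun j hj => ?_⟩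
      rw [stdSimplex.δ_comp_yonedaEquiv_symm, hz j hj, dif_pos hj, Equiv.symm_apply_apply]

/-! ### Horn filling in simplicial abelian groups -/

section Moore

variable {G : SSet.{u}} [∀ n, AddCommGroup (G.obj n)]
  (hadd : ∀ {m n : SimplexCategoryᵒᵖ} (f : m ⟶ n) (a b : G.obj m),
    G.map f (a + b) = G.map f a + G.map f b)

include hadd

lemma map_sub_of_map_add {m n : SimplexCategoryᵒᵖ} (f : m ⟶ n) (a b : G.obj m) :
    G.map f (a - b) = G.map f a - G.map f b :=
  map_sub (AddMonoidHom.mk' (G.map f) (hadd f)) a b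

lemma map_zero_of_map_add {m n : SimplexCategoryᵒᵖ} (f : m ⟶ n) :
    G.map f (0 : G.obj m) = 0 :=
  map_zero (AddMonoidHom.mk' (G.map f) (hadd f))

variable {n : ℕ} {k : Fin (n + 3)} {y : Fin (n + 3) → G _⦋n + 1⦌}
  (hy : ∀ a b : Fin (n + 2), a ≤ b → a.castSucc ≠ k → b.succ ≠ k →
    G.δ b (y a.castSucc) = G.δ a (y b.succ))

include hy

/-- Correct the faces in increasing order by adding `s_r(y_r - d_r u)`. For `j < r` the identity
`d_j s_r = s_{r-1} d_j` shows that face `j` is undisturbed, as `d_j` of the error is zero by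
compatibility. -/
lemma exists_faces_lt (r : ℕ) (hr : r ≤ k) :
    ∃ u : G _⦋n + 2⦌, ∀ j : Fin (n + 3), (j : ℕ) < r → G.δ j u = y j := by
  induction r with
  | zero => exact ⟨0, fun j hj => absurd hj (Nat.not_lt_zero _)⟩
  | succ r ih =>
    obtain ⟨u, hu⟩ := ih (by omega)
    have hr2 : r < n + 2 := by omega
    set i : Fin (n + 2) := ⟨r, hr2⟩ with hi
    set x := y i.castSucc - G.δ i.castSucc u with hx
    refine ⟨u + G.σ i x, fun j hj => ?_⟩
    have hδ : ∀ a b : G _⦋n + 2⦌, G.δ j (a + b) = G.δ j a + G.δ j b := hadd _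
    rw [hδ]
    rcases Nat.lt_succ_iff_lt_or_eq.1 hj with hj | hj
    · rw [hu j hj]
      have hjn : j ≠ k := by rintro rfl; omega
      obtain ⟨a, rfl⟩ : ∃ a : Fin (n + 2), j = a.castSucc := ⟨⟨j, by omega⟩, rfl⟩
      obtain ⟨b, hb⟩ : ∃ b : Fin (n + 1), i = b.succ :=
        ⟨⟨r - 1, by omega⟩, Fin.ext (by simp [hi]; simp at hj; omega)⟩
      have hab : a ≤ b.castSucc := by
        have := congrArg Fin.val hb
        simp [hi] at this hj
        rw [Fin.le_def]; simp; omega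
      have hx0 : G.δ a x = 0 := by
        have hik : i.castSucc ≠ k := by
          intro h; have := congrArg Fin.val h; simp [hi] at this; omega
        have h1 := δ_comp_δ_apply (S := G) hab u
        have h2 := hy a b.castSucc hab hjn (by rwa [Fin.succ_castSucc, ← hb])
        have e : b.castSucc.succ = i.castSucc := by rw [Fin.succ_castSucc, ← hb]
        rw [e] at h1 h2
        rw [hx, show G.δ a (y i.castSucc - G.δ i.castSucc u) = G.δ a (y i.castSucc) -
          G.δ a (G.δ i.castSucc u) from map_sub_of_map_add hadd _ _ _, h1, ← h2, hu _ hj, sub_self]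
      rw [hb, δ_comp_σ_of_le_apply (S := G) hab, hx0,
        show G.σ b (0 : G _⦋n⦌) = 0 from map_zero_of_map_add hadd _, add_zero]
    · obtain rfl : j = i.castSucc := Fin.ext hj
      rw [δ_comp_σ_self_apply, hx, add_sub_cancel]

/-- Starting from the faces below `k`, correct the faces above `k` from the top downwards, now with
`s_i` for face `i + 1`, so that no correction requires the missing face. -/
lemma exists_faces (r : ℕ) :
    ∃ u : G _⦋n + 2⦌, ∀ j : Fin (n + 3), ((j : ℕ) < k ∨ (k : ℕ) < j ∧ n + 3 - r ≤ j) →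
      G.δ j u = y j := by
  induction r with
  | zero =>
    obtain ⟨u, hu⟩ := exists_faces_lt hadd hy k le_rfl
    exact ⟨u, fun j hj => hu j (by omega)⟩
  | succ r ih =>
    obtain ⟨u, hu⟩ := ih
    by_cases hrk : n + 2 - r ≤ k
    · refine ⟨u, fun j hj => hu j ?_⟩
      omega
    by_cases hrn : n + 2 ≤ r
    · omega
    -- The face treated in this step is `i + 1 = n + 2 - r`.
    set i : Fin (n + 2) := ⟨n + 1 - r, by omega⟩ with hi
    have hik : i.succ ≠ k := by
      intro h; have := congrArg Fin.val h; simp [hi] at this; omega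
    set x := y i.succ - G.δ i.succ u with hx
    refine ⟨u + G.σ i x, fun j hj => ?_⟩
    have hδ : ∀ a b : G _⦋n + 2⦌, G.δ j (a + b) = G.δ j a + G.δ j b := hadd _
    have hjk : j ≠ k := by rintro rfl; omega
    rw [hδ]
    rcases lt_trichotomy (j : ℕ) (i.succ : ℕ) with h | h | h
    · have hjk' : (j : ℕ) < k := by simp [hi] at h; omega
      rw [hu j (Or.inl hjk')]
      obtain ⟨a, rfl⟩ : ∃ a : Fin (n + 2), j = a.castSucc :=
        ⟨⟨j, by simp [hi] at h; omega⟩, rfl⟩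
      obtain ⟨b, hb⟩ : ∃ b : Fin (n + 1), i = b.succ :=
        ⟨⟨n - r, by simp at hjk'; omega⟩, Fin.ext (by simp [hi]; simp at hjk'; omega)⟩
      have hab : a ≤ b.castSucc := by
        have := congrArg Fin.val hb
        simp [hi] at this hjk'
        rw [Fin.le_def]; simp; omega
      have hx0 : G.δ a x = 0 := by
        have hai : a ≤ i := by
          rw [hb]; exact hab.trans (Fin.castSucc_lt_succ).le
        have h1 := δ_comp_δ_apply (S := G) hai u
        have h2 := hy a i hai hjk hik
        rw [hx, show G.δ a (y i.succ - G.δ i.succ u) = G.δ a (y i.succ) -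
          G.δ a (G.δ i.succ u) from map_sub_of_map_add hadd _ _ _, h1, ← h2, hu _ (Or.inl hjk'),
          sub_self]
      rw [hb, δ_comp_σ_of_le_apply (S := G) hab, hx0,
        show G.σ b (0 : G _⦋n⦌) = 0 from map_zero_of_map_add hadd _, add_zero]
    · obtain rfl : j = i.succ := Fin.ext h
      rw [δ_comp_σ_succ_apply, hx, add_sub_cancel]
    · simp [hi] at h
      have hju : (j : ℕ) < k ∨ (k : ℕ) < j ∧ n + 3 - r ≤ j := by omega
      rw [hu j hju]
      obtain ⟨a, rfl⟩ := j.eq_succ_of_ne_zero (by rintro rfl; simp at h)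
      obtain ⟨b, hb⟩ : ∃ b : Fin (n + 1), i = b.castSucc :=
        ⟨⟨n + 1 - r, by have := a.2; simp at h; omega⟩, rfl⟩
      have hab : b.castSucc < a := by
        rw [← hb, Fin.lt_def]; simp [hi]; simp at h; omega
      have hx0 : G.δ a x = 0 := by
        obtain ⟨a', rfl⟩ := a.eq_succ_of_ne_zero (by rintro rfl; simp at hab)
        have hai : i.succ ≤ a'.succ.castSucc := by
          rw [hb, ← Fin.castSucc_succ]
          exact Fin.castSucc_le_castSucc_iff.2 hab
        have e : i.succ = b.succ.castSucc := by rw [hb, Fin.castSucc_succ]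
        have hai' : b.succ ≤ a'.succ := hab
        have h1 := δ_comp_δ_apply (S := G) hai' u
        have h2 := hy b.succ a'.succ hai' (by rwa [← e]) hjk
        rw [← e] at h1 h2
        rw [hx, show G.δ a'.succ (y i.succ - G.δ i.succ u) = G.δ a'.succ (y i.succ) -
          G.δ a'.succ (G.δ i.succ u) from map_sub_of_map_add hadd _ _ _, ← h1, h2, hu _ hju,
          sub_self]
      rw [hb, δ_comp_σ_of_gt_apply (S := G) hab, hx0,
        show G.σ b (0 : G _⦋n⦌) = 0 from map_zero_of_map_add hadd _, add_zero]

end Moore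

/-- Moore's theorem: a simplicial abelian group is a Kan complex. -/
lemma exists_faces_of_simplicialAddCommGroup {G : SSet.{u}} (hG : SimplicialAddCommGroup G) {n : ℕ}
    {k : Fin (n + 3)} {y : Fin (n + 3) → G _⦋n + 1⦌}
    (hy : ∀ a b : Fin (n + 2), a ≤ b → a.castSucc ≠ k → b.succ ≠ k →
      G.δ b (y a.castSucc) = G.δ a (y b.succ)) :
    ∃ u : G _⦋n + 2⦌, ∀ j, j ≠ k → G.δ j u = y j := by
  let _ := hG.group
  obtain ⟨u, hu⟩ := exists_faces (G := G) hG.map_add hy (n + 3)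
  exact ⟨u, fun j hj => hu j (by have := Fin.val_ne_of_ne hj; omega)⟩

/-- The total space of a principal fibration onto a union of components of a Kan complex is Kan. -/
theorem kanComplex_of_isPrincipalFibration {G E B : SSet.{u}} {hG : SimplicialAddCommGroup G}
    (ρ : SimplicialAction hG E) (p : E ⟶ B) (hB : KanComplex B)
    (hr : (Subcomplex.range p).IsUnionOfComponents)
    (hp : ρ.IsPrincipalFibration (Subcomplex.toRange p)) : KanComplex E := by
  rw [kanComplex_iff_exists_faces] at hB ⊢
  intro n k y hy
  have hnat : ∀ {m n : SimplexCategoryᵒᵖ} (f : m ⟶ n) (x : E.obj m),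
      p.app n (E.map f x) = B.map f (p.app m x) := fun f x =>
    ConcreteCategory.congr_hom (p.naturality f) x
  -- The image horn is filled in the base; since one face of `b` lies in the image of `p`, so does
  -- `b`.
  obtain ⟨b, hb⟩ := hB n k (fun j => p.app _ (y j)) fun a b hab ha hb =>
    (hnat _ _).symm.trans ((congrArg _ (hy a b hab ha hb)).trans (hnat _ _))
  obtain ⟨j₀, hj₀⟩ := exists_ne k
  obtain ⟨x, hx⟩ : b ∈ (Subcomplex.range p).obj _ :=
    (hr (SimplexCategory.δ j₀).op b).1 ⟨y j₀, (hb j₀ hj₀).symm⟩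
  have hfib : ∀ j, ∃ a : G _⦋n + 1⦌, j ≠ k → ρ.act _ a (E.δ j x) = y j := by
    intro j
    by_cases hj : j = k
    -- At the missing face no condition is imposed, and zero is a default.
    · exact ⟨(hG.group _).zero, fun h => absurd hj h⟩
    obtain ⟨a, ha⟩ := (hp.fiber _ (E.δ j x) (y j)).1 (Subtype.ext (by
      change p.app _ (E.map _ x) = p.app _ (y j)
      rw [hnat, ← hb j hj]
      exact congrArg (B.map _) hx))
    exact ⟨a, fun _ => ha⟩
  choose a ha using hfib
  have hinj : ∀ (m : SimplexCategoryᵒᵖ) (c d : G.obj m) (x : E.obj m),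
      ρ.act m c x = ρ.act m d x → c = d := by
    intro m c d x h
    let _ := hG.group m
    have h1 : ρ.act m (-d + c) x = x := by
      rw [ρ.add_act, h, ← ρ.add_act, neg_add_cancel, ρ.zero_act]
    exact (neg_add_eq_zero.1 (hp.free m _ x h1)).symm
  -- The discrepancies form a horn in the group: both sides of the compatibility move the same
  -- simplex to the same place, and the action is free.
  obtain ⟨u, hu⟩ := exists_faces_of_simplicialAddCommGroup hG (k := k) (y := a) (by
    intro c d hcd hc hd
    have h := hy c d hcd hc hd
    rw [← ha _ hc, ← ha _ hd] at h
    refine hinj _ _ _ (E.δ d (E.δ c.castSucc x)) ?_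
    refine (ρ.map_act _ _ _).symm.trans (h.trans ((ρ.map_act _ _ _).trans ?_))
    exact congrArg _ (δ_comp_δ_apply (S := E) hcd x))
  refine ⟨ρ.act _ u x, fun j hj => ?_⟩
  refine (ρ.map_act _ _ _).trans ?_
  rw [← ha j hj, ← hu j hj]
  rfl

end SSet

end PrincipalFibration

open CategoryTheory in
lemma SSet.kanComplex_of_iso {X Y : SSet.{u}} (i : X ≅ Y) (h : SSet.KanComplex Y) :
    SSet.KanComplex X := by
  rw [SSet.kanComplex_iff_exists_faces] at h ⊢
  intro n k y hy
  have hnat : ∀ {m n : SimplexCategoryᵒᵖ} (f : m ⟶ n) (x : X.obj m),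
      i.hom.app n (X.map f x) = Y.map f (i.hom.app m x) := fun f x =>
    ConcreteCategory.congr_hom (i.hom.naturality f) x
  have hnat' : ∀ {m n : SimplexCategoryᵒᵖ} (f : m ⟶ n) (x : Y.obj m),
      i.inv.app n (Y.map f x) = X.map f (i.inv.app m x) := fun f x =>
    ConcreteCategory.congr_hom (i.inv.naturality f) x
  obtain ⟨z, hz⟩ := h n k (fun j => i.hom.app _ (y j)) fun a b hab ha hb =>
    (hnat _ _).symm.trans ((congrArg _ (hy a b hab ha hb)).trans (hnat _ _))
  refine ⟨i.inv.app _ z, fun j hj => (hnat' _ _).symm.trans ?_⟩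
  exact (congrArg _ (hz j hj)).trans (ConcreteCategory.congr_hom (i.hom_inv_id_app _) (y j))

/-! ### Isomorphisms, and the case of the zero algebra -/

namespace LInfinityAlgebra

section Sigma

open CategoryTheory

variable {K : Type v} [Field K] {V W : Type u} [AddCommGroup V] [Module K V] [AddCommGroup W]
  [Module K W] {g : LInfinityAlgebra K V} {h : LInfinityAlgebra K W}

/-- A strict map commutes with degree projections, so an injective one reflects homogeneity; this
makes inverses of bijective maps graded. -/
lemma IsHom.mem_grading_of_injective {f : V →ₗ[K] W} (hf : IsHom g h f)
    (hi : Function.Injective f) {d : ℤ} {x : V} (hx : f x ∈ h.grading d) : x ∈ g.grading d := by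
  have h1 : g.degreeProj d x = x := hi (by
    rw [hf.map_degreeProj, h.degreeProj_of_mem d hx, if_pos rfl])
  rw [← h1]
  exact g.degreeProj_mem d x

lemma IsHom.symm (f : V ≃ₗ[K] W) (hf : IsHom g h f.toLinearMap) :
    IsHom h g f.symm.toLinearMap where
  map_grading d x hx := hf.mem_grading_of_injective f.injective (by simpa using hx)
  map_bracket k x := f.injective (by
    have := hf.map_bracket k fun i => f.symm (x i)
    simp only [LinearEquiv.coe_coe, LinearEquiv.apply_symm_apply] at this ⊢
    exact this.symm)

lemma isIso_sigmaMap {f : V →ₗ[K] W} (hf : IsHom g h f) (hg : g.IsNilpotent) (hh : h.IsNilpotent)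
    (hbij : Function.Bijective f) : IsIso (sigmaMap hf hg hh) := by
  obtain ⟨f, rfl⟩ : ∃ f' : V ≃ₗ[K] W, f'.toLinearMap = f :=
    ⟨LinearEquiv.ofBijective f hbij, rfl⟩
  refine ⟨sigmaMap (hf.symm f) hh hg, ?_, ?_⟩
  · ext n μ
    apply Subtype.ext
    change TensorProduct.map f.symm.toLinearMap LinearMap.id
      (TensorProduct.map f.toLinearMap LinearMap.id μ.1) = μ.1
    rw [← LinearMap.comp_apply, ← TensorProduct.map_comp, LinearEquiv.symm_comp,
      LinearMap.id_comp, TensorProduct.map_id, LinearMap.id_apply]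
  · ext n μ
    apply Subtype.ext
    change TensorProduct.map f.toLinearMap LinearMap.id
      (TensorProduct.map f.symm.toLinearMap LinearMap.id μ.1) = μ.1
    rw [← LinearMap.comp_apply, ← TensorProduct.map_comp, LinearEquiv.comp_symm,
      LinearMap.id_comp, TensorProduct.map_id, LinearMap.id_apply]

lemma LowerCentralTower.isIso_sigmaProj (T : g.LowerCentralTower) (hg : g.IsNilpotent) {N : ℕ}
    (hN : g.lcs N = ⊥) : IsIso (T.sigmaProj hg N) := by
  refine isIso_sigmaMap _ _ _ ⟨?_, (g.lcs N).mkQ_surjective⟩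
  rw [← LinearMap.ker_eq_bot, Submodule.ker_mkQ, hN]

section Subsingleton

variable [Subsingleton V]

lemma subsingleton_MC (n : ℕ) : Subsingleton (g.MC n) := by
  have : Subsingleton (V ⊗[K] Forms K n) := by
    refine ⟨fun a b => ?_⟩
    have h : ∀ a : V ⊗[K] Forms K n, a = 0 := fun a => by
      induction a using TensorProduct.induction_on with
      | zero => rfl
      | tmul x ω => rw [Subsingleton.elim x 0, TensorProduct.zero_tmul]
      | add x y hx hy => rw [hx, hy, add_zero]
    rw [h a, h b]
  infer_instance

lemma zero_mem_MC (n : ℕ) : (0 : V ⊗[K] Forms K n) ∈ g.MC n := by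
  have hab : g.IsAbelian := fun k _ => MultilinearMap.ext fun x => Subsingleton.elim _ _
  exact (hab.mcSubgroup n).zero_mem

/-- `Σ(0)` is a point. -/
def sigmaIsTerminal (hg : g.IsNilpotent) : Limits.IsTerminal (g.sigma hg) :=
  Limits.IsTerminal.ofUniqueHom
    (fun X =>
      { app := fun n => TypeCat.ofHom fun _ => (⟨0, zero_mem_MC n.unop.len⟩ : g.MC n.unop.len)
        naturality := fun m n f => by
          ext x
          exact (subsingleton_MC (g := g) n.unop.len).elim _ _ })
    (fun X m => by
      ext n x
      exact (subsingleton_MC (g := g) n.unop.len).elim _ _)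

lemma kanComplex_sigma_of_subsingleton (hg : g.IsNilpotent) : SSet.KanComplex (g.sigma hg) := by
  rw [SSet.kanComplex_iff_exists_faces]
  intro n k y _
  exact ⟨⟨0, zero_mem_MC _⟩, fun j _ => (subsingleton_MC (g := g) (n + 1)).elim _ _⟩

end Subsingleton

instance subsingleton_quotient_lcs_one (g : LInfinityAlgebra K V) :
    Subsingleton (V ⧸ g.lcs 1) := by
  rw [Submodule.Quotient.subsingleton_iff, lcs_one]

end Sigma

/-! ### The principal fibration of a central extension -/

namespace CentralExtension

open CategoryTheory

variable {K : Type v} {U V W : Type u} [Field K] [AddCommGroup U] [Module K U]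
  [AddCommGroup V] [Module K V] [AddCommGroup W] [Module K W] {a : LInfinityAlgebra K U}
  {e : LInfinityAlgebra K V} {b : LInfinityAlgebra K W} {ι : U →ₗ[K] V} {f : V →ₗ[K] W}
  (C : CentralExtension a e b ι f) (he : e.IsNilpotent) (hb : b.IsNilpotent)

/-- The action of `Σ(a)` on `Σ(e)` by addition. -/
def sigmaAction : SimplicialAction C.abelian.sigmaGroup (e.sigma he) where
  act n α μ := (⟨TensorProduct.map ι LinearMap.id α.1 + μ.1, C.add_mem_MC he α.2 μ.2⟩ :
    e.MC n.unop.len)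
  zero_act n μ := by
    apply Subtype.ext
    change TensorProduct.map ι LinearMap.id 0 + μ.1 = μ.1
    rw [map_zero, zero_add]
  add_act n α β μ := by
    apply Subtype.ext
    change TensorProduct.map ι LinearMap.id (α.1 + β.1) + μ.1 =
      TensorProduct.map ι LinearMap.id α.1 + (TensorProduct.map ι LinearMap.id β.1 + μ.1)
    rw [map_add, add_assoc]
  map_act θ α μ := by
    apply Subtype.ext
    change TensorProduct.map LinearMap.id (Forms.pullback θ.unop.toOrderHom).toLinearMap
      (TensorProduct.map ι LinearMap.id α.1 + μ.1) =
      TensorProduct.map ι LinearMap.id (TensorProduct.map LinearMap.id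
        (Forms.pullback θ.unop.toOrderHom).toLinearMap α.1) +
      TensorProduct.map LinearMap.id (Forms.pullback θ.unop.toOrderHom).toLinearMap μ.1
    rw [map_add, pullback_map_comm]

lemma isPrincipalFibration : (C.sigmaAction he).IsPrincipalFibration
    (SSet.Subcomplex.toRange (sigmaMap C.isHom_f he hb)) where
  free n α μ h := by
    have h1 : TensorProduct.map ι LinearMap.id α.1 + μ.1 = μ.1 := congrArg Subtype.val h
    apply Subtype.ext
    exact C.map_ι_injective ((add_eq_right.1 h1).trans (map_zero _).symm)
  surjective n := by
    rintro ⟨_, x, rfl⟩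
    exact ⟨x, rfl⟩
  fiber n μ ν := by
    have hf : (SSet.Subcomplex.toRange (sigmaMap C.isHom_f he hb)).app n μ =
        (SSet.Subcomplex.toRange (sigmaMap C.isHom_f he hb)).app n ν ↔
        TensorProduct.map f LinearMap.id μ.1 = TensorProduct.map f LinearMap.id ν.1 :=
      ⟨fun h => congrArg (fun z => z.1.1) h, fun h => Subtype.ext (Subtype.ext h)⟩
    rw [hf]
    constructor
    · intro h
      obtain ⟨α, hα, hα'⟩ := C.exists_add_eq he μ.2 ν.2 h
      exact ⟨⟨α, hα⟩, Subtype.ext hα'⟩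
    · rintro ⟨α, rfl⟩
      change _ = TensorProduct.map f LinearMap.id (TensorProduct.map ι LinearMap.id α.1 + μ.1)
      rw [map_add, C.map_f_map_ι, zero_add]

lemma isUnionOfComponents [CharZero K] :
    (SSet.Subcomplex.range (sigmaMap C.isHom_f he hb)).IsUnionOfComponents := by
  have hnat : ∀ {m n : SimplexCategoryᵒᵖ} (θ : m ⟶ n) (μ : (e.sigma he).obj m),
      (sigmaMap C.isHom_f he hb).app n ((e.sigma he).map θ μ) =
        (b.sigma hb).map θ ((sigmaMap C.isHom_f he hb).app m μ) := fun θ μ =>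
    ConcreteCategory.congr_hom ((sigmaMap C.isHom_f he hb).naturality θ) μ
  intro m n θ ν
  constructor
  · rintro ⟨μ, hμ⟩
    -- Restricting the lift to a vertex and pulling back to the original simplex makes `θ ≫ τ` the
    -- collapse to the vertex `θ 0`, the form in which `exists_lift` takes its hypothesis.
    let τ : n ⟶ m := (SimplexCategory.const m.unop n.unop 0).op
    have hτ : (sigmaMap C.isHom_f he hb).app m ((e.sigma he).map τ μ) =
        (b.sigma hb).map (θ ≫ τ) ν := by
      rw [hnat, hμ, Functor.map_comp]
      rfl
    obtain ⟨μ', hμ', h⟩ := C.exists_lift he (θ.unop.toOrderHom 0) ν.2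
      ((e.sigma he).map τ μ).2 (congrArg Subtype.val hτ)
    exact ⟨⟨μ', hμ'⟩, Subtype.ext h⟩
  · rintro ⟨μ, rfl⟩
    exact ⟨(e.sigma he).map θ μ, hnat θ μ⟩

end CentralExtension

end LInfinityAlgebra

end

/-! ### Induction along the tower -/

theorem mainTheorem7 {K : Type v} [Field K] [CharZero K] {V : Type u} [AddCommGroup V] [Module K V]
    (g : LInfinityAlgebra K V) (hg : g.IsNilpotent) :
    SSet.KanComplex (g.sigma hg) ∧
    ∃ T : g.LowerCentralTower,
      Nonempty (CategoryTheory.Limits.IsTerminal (T.sigmaQuot 1)) ∧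
      (∀ N, g.lcs N = ⊥ → CategoryTheory.IsIso (T.sigmaProj hg N)) ∧
      ∀ i, 1 ≤ i →
        (SSet.Subcomplex.range (T.sigmaStep i)).IsUnionOfComponents ∧
        ∃ ρ : SimplicialAction (T.sigmaGrGroup i) (T.sigmaQuot (i + 1)),
          T.IsAdditiveAction i ρ ∧
          ρ.IsPrincipalFibration (SSet.Subcomplex.toRange (T.sigmaStep i)) := by
  let T := g.lowerCentralTower
  let C := fun i => (g.exists_centralExtension i).some
  have hcomp : ∀ i, (SSet.Subcomplex.range (T.sigmaStep i)).IsUnionOfComponents := fun i =>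
    (C i).isUnionOfComponents (T.quot_nilpotent (i + 1)) (T.quot_nilpotent i)
  have hprin : ∀ i, ((C i).sigmaAction (T.quot_nilpotent (i + 1))).IsPrincipalFibration
      (SSet.Subcomplex.toRange (T.sigmaStep i)) := fun i =>
    (C i).isPrincipalFibration (T.quot_nilpotent (i + 1)) (T.quot_nilpotent i)
  have hKan : ∀ i, SSet.KanComplex (T.sigmaQuot (i + 1)) := by
    intro i
    induction i with
    | zero => exact LInfinityAlgebra.kanComplex_sigma_of_subsingleton (V := V ⧸ g.lcs 1) _
    | succ i ih => exact SSet.kanComplex_of_isPrincipalFibration _ _ ih (hcomp _) (hprin _)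
  refine ⟨?_, T, ⟨LInfinityAlgebra.sigmaIsTerminal _⟩, fun N hN => T.isIso_sigmaProj hg hN,
    fun i _ => ⟨hcomp i, _, fun n α μ => rfl, hprin i⟩⟩
  obtain ⟨N, hN⟩ := hg
  -- The induction covers only the stages from `F^1` on, so a possible `N = 0` is avoided by passing
  -- to `N + 1`.
  have hN' : g.lcs (N + 1) = ⊥ := by
    rw [eq_bot_iff, ← hN]
    exact g.lcs_succ_le N
  have := T.isIso_sigmaProj ⟨N, hN⟩ hN'
  exact SSet.kanComplex_of_iso (CategoryTheory.asIso (T.sigmaProj ⟨N, hN⟩ (N + 1))) (hKan N)
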